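/- **Setting.** Graphs are finite loopless multigraphs of maximum degree at most $4$. An *$st$-graph* is a connected graph $G$ with two distinct poles $s,t$ such that $G+st$ is biconnected (connected without cutvertices) and planar. The *series composition* of $st$-graphs $G_1,G_2$ identifies $t_1$ with $s_2$ and has the poles $s_1,t_2$. The *parallel composition* identifies $s_1$ with $s_2$ (pole $s$) and $t_1$ with $t_2$ (pole $t$). An *orthogonal representation* of $G$ is a planar embedding of $G$ with $s$ and $t$ on the outer face, together with an integer rotation for every edge–face incidence and every vertex–face incidence, such that: the rotations in a face sum to $4$ ($-4$ for the outer face); the two rotations of an edge on its two sides sum to $0$; the rotations around a vertex $v$ sum to $2\deg(v)-4$; and rotations at vertices lie in $[-2,1]$ (rotation $r$ at a vertex is the angle $(2-r)\cdot 90^\circ$). An edge has $|r|$ bends if its rotation is $\pm r$. Let $\pi(s,t)$ and $\pi(t,s)$ be the paths from $s$ to $t$ and from $t$ to $s$ in counter-clockwise direction along the outer face, and let $\mathrm{rot}(\pi)$ be the sum of the rotations, in the outer face, of the edges and the inner vertices of $\pi$. The representation has $\max\{|\mathrm{rot}(\pi(s,t))|,|\mathrm{rot}(\pi(t,s))|\}$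 *bends*, and it is a *$(\sigma,\tau)$-orthogonal representation* if $s$ and $t$ have the rotations $\sigma-3$ and $\tau-3$ in the outer face. Every edge $e$ has a cost function $\mathrm{cost}_e:\mathbb N\to\mathbb R\cup\{\infty\}$ of its number of bends, and the cost of a representation is the sum over its edges. The *cost functions* of $G$ are the functions $\mathrm{cost}^\sigma_\tau$, $\sigma,\tau\in\{1,\dots,4\}$, where $\mathrm{cost}^\sigma_\tau(\beta)$ is the minimum cost of the $(\sigma,\tau)$-orthogonal representations of $G$ with $\beta$ bends ($\infty$ if there are none). Given a set $W$ of vertices, the *restricted* cost functions take the minimum only over those representations in which every vertex of $W$ that has degree $2$ in the graph forms a $90^\circ$ angle, that is, has rotation $1$ at one of its two incidences. For a parallel composition, only embeddings in which $G_1$ and $G_2$ are placed next to each other (in either order) are considered: around $s$, starting at the outer face, all edges of one of the two graphs precede all edges of the other, and around $t$ likewise with the roles exchanged. **Statement.** Let $G_1,G_2$ be $st$-graphs with edge costs, let $G$ be their series or parallel composition with the inherited edge costs, and let $W$ be a set of vertices of $G$ that have degree at most $2$ in $G$ ($W=\emptyset$ is the non-restricted case). Suppose that the minima defining the cost functions of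 $G_1$ and $G_2$, restricted to the vertices of $W$ in $G_1$ and $G_2$, respectively, exist, and that these functions are $\infty$ for all bend numbers larger than $\ell$. Then the minima defining the cost functions of $G$ restricted to $W$ exist, and these cost functions can be computed from $\ell$ and the tables of the cost functions of $G_1$ and $G_2$ for the bend numbers $0,\dots,\ell$, and the information which of the identified vertices belong to $W$: 1. in $O(\ell^2)$ time for the series composition; 2. in $O(\ell)$ time for the parallel composition. More precisely, for each of the two compositions there are one random access machine program and one constant $C$, independent of $G_1,G_2,W,\ell$ and the costs, such that the program makes at most $C(\ell^2+1)$ and $C(\ell+1)$ steps, respectively, and outputs a number $m$ and the tables of the cost functions of $G$ for bend numbers $0,\dots,m$, these functions being $\infty$ above $m$. The machine has integer registers (constants, addition, subtraction, comparison), registers for elements of $\mathbb R\cup\{\infty\}$ (the constant $\infty$, addition, comparison) and arrays of such elements indexed by integer registers; every operation takes one step. -/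

import Mathlib

namespace BendCost

open Equiv

/-! ### Multigraphs, poles, embeddings -/

/-- A multigraph with vertex type `V` and edge type `E`. The edge `e` has the two end vertices
`ends e false` and `ends e true`. -/
structure Multigraph (V E : Type) where
  ends : E → Bool → V

namespace Multigraph

variable {V E : Type} (G : Multigraph V E)

/-- A dart `(e, b)` is the edge `e` directed away from its end vertex `ends e b`. -/
def tail (d : E × Bool) : V := G.ends d.1 d.2

/-- The number of edge ends at a vertex. -/
noncomputable def degree (v : V) : ℕ := Nat.card {d : E × Bool // G.tail d = v}

def Loopless : Prop := ∀ e, G.ends e false ≠ G.ends e true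

/-- The underlying simple graph, used for connectivity notions. -/
def simple : SimpleGraph V :=
  SimpleGraph.fromRel fun u v => ∃ e, G.ends e false = u ∧ G.ends e true = v

/-- Connected, and no vertex is a cutvertex. -/
def Biconnected : Prop :=
  G.simple.Connected ∧ ∀ v : V, (G.simple.induce {v}ᶜ).Preconnected

/-- The multigraph with one additional edge `none` between `s` and `t`. -/
def addEdge (s t : V) : Multigraph V (Option E) where
  ends := fun e b => e.elim (if b then t else s) (fun e => G.ends e b)

end Multigraph

/-- Reversal of darts. -/
def rev (E : Type) : Perm (E × Bool) := Equiv.prodCongr (Equiv.refl E) Equiv.boolNot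

/-- A (combinatorial) planar embedding of a connected multigraph: `next` sends each dart to the
counter-clockwise next dart at the same vertex. Traversing `d` and then the dart
`next (rev d)`, and so on, traverses the face to the right of `d`; the faces are the orbits of
this permutation. Planarity is Euler's formula. -/
structure Embedding {V E : Type} (G : Multigraph V E) where
  next : Perm (E × Bool)
  sameCycle_next : ∀ d d', next.SameCycle d d' ↔ G.tail d = G.tail d'
  euler : Nat.card V + Nat.card (Quotient (Perm.SameCycle.setoid (next * rev E))) =
    Nat.card E + 2

namespace Embedding

variable {V E : Type} {G : Multigraph V E} (R : Embedding G)

/-- The successor of a dart on the boundary of the face to its right. -/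
def face : Perm (E × Bool) := R.next * rev E

end Embedding

/-- A multigraph with two designated vertices. -/
structure PoleGraph (V E : Type) extends Multigraph V E where
  s : V
  t : V

/-- An `st`-graph of maximum degree at most four (loopless, parallel edges allowed): a connected
graph `G` with distinct poles `s`, `t` such that `G + st` is biconnected and planar. -/
structure PoleGraph.IsSTGraph {V E : Type} (G : PoleGraph V E) : Prop where
  poles_ne : G.s ≠ G.t
  loopless : G.Loopless
  connected : G.simple.Connected
  biconnected : (G.addEdge G.s G.t).Biconnected
  planar : Nonempty (Embedding (G.addEdge G.s G.t))
  degree_le : ∀ v, G.degree v ≤ 4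

/-! ### Orthogonal representations of `st`-graphs -/

open Classical in
/-- An orthogonal representation of an `st`-graph with both poles on the outer face.

* `eRot d` is the rotation of the edge of `d` in the face to the right of `d`.
* `vRot d` is the rotation of the vertex `tail d` at its incidence (angle) to the face on the
  right of `d`, namely the one directly preceding `d` on that face: it lies between the
  counter-clockwise predecessor of `d` and `d`. An angle `α` has rotation `2 - α / 90°`.
* The outer face is the face on the right of `outS` (a dart leaving `s`), and also on the right
  of `outT` (a dart leaving `t`).

Faces are traversed with the face on the right, that is clockwise for inner faces and
counter-clockwise for the outer face. -/
structure OrthRep {V E : Type} [Fintype E] (G : PoleGraph V E) extends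
    Embedding G.toMultigraph where
  eRot : E × Bool → ℤ
  vRot : E × Bool → ℤ
  outS : E × Bool
  outT : E × Bool
  tail_outS : G.tail outS = G.s
  tail_outT : G.tail outT = G.t
  same_outer : toEmbedding.face.SameCycle outS outT
  /-- The rotations in the outer face add up to `-4`. -/
  sum_outer : ∑ x with toEmbedding.face.SameCycle outS x, (eRot x + vRot x) = -4
  /-- The rotations in every other face add up to `4`. -/
  sum_inner : ∀ d, ¬ toEmbedding.face.SameCycle outS d →
    ∑ x with toEmbedding.face.SameCycle d x, (eRot x + vRot x) = 4
  edge_rot : ∀ d, eRot d + eRot (rev E d) = 0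
  sum_vertex : ∀ v, ∑ d with G.tail d = v, vRot d = 2 * (G.degree v : ℤ) - 4
  vRot_mem : ∀ d, vRot d ∈ Set.Icc (-2) 1

namespace OrthRep

variable {V E : Type} [Fintype E] {G : PoleGraph V E} (R : OrthRep G)

/-- The rotation of the path that starts with the dart `a` and follows the face on its right up
to the start vertex of the dart `b`: all edges of the path, and its inner vertices, are counted
(`a ≠ b` on the same face). -/
noncomputable def rotPath (a b : E × Bool) : ℤ :=
  (∑ i ∈ Finset.range (sInf {k : ℕ | (R.face ^ k) a = b}), R.eRot ((R.face ^ i) a)) +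
    ∑ i ∈ Finset.Ico 1 (sInf {k : ℕ | (R.face ^ k) a = b}), R.vRot ((R.face ^ i) a)

/-- The number of bends, `max {|rot(π(s,t))|, |rot(π(t,s))|}`. -/
noncomputable def bends : ℕ :=
  max (R.rotPath R.outS R.outT).natAbs (R.rotPath R.outT R.outS).natAbs

/-- `R` is a `(σ, τ)`-orthogonal representation: the poles `s` and `t` have `σ` and `τ` occupied
incidences. -/
def IsST (σ τ : ℕ) : Prop := R.vRot R.outS = (σ : ℤ) - 3 ∧ R.vRot R.outT = (τ : ℤ) - 3

/-- The cost of `R`; the edge `e` has `|eRot (e, _)|` bends. -/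
noncomputable def cost (w : E → ℕ → WithTop ℝ) : WithTop ℝ :=
  ∑ e, w e (R.eRot (e, false)).natAbs

/-- The restriction given by a list `W` of vertices: the vertices of `W` that have degree two form
an angle of `90°` (and not two angles of `180°`). -/
def Restricted (W : Set V) : Prop :=
  ∀ v ∈ W, G.degree v = 2 → ∃ d, G.tail d = v ∧ R.vRot d = 1

end OrthRep

/-- `c σ τ β` is, for all `σ, τ, β`, the minimum cost of the `(σ, τ)`-orthogonal representations of
`G` with `β` bends that belong to the class `A`, and `⊤` if there are none. -/
def IsCostFunctions {V E : Type} [Fintype E] (G : PoleGraph V E) (w : E → ℕ → WithTop ℝ)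
    (A : Set (OrthRep G)) (c : ℕ → ℕ → ℕ → WithTop ℝ) : Prop :=
  ∀ σ τ β, IsLeast
    (insert ⊤ {x | ∃ R ∈ A, R.IsST σ τ ∧ R.bends = β ∧ R.cost w = x}) (c σ τ β)

/-! ### Series and parallel composition -/

section Composition

variable {V₁ E₁ V₂ E₂ : Type}

open Classical in
/-- The embedding of the second vertex set when its vertex `p` is identified with `q`. -/
noncomputable def serIncl (q : V₁) (p : V₂) (v : V₂) : V₁ ⊕ {v : V₂ // v ≠ p} :=
  if h : v ≠ p then Sum.inr ⟨v, h⟩ else Sum.inl q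

/-- The series composition: `t₁` is identified with `s₂`, and the poles are `s₁` and `t₂`. -/
noncomputable def series (G₁ : PoleGraph V₁ E₁) (G₂ : PoleGraph V₂ E₂) :
    PoleGraph (V₁ ⊕ {v : V₂ // v ≠ G₂.s}) (E₁ ⊕ E₂) where
  ends := Sum.elim (fun e b => Sum.inl (G₁.ends e b))
    (fun e b => serIncl G₁.t G₂.s (G₂.ends e b))
  s := Sum.inl G₁.s
  t := serIncl G₁.t G₂.s G₂.t

open Classical in
/-- The embedding of the second vertex set when its vertices `p`, `p'` are identified with `q`
and `q'`. -/
noncomputable def parIncl (q q' : V₁) (p p' : V₂) (v : V₂) :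
    V₁ ⊕ {v : V₂ // v ≠ p ∧ v ≠ p'} :=
  if h : v ≠ p ∧ v ≠ p' then Sum.inr ⟨v, h⟩ else if v = p then Sum.inl q else Sum.inl q'

/-- The parallel composition: `s₁`, `s₂` are identified to the pole `s`, and `t₁`, `t₂` to the
pole `t`. -/
noncomputable def parallel (G₁ : PoleGraph V₁ E₁) (G₂ : PoleGraph V₂ E₂) :
    PoleGraph (V₁ ⊕ {v : V₂ // v ≠ G₂.s ∧ v ≠ G₂.t}) (E₁ ⊕ E₂) where
  ends := Sum.elim (fun e b => Sum.inl (G₁.ends e b))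
    (fun e b => parIncl G₁.s G₁.t G₂.s G₂.t (G₂.ends e b))
  s := Sum.inl G₁.s
  t := Sum.inl G₁.t

/-- In the embedding, the two composed graphs are placed next to each other (in one of the two
possible orders) and not nested or interleaved. With `side = false`, the graph `G₁`
precedes `G₂` in counter-clockwise order at `s`, when starting at the outer face, and it follows
`G₂` at `t`. With `side = true` the roles are exchanged. -/
def SideBySide [Fintype E₁] [Fintype E₂] {G₁ : PoleGraph V₁ E₁} {G₂ : PoleGraph V₂ E₂}
    (R : OrthRep (parallel G₁ G₂)) : Prop :=
  ∃ side : Bool,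
    R.outS.1.isRight = side ∧ R.outT.1.isRight = !side ∧
    (∀ d, (parallel G₁ G₂).tail d = (parallel G₁ G₂).s → R.next d ≠ R.outS →
      (R.next d).1.isRight = side → d.1.isRight = side) ∧
    (∀ d, (parallel G₁ G₂).tail d = (parallel G₁ G₂).t → R.next d ≠ R.outT →
      (R.next d).1.isRight = !side → d.1.isRight = !side)

end Composition

/-! ### Random access machine with exact arithmetic on `ℝ ∪ {∞}` -/

/-- The memory: integer registers, registers for values in `ℝ ∪ {∞}`, and arrays of such values.
Arrays are named by triples of numbers; every program refers to finitely many registers and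
arrays. -/
structure State where
  int : ℕ → ℤ
  val : ℕ → WithTop ℝ
  arr : ℕ × ℕ × ℕ → ℤ → WithTop ℝ

/-- Elementary instructions. -/
inductive Instr where
  /-- `int r := z` -/
  | const (r : ℕ) (z : ℤ)
  /-- `int r := int a + int b` -/
  | add (r a b : ℕ)
  /-- `int r := int a - int b` -/
  | sub (r a b : ℕ)
  /-- `val r := ∞` -/
  | vtop (r : ℕ)
  /-- `val r := val a + val b` -/
  | vadd (r a b : ℕ)
  /-- `val r := arr k [int i]` -/
  | load (r : ℕ) (k : ℕ × ℕ × ℕ) (i : ℕ)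
  /-- `arr k [int i] := val r` -/
  | store (k : ℕ × ℕ × ℕ) (i : ℕ) (r : ℕ)

/-- Elementary tests. -/
inductive Test where
  /-- `int a ≤ int b` -/
  | le (a b : ℕ)
  /-- `val a ≤ val b` -/
  | vle (a b : ℕ)

def Instr.apply : Instr → State → State
  | const r z, S => { S with int := Function.update S.int r z }
  | add r a b, S => { S with int := Function.update S.int r (S.int a + S.int b) }
  | sub r a b, S => { S with int := Function.update S.int r (S.int a - S.int b) }
  | vtop r, S => { S with val := Function.update S.val r ⊤ }
  | vadd r a b, S => { S with val := Function.update S.val r (S.val a + S.val b) }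
  | load r k i, S => { S with val := Function.update S.val r (S.arr k (S.int i)) }
  | store k i r, S =>
      { S with arr := Function.update S.arr k (Function.update (S.arr k) (S.int i) (S.val r)) }

def Test.Holds : Test → State → Prop
  | le a b, S => S.int a ≤ S.int b
  | vle a b, S => S.val a ≤ S.val b

/-- Programs. -/
inductive Prog where
  | skip
  | instr (i : Instr)
  | seq (P Q : Prog)
  | ite (b : Test) (P Q : Prog)
  | while (b : Test) (P : Prog)

/-- `Exec P S n S'`: the program `P`, started in the state `S`, terminates in the state `S'` after
exactly `n` steps, where every elementary instruction and every evaluation of a test is one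
step. -/
inductive Exec : Prog → State → ℕ → State → Prop where
  | skip (S) : Exec .skip S 0 S
  | instr (i S) : Exec (.instr i) S 1 (i.apply S)
  | seq {P Q S m S' n S''} : Exec P S m S' → Exec Q S' n S'' → Exec (.seq P Q) S (m + n) S''
  | ite_true {b P Q S n S'} : b.Holds S → Exec P S n S' → Exec (.ite b P Q) S (n + 1) S'
  | ite_false {b P Q S n S'} : ¬ b.Holds S → Exec Q S n S' → Exec (.ite b P Q) S (n + 1) S'
  | while_false {b P S} : ¬ b.Holds S → Exec (.while b P) S 1 S
  | while_true {b P S m S' n S''} : b.Holds S → Exec P S m S' → Exec (.while b P) S' n S'' →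
      Exec (.while b P) S (m + n + 1) S''

/-- The arrays `(k, σ, τ)` with `σ, τ ∈ {1, …, 4}` hold the tables of the values `c σ τ β` with
`β ≤ m`. Nothing is required of the other cells. -/
def State.HoldsTable (S : State) (k m : ℕ) (c : ℕ → ℕ → ℕ → WithTop ℝ) : Prop :=
  ∀ σ ∈ Finset.Icc 1 4, ∀ τ ∈ Finset.Icc 1 4, ∀ β ≤ m, S.arr (k, σ, τ) (β : ℤ) = c σ τ β

/-- All values for more than `m` bends are `∞`. -/
def TopAbove (m : ℕ) (c : ℕ → ℕ → ℕ → WithTop ℝ) : Prop := ∀ σ τ β, m < β → c σ τ β = ⊤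

open Classical in
/-- The bit telling whether a proposition holds, as an integer. -/
noncomputable def bit (p : Prop) : ℤ := if p then 1 else 0

end BendCost

open BendCost

/-! Rotations turn the geometry into counting. The sum of all rotations, taken over edges and
vertices, is `4|E| - 4|V|`. If every face but one sums to `4`, the exceptional face therefore sums
to `-4` exactly when Euler's formula holds, and Euler's inequality (`euler_inequality`, valid for
every connected map) gives at least `-4`. So planarity need not be checked separately when
representations are glued. When a representation is cut, the lower bounds for the parts add up to
the known total and are thus equalities.

For a `(σ, τ)`-orthogonal representation, the rotation `ρ` of the path from `s` to `t` determines
that of the other path, `2 - σ - τ - ρ`, and the number of bends is `max (-ρ) (ρ + σ + τ - 2)`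
(`OrthRep.bends_eq`). Hence `β` bends leave two candidates for `ρ`, and the mirror image exchanges
them at the same cost (`OrthRep.Realizes.flip`). A finite table entry is therefore attained for both
candidates, and the composition needs no other information about a part.

Parts are glued by multiplying the rotation systems with transpositions of darts at the identified
vertices; the two new angles at such a vertex have a rotation sum that exceeds the sum of the two
old outer ones by `4`. In a series composition `ρ = ρ₁ + x + ρ₂`, where `x` is the rotation of the
identified vertex on the path, so all pairs of bend numbers are tried. In a parallel composition the
path from `s` to `t` is that of the first part, and the face between the parts must sum to `4`; this
determines `ρ₂` from `ρ₁` and boundedly many angles, so a single loop suffices. The second order of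
the parts is the mirror image of the first.

Conversely, every representation of the composition arises in this way (`SeriesGluing.exists_parts`,
`ParallelGluing.exists_parts`). For the series composition this requires that the parts do not
interleave at the cutvertex, which again follows from Euler's inequality.

An identified vertex in `W` has degree one in each part, so its restriction concerns only the two
new angles, and one bit per identified vertex is enough. The programs lower table entries: each
finite entry is the cost of a representation, and no representation is cheaper than its entry. Thus
the entries are the minima, which in particular exist. -/

namespace BendCost

open Equiv

/-! ### First return paths of a permutation -/

section Arc

variable {D D' : Type} {p : Perm D} {e v : D → ℤ} {B : Set D} {a b c : D} {r r' : ℤ}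

/-- `Arc p e v B a b r`: following `p` from `a`, the set `B` is first entered at `b` (after at
least one step), and the weights `e` of the points before `b` and `v` of the points strictly
between add up to `r`. -/
inductive Arc (p : Perm D) (e v : D → ℤ) (B : Set D) : D → D → ℤ → Prop
  | last {a : D} : p a ∈ B → Arc p e v B a (p a) (e a)
  | step {a b : D} {r : ℤ} : p a ∉ B → Arc p e v B (p a) b r →
      Arc p e v B a b (e a + v (p a) + r)

namespace Arc

theorem mem (h : Arc p e v B a b r) : b ∈ B := by
  induction h with
  | last h => exact h
  | step _ _ ih => exact ih

theorem sameCycle (h : Arc p e v B a b r) : p.SameCycle a b := by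
  induction h with
  | last h => exact ⟨1, by simp⟩
  | step _ _ ih => exact (Perm.sameCycle_apply_left).1 ih

theorem anti {B' : Set D} (h : Arc p e v B a b r) (hB : B' ⊆ B) (hb : b ∈ B') :
    Arc p e v B' a b r := by
  induction h with
  | last h => exact last hb
  | step h _ ih => exact step (fun h' => h (hB h')) (ih hb)

theorem trans {B' : Set D} (h : Arc p e v B a b r) (hB : B' ⊆ B) (hb : b ∉ B')
    (h' : Arc p e v B' b c r') : Arc p e v B' a c (r + v b + r') := by
  induction h with
  | last h => exact step hb h'
  | step h _ ih =>
    have := step (fun h' => h (hB h')) (ih hb h')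
    convert this using 1
    ring

theorem map {p' : Perm D'} {e' v' : D' → ℤ} {B' : Set D'} {a b : D'} {J : D' → D}
    (hp : ∀ d, p (J d) = J (p' d)) (he : ∀ d, e (J d) = e' d) (hB : ∀ d, J d ∈ B ↔ d ∈ B')
    (hv : ∀ d ∉ B', v (J d) = v' d) (h : Arc p' e' v' B' a b r) :
    Arc p e v B (J a) (J b) r := by
  induction h with
  | last h => rw [← he, ← hp]; exact last (by rwa [hp, hB])
  | @step a b r h _ ih =>
    rw [← he, ← hv _ h, ← hp]
    exact step (by rwa [hp, hB]) (by rwa [hp])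

/-- After its start the path meets `B` only at its end, so `g` acts on the last step alone. All
cutting and gluing rests on this: boundary paths keep their interiors and only their ends are
redirected. -/
theorem comp {g : Perm D} (hg : ∀ d ∉ B, g d = d) (hgB : ∀ d ∈ B, g d ∈ B)
    (h : Arc p e v B a b r) : Arc (g * p) e v B a (g b) r := by
  induction h with
  | last h => exact last (p := g * _) (hgB _ h)
  | @step a b r h _ ih =>
    have h1 : (g * p) a = p a := hg _ h
    have := step (p := g * p) (e := e) (v := v) (B := B) (a := a) (by rwa [h1]) (by rwa [h1])
    rwa [h1] at this

theorem exists_of_sameCycle [Finite D] (p : Perm D) (e v : D → ℤ) (B : Set D)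
    (h : p.SameCycle a b) (hb : b ∈ B) : ∃ c ∈ B, ∃ r, Arc p e v B a c r := by
  obtain ⟨i, hi, -, rfl⟩ := h.exists_pow_eq''
  obtain ⟨k, rfl⟩ : ∃ k, i = k + 1 := ⟨i - 1, by omega⟩
  clear hi h
  induction k generalizing a with
  | zero => exact ⟨p a, by simpa using hb, _, last (by simpa using hb)⟩
  | succ k ih =>
    by_cases ha : p a ∈ B
    · exact ⟨_, ha, _, last ha⟩
    · rw [pow_succ, Perm.mul_apply] at hb
      obtain ⟨c, hc, r, hr⟩ := ih hb
      exact ⟨c, hc, _, step ha hr⟩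

/-- The points whose next entry into `B` lies in `C`, and which lie in `C` if they lie in `B`, form
a set closed under `p`. -/
theorem mem_of_closed [Finite D] {C : Set D} (hC : ∀ c ∈ C, ∃ c' ∈ C, ∃ r, Arc p e v B c c' r)
    (hc : c ∈ C) (hb : b ∈ B) (h : p.SameCycle c b) : b ∈ C := by
  let Z : Set D := {x | (∃ c' ∈ C, ∃ r, Arc p e v B x c' r) ∧ (x ∈ B → x ∈ C)}
  have hZ : ∀ x ∈ Z, p x ∈ Z := by
    rintro x ⟨⟨c', hc', r, hr⟩, -⟩
    cases hr with
    | last h => exact ⟨hC _ hc', fun _ => hc'⟩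
    | step h h' => exact ⟨⟨c', hc', _, h'⟩, fun h'' => absurd h'' h⟩
  obtain ⟨i, rfl⟩ := h.exists_nat_pow_eq
  have : ∀ i : ℕ, (p ^ i) c ∈ Z := by
    intro i
    induction i with
    | zero => exact ⟨hC c hc, fun _ => hc⟩
    | succ i ih => rw [pow_succ', Perm.mul_apply]; exact hZ _ ih
  exact (this i).2 hb

theorem eq_of_self [Finite D] (ha : Arc p e v B a a r) (hb : b ∈ B) (h : p.SameCycle a b) :
    b = a :=
  mem_of_closed (e := e) (v := v) (C := {a})
    (fun c hc => ⟨a, rfl, r, by rw [Set.mem_singleton_iff.1 hc]; exact ha⟩) rfl hb h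

theorem exists_pow (h : Arc p e v B a b r) : ∃ k : ℕ, (p ^ (k + 1)) a = b ∧
    (∀ i < k, (p ^ (i + 1)) a ∉ B) ∧
    r = ∑ i ∈ Finset.range (k + 1), e ((p ^ i) a) + ∑ i ∈ Finset.range k, v ((p ^ (i + 1)) a) := by
  induction h with
  | last h => exact ⟨0, by simp⟩
  | @step a b r h _ ih =>
    obtain ⟨k, hk, hB, hr⟩ := ih
    refine ⟨k + 1, ?_, ?_, ?_⟩
    · rw [pow_succ, Perm.mul_apply, hk]
    · intro i hi
      cases i with
      | zero => simpa using h
      | succ i => 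
        rw [pow_succ, Perm.mul_apply]
        exact hB i (by omega)
    · have hpow : ∀ i : ℕ, (p ^ (i + 1)) a = (p ^ i) (p a) := fun i => by
        rw [pow_succ, Perm.mul_apply]
      rw [Finset.sum_range_succ' (fun i => e ((p ^ i) a)),
        Finset.sum_range_succ' (fun i => v ((p ^ (i + 1)) a)), hr]
      simp only [hpow, pow_zero, Perm.one_apply]
      ring

theorem of_pow (k : ℕ) (hb : (p ^ (k + 1)) a ∈ B) (hB : ∀ i < k, (p ^ (i + 1)) a ∉ B) :
    Arc p e v B a ((p ^ (k + 1)) a)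
      (∑ i ∈ Finset.range (k + 1), e ((p ^ i) a) + ∑ i ∈ Finset.range k, v ((p ^ (i + 1)) a)) := by
  induction k generalizing a with
  | zero => 
    simp only [zero_add, pow_one, Finset.range_one, Finset.sum_singleton, pow_zero,
      Perm.one_apply, Finset.range_zero, Finset.sum_empty, add_zero] at hb ⊢
    exact last hb
  | succ k ih =>
    have h0 : p a ∉ B := by simpa using hB 0 (by omega)
    have h1 := ih (a := p a) (by rwa [← Perm.mul_apply, ← pow_succ]) (fun i hi => by
      rw [← Perm.mul_apply, ← pow_succ]
      exact hB (i + 1) (by omega))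
    have h2 := step h0 h1
    have hpow : ∀ i : ℕ, (p ^ (i + 1)) a = (p ^ i) (p a) := fun i => by
      rw [pow_succ, Perm.mul_apply]
    rw [hpow (k + 1), Finset.sum_range_succ' (fun i => e ((p ^ i) a)),
      Finset.sum_range_succ' (fun i => v ((p ^ (i + 1)) a))]
    convert h2 using 1
    simp only [hpow, pow_zero, Perm.one_apply]
    ring

end Arc

open Classical in
/-- The sum of `f` over the cycle of `d`. -/
noncomputable def cycleSum [Fintype D] (p : Perm D) (f : D → ℤ) (d : D) : ℤ :=
  ∑ x with p.SameCycle d x, f x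

theorem cycleSum_eq [Fintype D] (p : Perm D) (f : D → ℤ) (d : D)
    {_ : DecidablePred fun x => p.SameCycle d x} :
    cycleSum p f d = ∑ x with p.SameCycle d x, f x := by
  unfold cycleSum; congr

theorem cycleSum_equiv [Fintype D] [Fintype D'] {p : Perm D} {p' : Perm D'} (j : D ≃ D')
    {d : D} {d' : D'} (h : ∀ x, p.SameCycle d x ↔ p'.SameCycle d' (j x)) {f : D → ℤ} {f' : D' → ℤ}
    (hf : ∀ x, f x = f' (j x)) : cycleSum p f d = cycleSum p' f' d' :=
  Finset.sum_equiv j (by simp [h]) fun x _ => hf x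

theorem cycleSum_congr [Fintype D] {f : D → ℤ} {d d' : D} (h : p.SameCycle d d') :
    cycleSum p f d = cycleSum p f d' := by
  unfold cycleSum
  congr 1
  ext x
  simp only [Finset.mem_filter, Finset.mem_univ, true_and]
  exact ⟨fun h' => h.symm.trans h', fun h' => h.trans h'⟩

/-- A first return to `a` runs through the cycle exactly once; the weight `v a` is the only one that
an arc from `a` to `a` leaves out. -/
theorem Arc.cycleSum_eq [Fintype D] (h : Arc p e v {a} a a r) :
    cycleSum p (fun x => e x + v x) a = r + v a := by
  classical
  obtain ⟨k, hk, hB, rfl⟩ := h.exists_pow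
  have hper : ∀ i : ℕ, (p ^ (i % (k + 1))) a = (p ^ i) a := by
    intro i
    have : Function.IsPeriodicPt p (k + 1) a := by
      rw [Function.IsPeriodicPt, Function.IsFixedPt, ← Perm.coe_pow]; exact hk
    have := this.iterate_mod_apply i
    simpa only [← Perm.coe_pow] using this
  have hset : (Finset.univ.filter fun x => p.SameCycle a x) =
      (Finset.range (k + 1)).image fun i => (p ^ i) a := by
    ext x
    simp only [Finset.mem_filter, Finset.mem_univ, true_and, Finset.mem_image, Finset.mem_range]
    constructor
    · intro h
      obtain ⟨i, rfl⟩ := h.exists_nat_pow_eq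
      exact ⟨i % (k + 1), Nat.mod_lt _ (by omega), hper i⟩
    · rintro ⟨i, -, rfl⟩
      exact ⟨i, by simp⟩
  have hinj : ∀ i j : ℕ, i < j → j < k + 1 → (p ^ i) a ≠ (p ^ j) a := by
    intro i j hij hj h
    obtain ⟨d, rfl⟩ : ∃ d, j = i + (d + 1) := ⟨j - i - 1, by omega⟩
    rw [pow_add, Perm.mul_apply] at h
    exact hB d (by omega) ((p ^ i).injective h.symm)
  unfold cycleSum
  rw [hset, Finset.sum_image]
  · rw [Finset.sum_add_distrib, Finset.sum_range_succ' (fun i => v ((p ^ i) a))]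
    simp [add_assoc]
  · intro i hi j hj h
    simp only [Finset.coe_range, Set.mem_Iio] at hi hj
    by_contra hne
    rcases Nat.lt_or_gt_of_ne hne with h' | h'
    · exact hinj i j h' hj h
    · exact hinj j i h' hi h.symm

/-! ### Cycles of a permutation multiplied by one supported on a set -/

section Surgery

variable [Finite D] {g : Perm D}

/-- A cycle that avoids `B` is not affected by a permutation supported on `B`. -/
theorem sameCycle_mul_of_avoid (hg : ∀ d ∉ B, g d = d) {d : D}
    (hd : ∀ b ∈ B, ¬ p.SameCycle d b) (x : D) : (g * p).SameCycle d x ↔ p.SameCycle d x := by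
  have key : ∀ i : ℕ, ((g * p) ^ i) d = (p ^ i) d := by
    intro i
    induction i with
    | zero => rfl
    | succ i ih =>
      rw [pow_succ', Perm.mul_apply, ih, Perm.mul_apply, pow_succ', Perm.mul_apply]
      refine hg _ fun hb => hd _ hb ⟨(i : ℤ) + 1, ?_⟩
      rw [← Perm.mul_apply, ← pow_succ']
      exact_mod_cast rfl
  constructor <;> intro h <;> obtain ⟨i, rfl⟩ := h.exists_nat_pow_eq
  · exact ⟨i, by rw [key]; simp⟩
  · exact ⟨i, by rw [← key]; simp⟩

/-- Every cycle of `p` that meets `B` is contained in cycles of `g * p` that meet `B`. -/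
theorem exists_sameCycle_mul (hg : ∀ d ∉ B, g d = d) (hgB : ∀ d ∈ B, g d ∈ B) {d b : D}
    (hb : b ∈ B) (h : p.SameCycle d b) : ∃ c ∈ B, (g * p).SameCycle d c := by
  obtain ⟨c, hc, r, hr⟩ := Arc.exists_of_sameCycle p 0 0 B h hb
  exact ⟨g c, hgB c hc, (hr.comp hg hgB).sameCycle⟩

theorem cycleSum_mul_of_avoid [Fintype D] (hg : ∀ d ∉ B, g d = d) {d : D}
    (hd : ∀ b ∈ B, ¬ p.SameCycle d b) (f : D → ℤ) :
    cycleSum (g * p) f d = cycleSum p f d := by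
  unfold cycleSum
  congr 1
  ext x
  simp only [Finset.mem_filter, Finset.mem_univ, true_and, sameCycle_mul_of_avoid hg hd]

end Surgery

section

variable [Finite D] {x y : D}

/-- The two first return paths between two points of one cycle. -/
theorem exists_arc_pair (e v : D → ℤ) (hxy : x ≠ y) (h : p.SameCycle x y) :
    ∃ r, Arc p e v {x, y} x y r := by
  obtain ⟨c, hc, r, hr⟩ := Arc.exists_of_sameCycle p e v {x, y} h (by simp)
  rcases hc with rfl | rfl
  -- If `x` were reached before `y`, the first returns would never leave `x`, and `y` would not be
  -- on the cycle.
  · exfalso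
    exact hxy (hr.eq_of_self (by simp) h).symm
  · exact ⟨r, hr⟩

theorem exists_arc_single (e v : D → ℤ) (h : ¬ p.SameCycle x y) :
    ∃ r, Arc p e v {x, y} x x r := by
  obtain ⟨c, hc, r, hr⟩ := Arc.exists_of_sameCycle p e v {x, y} (Perm.SameCycle.refl p x) (by simp)
  rcases hc with rfl | rfl
  · exact ⟨r, hr⟩
  · exact absurd hr.sameCycle h

end

/-! ### Splitting and merging cycles by a transposition -/

section Swap

variable [DecidableEq D]

theorem swap_fix {x y : D} : ∀ d ∉ ({x, y} : Set D), swap x y d = d := by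
  intro d hd
  simp only [Set.mem_insert_iff, Set.mem_singleton_iff, not_or] at hd
  exact swap_apply_of_ne_of_ne hd.1 hd.2

theorem swap_maps {x y : D} : ∀ d ∈ ({x, y} : Set D), swap x y d ∈ ({x, y} : Set D) := by
  rintro d (rfl | rfl) <;> simp

variable [Finite D] {x y : D}

/-- Swapping two points of one cycle splits the cycle. -/
theorem not_sameCycle_swap_mul (hxy : x ≠ y) (h : p.SameCycle x y) :
    ¬ (swap x y * p).SameCycle x y := by
  intro h'
  obtain ⟨r, hr⟩ := exists_arc_pair 0 0 hxy h
  have h1 := hr.comp swap_fix swap_maps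
  rw [swap_apply_right] at h1
  exact hxy (h1.eq_of_self (by simp) h').symm

theorem sameCycle_swap_mul (h : ¬ p.SameCycle x y) : (swap x y * p).SameCycle x y := by
  obtain ⟨r, hr⟩ := exists_arc_single 0 0 h
  have h1 := (hr.comp swap_fix swap_maps).sameCycle
  rwa [swap_apply_left] at h1

/-- Swapping two points of different cycles only enlarges cycles. -/
theorem SameCycle.swap_mul (h : ¬ p.SameCycle x y) {a b : D} (hab : p.SameCycle a b) :
    (swap x y * p).SameCycle a b := by
  have hxy := sameCycle_swap_mul h
  by_cases ha : ∀ c ∈ ({x, y} : Set D), ¬ p.SameCycle a c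
  · exact (sameCycle_mul_of_avoid swap_fix ha b).2 hab
  · push Not at ha
    obtain ⟨c, hc, hac⟩ := ha
    have key : ∀ a, p.SameCycle a c → (swap x y * p).SameCycle a x := by
      intro a hac
      obtain ⟨d, hd, had⟩ := exists_sameCycle_mul swap_fix swap_maps hc hac
      rcases hd with rfl | rfl
      · exact had
      · exact had.trans hxy.symm
    exact (key a hac).trans (key b (hab.symm.trans hac)).symm

/-- The swap closes the arcs from `x` to `y` and from `y` to `x` into two loops of unchanged weight.
-/
theorem cycleSum_swap_mul [Fintype D] (hxy : x ≠ y) (h : p.SameCycle x y) (e v : D → ℤ) :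
    cycleSum (swap x y * p) (fun z => e z + v z) x + cycleSum (swap x y * p) (fun z => e z + v z) y =
      cycleSum p (fun z => e z + v z) x := by
  obtain ⟨r, hr⟩ := exists_arc_pair e v hxy h
  obtain ⟨s, hs⟩ := exists_arc_pair e v hxy.symm h.symm
  rw [Set.pair_comm] at hs
  have h1 := hr.comp swap_fix swap_maps
  have h2 := hs.comp swap_fix swap_maps
  rw [swap_apply_right] at h1
  rw [swap_apply_left] at h2
  rw [(h1.anti (by simp) (by simp)).cycleSum_eq, (h2.anti (by simp) (by simp)).cycleSum_eq,
    (hr.trans (B' := {x}) (by simp) (by simpa using hxy.symm) (hs.anti (by simp) (by simp))).cycleSum_eq]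
  ring

end Swap

end Arc

end BendCost

namespace BendCost

open Equiv

/-! ### Euler's inequality -/

/-- The number of cycles of a permutation, fixed points included. -/
noncomputable def cycleCount {D : Type} (p : Perm D) : ℕ :=
  Nat.card (Quotient (Perm.SameCycle.setoid p))

theorem mk_eq_mk_iff {D : Type} {p : Perm D} {a b : D} :
    (Quotient.mk (Perm.SameCycle.setoid p) a = Quotient.mk _ b) ↔ p.SameCycle a b :=
  Quotient.eq (r := Perm.SameCycle.setoid p)

theorem mk_apply {D : Type} (p : Perm D) (a : D) :
    Quotient.mk (Perm.SameCycle.setoid p) (p a) = Quotient.mk _ a :=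
  mk_eq_mk_iff.2 (Perm.sameCycle_apply_left.2 (Perm.SameCycle.refl p a))

section Euler

variable {E : Type}

theorem rev_mk (e : E) (b : Bool) : rev E (e, b) = (e, !b) := rfl

theorem rev_rev (d : E × Bool) : rev E (rev E d) = d := by
  rcases d with ⟨e, b⟩
  simp [rev]

/-- `n` and the reversal of darts act transitively on the darts. -/
def Transitive (n : Perm (E × Bool)) : Prop :=
  ∀ f : E × Bool → ℝ, (∀ d, f (n d) = f d) → (∀ d, f (rev E d) = f d) → ∀ d d', f d = f d'

/-- The coboundary of a function on the cycles of a permutation of the darts. -/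
def cycleDiff (p : Perm (E × Bool)) :
    (Quotient (Perm.SameCycle.setoid p) → ℝ) →ₗ[ℝ] (E → ℝ) where
  toFun g e := g (Quotient.mk _ (e, false)) - g (Quotient.mk _ (e, true))
  map_add' g h := by ext e; simp; ring
  map_smul' c g := by ext e; simp; ring

theorem cycleDiff_apply (p : Perm (E × Bool)) (g) (e : E) :
    cycleDiff p g e = g (Quotient.mk _ (e, false)) - g (Quotient.mk _ (e, true)) := rfl

theorem apply_rev_of_cycleDiff_eq_zero {p : Perm (E × Bool)}
    {g : Quotient (Perm.SameCycle.setoid p) → ℝ} (h : cycleDiff p g = 0) (d : E × Bool) :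
    g (Quotient.mk _ (rev E d)) = g (Quotient.mk _ d) := by
  rcases d with ⟨e, b⟩
  have := congrFun h e
  simp only [cycleDiff_apply, Pi.zero_apply, sub_eq_zero] at this
  cases b
  · exact this.symm
  · exact this

variable [Fintype E]

theorem finrank_ker_le_one {ι : Type} [Finite ι] {M : Type*} [AddCommGroup M] [Module ℝ M]
    (L : (ι → ℝ) →ₗ[ℝ] M) (h : ∀ g, L g = 0 → ∀ i j, g i = g j) :
    Module.finrank ℝ (LinearMap.ker L) ≤ 1 := by
  cases nonempty_fintype ι
  refine finrank_le_one_iff.2 ?_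
  rcases isEmpty_or_nonempty ι with hι | ⟨⟨i⟩⟩
  · exact ⟨0, fun w => ⟨0, by ext i; exact hι.elim i⟩⟩
  · by_cases hc : L (fun _ => 1) = 0
    · refine ⟨⟨fun _ => 1, hc⟩, fun w => ⟨w.1 i, ?_⟩⟩
      ext j
      simp [h w.1 w.2 i j]
    · refine ⟨0, fun w => ⟨0, ?_⟩⟩
      have hw : w.1 = w.1 i • (fun _ => (1 : ℝ)) := by
        ext j
        simp [h w.1 w.2 i j]
      have h0 := w.2
      rw [LinearMap.mem_ker, hw, map_smul, smul_eq_zero] at h0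
      ext j
      simp [h w.1 w.2 j i, h0.resolve_right hc]

/-- Rank and nullity, where the kernel contains only constants. The index set will be the set of
vertices or of faces, and the condition on the kernel is connectivity. -/
theorem card_le_finrank_range {ι : Type} [Finite ι] {M : Type*} [AddCommGroup M] [Module ℝ M]
    (L : (ι → ℝ) →ₗ[ℝ] M) (h : ∀ g, L g = 0 → ∀ i j, g i = g j) :
    Nat.card ι ≤ Module.finrank ℝ (LinearMap.range L) + 1 := by
  cases nonempty_fintype ι
  have h1 := LinearMap.finrank_range_add_finrank_ker L
  have h2 := finrank_ker_le_one L h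
  rw [Module.finrank_pi] at h1
  rw [Nat.card_eq_fintype_card]
  omega

/-- Cuts are orthogonal to coboundaries of face functions: `rev E d` and `n d` lie on the same face,
so around each vertex the differences of the face function telescope to zero, while the vertex
function is constant there. -/
theorem cycleDiff_orthogonal (n : Perm (E × Bool)) (g f) :
    ∑ e, cycleDiff n g e * cycleDiff (n * rev E) f e = 0 := by
  have h1 : ∀ d : E × Bool, f (Quotient.mk _ (rev E d)) = f (Quotient.mk _ (n d)) := by
    intro d
    rw [← mk_apply (n * rev E) (rev E d), Perm.mul_apply, rev_rev]
  have h2 : ∑ d : E × Bool, g (Quotient.mk _ d) *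
      (f (Quotient.mk _ d) - f (Quotient.mk _ (rev E d))) = 0 := by
    simp only [mul_sub, Finset.sum_sub_distrib, h1]
    rw [sub_eq_zero, ← Equiv.sum_comp n]
    simp only [mk_apply]
  rw [Fintype.sum_prod_type] at h2
  rw [← h2]
  refine Finset.sum_congr rfl fun e _ => ?_
  simp only [cycleDiff_apply, Fintype.sum_bool, rev_mk, Bool.not_true, Bool.not_false]
  ring

/-- Euler's inequality for a connected map. -/
theorem euler_inequality {n : Perm (E × Bool)} (hn : Transitive n) :
    cycleCount n + cycleCount (n * rev E) ≤ Nat.card E + 2 := by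
  have h1 := card_le_finrank_range (cycleDiff n) (by
    intro g hg i j
    induction i using Quotient.inductionOn with | _ a
    induction j using Quotient.inductionOn with | _ b
    exact hn (fun d => g (Quotient.mk _ d)) (fun d => by rw [mk_apply])
      (apply_rev_of_cycleDiff_eq_zero hg) a b)
  have h2 := card_le_finrank_range (cycleDiff (n * rev E)) (by
    intro g hg i j
    induction i using Quotient.inductionOn with | _ a
    induction j using Quotient.inductionOn with | _ b
    refine hn (fun d => g (Quotient.mk _ d)) (fun d => ?_)
      (apply_rev_of_cycleDiff_eq_zero hg) a b
    have := mk_apply (n * rev E) (rev E d)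
    rw [Perm.mul_apply, rev_rev] at this
    rw [this, apply_rev_of_cycleDiff_eq_zero hg])
  -- A vector in both ranges is orthogonal to itself, hence zero. So the two ranks add up to at most
  -- the number of edges.
  have h3 : Disjoint (LinearMap.range (cycleDiff n)) (LinearMap.range (cycleDiff (n * rev E))) := by
    rw [Submodule.disjoint_def]
    rintro _ ⟨g, rfl⟩ ⟨f, hf⟩
    have := cycleDiff_orthogonal n g f
    rw [hf] at this
    ext e
    have h4 := (Finset.sum_eq_zero_iff_of_nonneg (fun e _ => mul_self_nonneg _)).1 this e
      (Finset.mem_univ e)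
    simpa using h4
  have h4 := Submodule.finrank_add_finrank_le_of_disjoint h3
  rw [Module.finrank_pi, ← Nat.card_eq_fintype_card] at h4
  unfold cycleCount
  omega

end Euler

/-! ### Sums over cycles -/

section CycleSum

variable {D : Type} [Fintype D] (p : Perm D) (f : D → ℤ)

noncomputable instance : Fintype (Quotient (Perm.SameCycle.setoid p)) := Fintype.ofFinite _

open Classical in
theorem sum_fiber_mk (a : D) :
    ∑ x with Quotient.mk (Perm.SameCycle.setoid p) x = Quotient.mk _ a, f x = cycleSum p f a := by
  unfold cycleSum
  congr 1
  ext x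
  simp only [Finset.mem_filter, Finset.mem_univ, true_and, mk_eq_mk_iff]
  exact ⟨fun h => h.symm, fun h => h.symm⟩

-- Every cycle of sum `4` has defect zero, so the number of faces can be read off the total rotation
-- and the sums of the exceptional faces.
open Classical in
theorem four_mul_cycleCount : 4 * (cycleCount p : ℤ) - ∑ d, f d =
    ∑ q : Quotient (Perm.SameCycle.setoid p),
      (4 - ∑ x with Quotient.mk (Perm.SameCycle.setoid p) x = q, f x) := by
  rw [Finset.sum_sub_distrib, Finset.sum_fiberwise Finset.univ (Quotient.mk _) f]
  simp [cycleCount, Nat.card_eq_fintype_card, mul_comm]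

variable {p f}

theorem four_mul_cycleCount_one {a : D} (h : ∀ d, ¬ p.SameCycle a d → cycleSum p f d = 4) :
    4 * (cycleCount p : ℤ) = ∑ d, f d + 4 - cycleSum p f a := by
  classical
  have h1 := four_mul_cycleCount p f
  rw [Finset.sum_eq_single (Quotient.mk _ a), sum_fiber_mk] at h1
  · linarith
  · intro q _ hq
    induction q using Quotient.inductionOn with | _ d
    rw [sum_fiber_mk, h, sub_self]
    exact fun h' => hq (mk_eq_mk_iff.2 h'.symm)
  · simp

theorem four_mul_cycleCount_two {a b : D} (hab : ¬ p.SameCycle a b)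
    (h : ∀ d, ¬ p.SameCycle a d → ¬ p.SameCycle b d → cycleSum p f d = 4) :
    4 * (cycleCount p : ℤ) = ∑ d, f d + 8 - cycleSum p f a - cycleSum p f b := by
  classical
  have h1 := four_mul_cycleCount p f
  rw [Finset.sum_eq_add (Quotient.mk _ a) (Quotient.mk _ b), sum_fiber_mk, sum_fiber_mk] at h1
  · linarith
  · exact fun h' => hab (mk_eq_mk_iff.1 h')
  · intro q _ hq
    induction q using Quotient.inductionOn with | _ d
    rw [sum_fiber_mk, h, sub_self]
    · exact fun h' => hq.1 (mk_eq_mk_iff.2 h'.symm)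
    · exact fun h' => hq.2 (mk_eq_mk_iff.2 h'.symm)
  · simp
  · simp

end CycleSum

end BendCost

namespace BendCost

open Equiv

/-! ### Darts and connectivity of `st`-graphs -/

section Connectivity

variable {V E : Type} {G : PoleGraph V E}

theorem Multigraph.tail_rev_ne {G : Multigraph V E} (h : G.Loopless) (d : E × Bool) :
    G.tail (rev E d) ≠ G.tail d := by
  rcases d with ⟨e, b⟩
  cases b
  · exact (h e).symm
  · exact h e

theorem PoleGraph.IsSTGraph.exists_tail (h : G.IsSTGraph) (u : V) : ∃ d, G.tail d = u := by
  obtain ⟨w, hw⟩ : ∃ w, u ≠ w := by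
    by_cases hu : u = G.s
    · exact ⟨G.t, hu ▸ h.poles_ne⟩
    · exact ⟨G.s, hu⟩
  obtain ⟨q⟩ := h.connected.preconnected u w
  cases q with
  | nil => exact absurd rfl hw
  | cons hadj _ =>
    simp only [Multigraph.simple, SimpleGraph.fromRel_adj] at hadj
    rcases hadj.2 with ⟨e, he, -⟩ | ⟨e, -, he⟩
    · exact ⟨(e, false), he⟩
    · exact ⟨(e, true), he⟩

/-- A pole is not a cutvertex: a function on the darts that is invariant under reversal and
constant at all other vertices is constant. -/
theorem PoleGraph.IsSTGraph.eq_of_invariant (h : G.IsSTGraph) {p : V} (hp : p = G.s ∨ p = G.t)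
    {α : Type*} {f : E × Bool → α} (hrev : ∀ d, f (rev E d) = f d)
    (hv : ∀ d d', G.tail d = G.tail d' → G.tail d ≠ p → f d = f d') (d d' : E × Bool) :
    f d = f d' := by
  have key : ∀ u u' : ({p}ᶜ : Set V),
      (((G.addEdge G.s G.t).simple.induce {p}ᶜ).Reachable u u') →
      ∀ d d', G.tail d = u → G.tail d' = u' → f d = f d' := by
    rintro u u' ⟨q⟩
    induction q with
    | @nil u =>
      intro d d' hd hd'
      exact hv d d' (hd.trans hd'.symm) (hd ▸ u.2)
    | @cons u w u' hadj q ih =>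
      intro d d' hd hd'
      have hstep : ∃ x, G.tail x = u ∧ G.tail (rev E x) = w := by
        simp only [SimpleGraph.comap_adj, Multigraph.simple, SimpleGraph.fromRel_adj,
          Function.Embedding.subtype_apply] at hadj
        obtain ⟨-, h'⟩ := hadj
        have hu := u.2
        have hw := w.2
        simp only [Set.mem_compl_iff, Set.mem_singleton_iff] at hu hw
        rcases h' with ⟨e, h1, h2⟩ | ⟨e, h1, h2⟩
        · cases e with
          -- The additional edge `st` has an end at the deleted pole, so walks avoiding that pole do
          -- not use it.
          | none =>
            exfalso
            rcases hp with rfl | rfl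
            · exact hu h1.symm
            · exact hw h2.symm
          | some e => exact ⟨(e, false), h1, h2⟩
        · cases e with
          | none =>
            exfalso
            rcases hp with rfl | rfl
            · exact hw h1.symm
            · exact hu h2.symm
          | some e => exact ⟨(e, true), h2, h1⟩
      obtain ⟨x, hx, hx'⟩ := hstep
      rw [hv d x (hd.trans hx.symm) (hd ▸ u.2), ← hrev x]
      exact ih _ _ hx' hd'
  have key' : ∀ d d', G.tail d ≠ p → G.tail d' ≠ p → f d = f d' := fun d d' hd hd' =>
    key ⟨_, hd⟩ ⟨_, hd'⟩ (h.biconnected.2 p _ _) d d' rfl rfl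
  -- Darts at `p` are treated through their reversals, which start elsewhere because there are no
  -- loops.
  have hred : ∀ d, ∃ x, G.tail x ≠ p ∧ f x = f d := by
    intro d
    by_cases hd : G.tail d = p
    · exact ⟨rev E d, hd ▸ Multigraph.tail_rev_ne h.loopless d, hrev d⟩
    · exact ⟨d, hd, rfl⟩
  obtain ⟨x, hx, hxd⟩ := hred d
  obtain ⟨y, hy, hyd⟩ := hred d'
  rw [← hxd, ← hyd, key' x y hx hy]

theorem perm_apply_inv {D : Type*} (p : Perm D) (d : D) : p (p⁻¹ d) = d := p.apply_symm_apply d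

theorem eq_of_sameCycle {D α : Type*} [Finite D] {p : Perm D} {f : D → α} (hf : ∀ d, f (p d) = f d)
    {a b : D} (h : p.SameCycle a b) : f a = f b := by
  obtain ⟨i, rfl⟩ := h.exists_nat_pow_eq
  induction i with
  | zero => rfl
  | succ i ih => rw [pow_succ', Perm.mul_apply, hf]; exact ih ⟨i, by simp⟩

variable [Fintype E]

theorem PoleGraph.IsSTGraph.transitive (h : G.IsSTGraph) {n : Perm (E × Bool)}
    (hn : ∀ d d', n.SameCycle d d' ↔ G.tail d = G.tail d') : Transitive n := fun _ hf hrev =>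
  h.eq_of_invariant (Or.inl rfl) hrev fun _ _ hd _ => eq_of_sameCycle hf ((hn _ _).2 hd)

theorem card_le_cycleCount {D α : Type} [Finite D] {p : Perm D} {f : D → α}
    (hf : ∀ d, f (p d) = f d) (hs : Function.Surjective f) : Nat.card α ≤ cycleCount p := by
  refine Nat.card_le_card_of_surjective
    (Quotient.lift (s := Perm.SameCycle.setoid p) f fun _ _ h => eq_of_sameCycle hf h) ?_
  intro a
  obtain ⟨d, rfl⟩ := hs a
  exact ⟨Quotient.mk _ d, rfl⟩

end Connectivity

/-! ### Rotation sums and Euler's formula -/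

section RotationSum

variable {V E : Type} [Fintype E]

theorem sum_eq_zero_of_rev {e : E × Bool → ℤ} (he : ∀ d, e d + e (rev E d) = 0) :
    ∑ d, e d = 0 := by
  have h1 : ∑ d, e (rev E d) = ∑ d, e d := Equiv.sum_comp (rev E) e
  have h2 : ∑ d, (e d + e (rev E d)) = 0 := Finset.sum_eq_zero fun d _ => he d
  rw [Finset.sum_add_distrib] at h2
  linarith

open Classical in
theorem Multigraph.degree_eq (G : Multigraph V E) (v : V) :
    G.degree v = (Finset.univ.filter fun d => G.tail d = v).card := by
  rw [Multigraph.degree, Nat.card_eq_fintype_card, Fintype.card_subtype]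

-- The edge rotations cancel in pairs, and the vertex sums are evaluated with the handshake
-- identity.
open Classical in
theorem sum_rotations [Fintype V] {G : Multigraph V E} {e v : E × Bool → ℤ}
    (he : ∀ d, e d + e (rev E d) = 0)
    (hv : ∀ u, ∑ d with G.tail d = u, v d = 2 * (G.degree u : ℤ) - 4) :
    ∑ d, (e d + v d) = 4 * (Nat.card E : ℤ) - 4 * Nat.card V := by
  rw [Finset.sum_add_distrib, sum_eq_zero_of_rev he, ← Finset.sum_fiberwise Finset.univ G.tail v]
  have h1 : ∑ u : V, (G.degree u : ℤ) = 2 * Nat.card E := by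
    have := Finset.sum_fiberwise Finset.univ G.tail fun _ => (1 : ℤ)
    simp only [Finset.sum_const, Finset.card_univ, Fintype.card_prod, Fintype.card_bool,
      nsmul_eq_mul, mul_one] at this
    simp only [Multigraph.degree_eq, this, Nat.card_eq_fintype_card]
    push_cast
    ring
  simp only [hv, Finset.sum_sub_distrib, ← Finset.mul_sum, h1]
  simp [Nat.card_eq_fintype_card]
  ring

open Classical in
/-- An orthogonal representation without the conditions on the faces at the two poles. -/
structure PreRep (G : PoleGraph V E) where
  next : Perm (E × Bool)
  eRot : E × Bool → ℤ
  vRot : E × Bool → ℤ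
  outS : E × Bool
  outT : E × Bool
  sameCycle_next : ∀ d d', next.SameCycle d d' ↔ G.tail d = G.tail d'
  tail_outS : G.tail outS = G.s
  tail_outT : G.tail outT = G.t
  sum_inner : ∀ d, ¬ (next * rev E).SameCycle outS d → ¬ (next * rev E).SameCycle outT d →
    cycleSum (next * rev E) (fun x => eRot x + vRot x) d = 4
  edge_rot : ∀ d, eRot d + eRot (rev E d) = 0
  sum_vertex : ∀ v, ∑ d with G.tail d = v, vRot d = 2 * (G.degree v : ℤ) - 4
  vRot_mem : ∀ d, vRot d ∈ Set.Icc (-2) 1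

namespace PreRep

variable {G : PoleGraph V E} (P : PreRep G)

def face : Perm (E × Bool) := P.next * rev E

/-- The sum of the rotations in the face to the right of a dart. -/
noncomputable def faceSum (d : E × Bool) : ℤ := cycleSum P.face (fun x => P.eRot x + P.vRot x) d

theorem tail_next (d : E × Bool) : G.tail (P.next d) = G.tail d :=
  (P.sameCycle_next _ _).1 (Perm.sameCycle_apply_left.2 (Perm.SameCycle.refl _ _))

/-- Euler's formula follows from the rotation conditions. -/
noncomputable def toOrthRep [Fintype V] (h : P.face.SameCycle P.outS P.outT) (hsum : P.faceSum P.outS = -4) :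
    OrthRep G where
  next := P.next
  sameCycle_next := P.sameCycle_next
  euler := by
    have h1 := four_mul_cycleCount_one (p := P.face) (f := fun x => P.eRot x + P.vRot x)
      (a := P.outS) fun d hd => P.sum_inner d hd fun h' => hd (h.trans h')
    have h2 := sum_rotations P.edge_rot P.sum_vertex
    unfold faceSum at hsum
    rw [hsum, h2] at h1
    change _ + cycleCount P.face = _
    omega
  eRot := P.eRot
  vRot := P.vRot
  outS := P.outS
  outT := P.outT
  tail_outS := P.tail_outS
  tail_outT := P.tail_outT
  same_outer := h
  sum_outer := (cycleSum_eq _ _ _).symm.trans hsum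
  sum_inner := fun d hd =>
    (cycleSum_eq _ _ _).symm.trans (P.sum_inner d hd fun h' => hd (h.trans h'))
  edge_rot := P.edge_rot
  sum_vertex := P.sum_vertex
  vRot_mem := P.vRot_mem

theorem euler_le (hG : G.IsSTGraph) : Nat.card V + cycleCount P.face ≤ Nat.card E + 2 := by
  have h1 := euler_inequality (hG.transitive P.sameCycle_next)
  have h2 := card_le_cycleCount (p := P.next) (f := G.tail) P.tail_next hG.exists_tail
  unfold face
  omega

/-- For the restriction of a planar representation only this bound is available at first. Equality
will follow by adding the bounds of both parts, and it is what `toOrthRep` needs. -/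
theorem faceSum_ge [Fintype V] (hG : G.IsSTGraph) (h : P.face.SameCycle P.outS P.outT) :
    -4 ≤ P.faceSum P.outS := by
  have h1 := four_mul_cycleCount_one (p := P.face) (f := fun x => P.eRot x + P.vRot x)
    (a := P.outS) fun d hd => P.sum_inner d hd fun h' => hd (h.trans h')
  rw [sum_rotations P.edge_rot P.sum_vertex] at h1
  have := P.euler_le hG
  unfold faceSum
  omega

/-- With two exceptional faces the bound rises from `-4` to `0`. This excludes decompositions in
which the poles of a part lie on different faces. -/
theorem faceSum_add_ge [Fintype V] (hG : G.IsSTGraph) (h : ¬ P.face.SameCycle P.outS P.outT) :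
    0 ≤ P.faceSum P.outS + P.faceSum P.outT := by
  have h1 := four_mul_cycleCount_two (p := P.face) (f := fun x => P.eRot x + P.vRot x)
    h P.sum_inner
  rw [sum_rotations P.edge_rot P.sum_vertex] at h1
  have := P.euler_le hG
  unfold faceSum
  omega

end PreRep

end RotationSum

/-! ### Rotation of the two boundary paths -/

namespace OrthRep

variable {V E : Type} [Fintype E] {G : PoleGraph V E} (R : OrthRep G)

theorem tail_next (d : E × Bool) : G.tail (R.next d) = G.tail d :=
  (R.sameCycle_next _ _).1 (Perm.sameCycle_apply_left.2 (Perm.SameCycle.refl _ _))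

theorem cycleSum_outS :
    cycleSum R.face (fun x => R.eRot x + R.vRot x) R.outS = -4 := by
  rw [← R.sum_outer, cycleSum_eq]

theorem cycleSum_inner {d : E × Bool} (hd : ¬ R.face.SameCycle R.outS d) :
    cycleSum R.face (fun x => R.eRot x + R.vRot x) d = 4 := by
  rw [← R.sum_inner d hd, cycleSum_eq]

theorem rotPath_eq {a b : E × Bool} {r : ℤ} (hab : a ≠ b)
    (h : Arc R.face R.eRot R.vRot {b} a b r) : R.rotPath a b = r := by
  obtain ⟨k, hk, hB, rfl⟩ := h.exists_pow
  have hinf : sInf {k : ℕ | (R.face ^ k) a = b} = k + 1 := by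
    refine IsLeast.csInf_eq ⟨hk, fun j hj => ?_⟩
    by_contra hlt
    rw [not_le] at hlt
    cases j with
    | zero => exact hab hj
    | succ j => exact hB j (by omega) hj
  unfold rotPath
  rw [hinf, Finset.sum_Ico_eq_sum_range]
  simp [add_comm 1]

variable {R}

theorem outS_ne_outT (hG : G.s ≠ G.t) : R.outS ≠ R.outT := fun h =>
  hG (by rw [← R.tail_outS, h, R.tail_outT])

theorem arc_outS (hG : G.s ≠ G.t) : Arc R.face R.eRot R.vRot {R.outS, R.outT} R.outS R.outT
    (R.rotPath R.outS R.outT) := by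
  have hne := outS_ne_outT (R := R) hG
  obtain ⟨r, hr⟩ := exists_arc_pair R.eRot R.vRot hne R.same_outer
  rwa [R.rotPath_eq hne (hr.anti (by simp) (by simp))]

theorem arc_outT (hG : G.s ≠ G.t) : Arc R.face R.eRot R.vRot {R.outS, R.outT} R.outT R.outS
    (R.rotPath R.outT R.outS) := by
  have hne := outS_ne_outT (R := R) hG
  obtain ⟨r, hr⟩ := exists_arc_pair R.eRot R.vRot hne.symm R.same_outer.symm
  rw [Set.pair_comm] at hr
  rwa [R.rotPath_eq hne.symm (hr.anti (by simp) (by simp))]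

/-- The rotations of the two boundary paths and of the poles add up to `-4`. -/
theorem rotPath_add (hG : G.s ≠ G.t) : R.rotPath R.outS R.outT + R.vRot R.outT +
    R.rotPath R.outT R.outS + R.vRot R.outS = -4 := by
  have hne := outS_ne_outT (R := R) hG
  have h := ((arc_outS hG).trans (B' := {R.outS}) (by simp) (by simpa using hne.symm)
    ((arc_outT hG).anti (by simp) (by simp))).cycleSum_eq
  rw [← h, R.cycleSum_outS]

/-- The rotations of the two paths have the sum `2 - σ - τ ≤ 0`, so the larger absolute value is
attained by a path of nonpositive rotation. -/
theorem bends_eq (hG : G.s ≠ G.t) {σ τ : ℕ} (h : R.IsST σ τ) : (R.bends : ℤ) =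
    max (-R.rotPath R.outS R.outT) (R.rotPath R.outS R.outT + σ + τ - 2) := by
  have h1 := rotPath_add (R := R) hG
  have h2 := R.vRot_mem R.outS
  have h3 := R.vRot_mem R.outT
  rw [Set.mem_Icc] at h2 h3
  rw [h.1] at h1 h2
  rw [h.2] at h1 h3
  unfold bends
  omega

theorem IsST.mem_Icc {σ τ : ℕ} (h : R.IsST σ τ) : σ ∈ Finset.Icc 1 4 ∧ τ ∈ Finset.Icc 1 4 := by
  have h2 := R.vRot_mem R.outS
  have h3 := R.vRot_mem R.outT
  rw [Set.mem_Icc] at h2 h3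
  rw [h.1] at h2
  rw [h.2] at h3
  simp only [Finset.mem_Icc]
  omega

theorem exists_isST (R : OrthRep G) : ∃ σ τ : ℕ, R.IsST σ τ := by
  have h2 := R.vRot_mem R.outS
  have h3 := R.vRot_mem R.outT
  rw [Set.mem_Icc] at h2 h3
  refine ⟨(R.vRot R.outS + 3).toNat, (R.vRot R.outT + 3).toNat, ?_, ?_⟩ <;> omega

end OrthRep

/-! ### Mirror images -/

section Mirror

variable {V E : Type}

theorem cycleSum_comp {D : Type} [Fintype D] (p : Perm D) (f : D → ℤ) (d : D) :
    cycleSum p (fun x => f (p x)) d = cycleSum p f d :=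
  cycleSum_equiv p (fun _ => (Perm.sameCycle_apply_right).symm) fun _ => rfl

/-- The identity `n⁻¹ * rev = rev * (n * rev)⁻¹ * rev⁻¹` says that the mirrored faces are the old
ones, traversed backwards with reversed darts. -/
theorem sameCycle_mirror (n : Perm (E × Bool)) (d x : E × Bool) :
    (n⁻¹ * rev E).SameCycle d x ↔ (n * rev E).SameCycle (rev E d) (rev E x) := by
  have hrev : (rev E)⁻¹ = rev E := by
    rw [inv_eq_iff_mul_eq_one]
    ext1 d
    exact rev_rev d
  have h : n⁻¹ * rev E = rev E * (n * rev E)⁻¹ * (rev E)⁻¹ := by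
    rw [mul_inv_rev, hrev, ← mul_assoc]
    nth_rewrite 2 [← hrev]
    simp
  rw [h, Perm.sameCycle_conj, Perm.sameCycle_inv, hrev]

variable [Fintype E] {G : PoleGraph V E}

/-- Reversal shifts the vertex rotations by one place against the edge rotations, which does not
change a sum over a whole cycle. -/
theorem cycleSum_mirror (n : Perm (E × Bool)) (e v : E × Bool → ℤ) (d : E × Bool) :
    cycleSum (n⁻¹ * rev E) (fun x => e (rev E x) + v (n x)) d =
      cycleSum (n * rev E) (fun x => e x + v x) (rev E d) := by
  have h1 := cycleSum_comp (n * rev E) v (rev E d)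
  have h2 : cycleSum (n⁻¹ * rev E) (fun x => e (rev E x) + v (n x)) d =
      cycleSum (n * rev E) (fun x => e x + v ((n * rev E) x)) (rev E d) :=
    cycleSum_equiv (rev E) (sameCycle_mirror n d) fun x => by simp only [Perm.mul_apply, rev_rev]
  rw [h2]
  unfold cycleSum at h1 ⊢
  rw [Finset.sum_add_distrib, Finset.sum_add_distrib, h1]

theorem OrthRep.face_rev_inv (R : OrthRep G) (d : E × Bool) :
    R.face (rev E (R.next⁻¹ d)) = d := by
  simp [Embedding.face, rev_rev]

/-- The rotation data of the mirror image of an orthogonal representation. -/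
noncomputable def OrthRep.mirrorPre (R : OrthRep G) : PreRep G where
  next := R.next⁻¹
  eRot d := R.eRot (rev E d)
  -- The angle between `d` and `R.next d` belongs to the dart at its counter-clockwise end: to
  -- `R.next d` before and to `d` after the reflection.
  vRot d := R.vRot (R.next d)
  outS := R.next⁻¹ R.outS
  outT := R.next⁻¹ R.outT
  sameCycle_next d d' := by rw [Perm.sameCycle_inv, R.sameCycle_next]
  tail_outS := by rw [← R.tail_next, perm_apply_inv, R.tail_outS]
  tail_outT := by rw [← R.tail_next, perm_apply_inv, R.tail_outT]
  sum_inner d hd _ := by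
    rw [cycleSum_mirror]
    refine R.cycleSum_inner fun h => hd ?_
    rw [sameCycle_mirror]
    refine Perm.SameCycle.trans ?_ h
    rw [← Perm.sameCycle_apply_left]
    simpa [rev_rev] using Perm.SameCycle.refl _ _
  edge_rot d := R.edge_rot _
  sum_vertex u := by
    rw [← R.sum_vertex u]
    exact Finset.sum_equiv R.next (by simp [R.tail_next]) fun _ _ => rfl
  vRot_mem d := R.vRot_mem _

variable [Fintype V]

/-- The mirror image of an orthogonal representation. -/
noncomputable def OrthRep.mirror (R : OrthRep G) : OrthRep G :=
  R.mirrorPre.toOrthRep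
    (by
      change (R.next⁻¹ * rev E).SameCycle (R.next⁻¹ R.outS) (R.next⁻¹ R.outT)
      rw [sameCycle_mirror, ← Perm.sameCycle_apply_left, ← Perm.sameCycle_apply_right]
      have h := R.same_outer
      rwa [← R.face_rev_inv R.outS, ← R.face_rev_inv R.outT] at h)
    (by
      change cycleSum (R.next⁻¹ * rev E) (fun x => R.eRot (rev E x) + R.vRot (R.next x))
        (R.next⁻¹ R.outS) = -4
      rw [cycleSum_mirror, ← R.cycleSum_outS]
      refine cycleSum_congr ?_
      rw [← Perm.sameCycle_apply_left]
      simpa [rev_rev] using Perm.SameCycle.refl _ _)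

namespace OrthRep

variable (R : OrthRep G)

theorem isST_mirror {σ τ : ℕ} (h : R.IsST σ τ) : R.mirror.IsST σ τ := by
  constructor
  · change R.vRot (R.next (R.next⁻¹ R.outS)) = _
    rw [perm_apply_inv, h.1]
  · change R.vRot (R.next (R.next⁻¹ R.outT)) = _
    rw [perm_apply_inv, h.2]

theorem cost_mirror (w : E → ℕ → WithTop ℝ) : R.mirror.cost w = R.cost w := by
  unfold cost
  refine Finset.sum_congr rfl fun e _ => ?_
  change w e (R.eRot (rev E (e, false))).natAbs = _
  have := R.edge_rot (e, false)
  rw [show (R.eRot (rev E (e, false))).natAbs = (R.eRot (e, false)).natAbs by omega]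

theorem restricted_mirror {W : Set V} (h : R.Restricted W) : R.mirror.Restricted W := by
  intro v hv hdeg
  obtain ⟨d, hd, hr⟩ := h v hv hdeg
  refine ⟨R.next⁻¹ d, ?_, ?_⟩
  · rw [← R.tail_next, perm_apply_inv, hd]
  · change R.vRot (R.next (R.next⁻¹ d)) = 1
    rw [perm_apply_inv, hr]

/-- Let `x 0, …, x k` be the darts of the path from `t` to `s`. The mirrored path from `s` to `t`
visits `rev (x k), …, rev (x 0)`, so both sums are merely reversed. -/
theorem rotPath_mirror (hG : G.s ≠ G.t) :
    R.mirror.rotPath R.mirror.outS R.mirror.outT = R.rotPath R.outT R.outS := by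
  obtain ⟨k, hk, hB, hr⟩ := (arc_outT (R := R) hG).exists_pow
  refine R.mirror.rotPath_eq (outS_ne_outT hG) ?_
  rw [hr]
  set x : ℕ → E × Bool := fun i => (R.face ^ i) R.outT with hx
  have hxs : ∀ j, R.next (rev E (x j)) = x (j + 1) := fun j => by
    simp only [hx, pow_succ', Perm.mul_apply]; rfl
  have hS : R.mirror.outS = rev E (x k) := by
    change R.next⁻¹ R.outS = _
    rw [Perm.inv_eq_iff_eq, hxs, ← hk]
  have hT : ∀ j, rev E (x j) = R.mirror.outT → x (j + 1) = R.outT := by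
    intro j hj
    rw [← hxs, hj]
    exact perm_apply_inv _ _
  have hpow : ∀ i ≤ k, (R.mirror.face ^ i) (rev E (x k)) = rev E (x (k - i)) := by
    intro i
    induction i with
    | zero => intro _; rfl
    | succ i ih =>
      intro hi
      rw [pow_succ', Perm.mul_apply, ih (by omega)]
      change R.next⁻¹ (rev E (rev E _)) = _
      rw [rev_rev, Perm.inv_eq_iff_eq, hxs]
      congr 1
      omega
  have hend : (R.mirror.face ^ (k + 1)) R.mirror.outS = R.mirror.outT := by
    rw [hS, pow_succ', Perm.mul_apply, hpow k le_rfl]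
    change R.next⁻¹ (rev E (rev E _)) = R.next⁻¹ R.outT
    rw [rev_rev]
    simp [hx]
  have := Arc.of_pow (p := R.mirror.face) (e := R.mirror.eRot) (v := R.mirror.vRot)
    (B := {R.mirror.outT}) (a := R.mirror.outS) k hend (by
      intro i hi h
      rw [hS, hpow _ (by omega)] at h
      have h1 := hT _ h
      refine hB (k - (i + 1)) (by omega) ?_
      change x (k - (i + 1) + 1) ∈ _
      rw [h1]
      simp)
  rw [hend] at this
  convert this using 2
  · rw [← Finset.sum_range_reflect]
    refine Finset.sum_congr rfl fun i hi => ?_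
    rw [Finset.mem_range] at hi
    rw [hS, hpow _ (by omega)]
    change _ = R.eRot (rev E (rev E _))
    rw [rev_rev]
    rfl
  · rw [← Finset.sum_range_reflect]
    refine Finset.sum_congr rfl fun i hi => ?_
    rw [Finset.mem_range] at hi
    rw [hS, hpow _ (by omega)]
    change _ = R.vRot (R.next (rev E _))
    rw [hxs]
    change R.vRot (x _) = _
    congr 2
    omega

theorem bends_mirror (hG : G.s ≠ G.t) : R.mirror.bends = R.bends := by
  obtain ⟨σ, τ, h⟩ := R.exists_isST
  have h1 := bends_eq hG h
  have h2 := bends_eq hG (R.isST_mirror h)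
  have h3 := rotPath_add (R := R) hG
  rw [rotPath_mirror R hG] at h2
  rw [h.1, h.2] at h3
  omega

end OrthRep

end Mirror

end BendCost

namespace BendCost

open Equiv

/-! ### Transport of cycles along injections -/

section Transport

variable {D D' : Type} [Finite D'] {p : Perm D} {p' : Perm D'} {J : D' → D}

theorem exists_perm_restrict (hJ : Function.Injective J) (hp : ∀ a, ∃ b, p (J a) = J b) :
    ∃ p' : Perm D', ∀ a, p (J a) = J (p' a) := by
  choose f hf using hp
  have hinj : Function.Injective f := fun a b hab => hJ (p.injective (by rw [hf, hf, hab]))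
  exact ⟨Equiv.ofBijective f hinj.bijective_of_finite, hf⟩

variable [Finite D]

theorem sameCycle_map_iff (hp : ∀ a, p (J a) = J (p' a)) {a : D'}
    {x : D} : p.SameCycle (J a) x ↔ ∃ b, J b = x ∧ p'.SameCycle a b := by
  have key : ∀ i : ℕ, (p ^ i) (J a) = J ((p' ^ i) a) := by
    intro i
    induction i with
    | zero => rfl
    | succ i ih => rw [pow_succ', Perm.mul_apply, ih, hp, pow_succ', Perm.mul_apply]
  constructor
  · intro h
    obtain ⟨i, rfl⟩ := h.exists_nat_pow_eq
    exact ⟨(p' ^ i) a, (key i).symm, i, by simp⟩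
  · rintro ⟨b, rfl, h⟩
    obtain ⟨i, rfl⟩ := h.exists_nat_pow_eq
    exact ⟨i, by rw [zpow_natCast, key]⟩

theorem sameCycle_map (hJ : Function.Injective J) (hp : ∀ a, p (J a) = J (p' a)) {a b : D'} :
    p.SameCycle (J a) (J b) ↔ p'.SameCycle a b := by
  rw [sameCycle_map_iff hp]
  constructor
  · rintro ⟨c, hc, h⟩
    rwa [← hJ hc]
  · exact fun h => ⟨b, rfl, h⟩

end Transport

theorem cycleSum_map {D D' : Type} [Fintype D] [Fintype D'] {p : Perm D} {p' : Perm D'}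
    {J : D' → D} (hJ : Function.Injective J) (hp : ∀ a, p (J a) = J (p' a)) (f : D → ℤ) (a : D') :
    cycleSum p f (J a) = cycleSum p' (fun b => f (J b)) a := by
  classical
  symm
  refine Finset.sum_bij (fun b _ => J b) ?_ (fun b _ c _ h => hJ h) ?_ fun _ _ => rfl
  · intro b hb
    simpa [sameCycle_map hJ hp] using hb
  · intro x hx
    simp only [Finset.mem_filter, Finset.mem_univ, true_and, sameCycle_map_iff hp] at hx
    obtain ⟨b, rfl, h⟩ := hx
    exact ⟨b, by simpa using h, rfl⟩

theorem cycleSum_congr_fun {D : Type} [Fintype D] {p : Perm D} {f f' : D → ℤ} {d : D}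
    (h : ∀ x, p.SameCycle d x → f x = f' x) : cycleSum p f d = cycleSum p f' d :=
  Finset.sum_congr rfl fun x hx => h x (by simpa using hx)

/-! ### Gluing two graphs -/

/-- The graph `G` is the edge-disjoint union of `G₁` and `G₂`, whose vertices and darts are
included by `ι₁`, `ι₂` and `J₁`, `J₂`. -/
structure Gluing {V₁ E₁ V₂ E₂ V E : Type} (G₁ : Multigraph V₁ E₁) (G₂ : Multigraph V₂ E₂)
    (G : Multigraph V E) (ι₁ : V₁ → V) (ι₂ : V₂ → V) (J₁ : E₁ × Bool → E × Bool)
    (J₂ : E₂ × Bool → E × Bool) : Prop where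
  ι₁_inj : Function.Injective ι₁
  ι₂_inj : Function.Injective ι₂
  ι_cases : ∀ v, (∃ u, ι₁ u = v) ∨ ∃ w, ι₂ w = v
  J₁_inj : Function.Injective J₁
  J₂_inj : Function.Injective J₂
  J_disj : ∀ a b, J₁ a ≠ J₂ b
  J_cases : ∀ x, (∃ a, J₁ a = x) ∨ ∃ b, J₂ b = x
  tail_J₁ : ∀ a, G.tail (J₁ a) = ι₁ (G₁.tail a)
  tail_J₂ : ∀ b, G.tail (J₂ b) = ι₂ (G₂.tail b)
  rev_J₁ : ∀ a, rev E (J₁ a) = J₁ (rev E₁ a)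
  rev_J₂ : ∀ b, rev E (J₂ b) = J₂ (rev E₂ b)

/-! ### Correcting the rotations around one vertex -/

section VertexSum

variable {V E : Type} [Fintype E]

open Classical in
theorem sum_tail_congr_off {G : Multigraph V E} {f v : E × Bool → ℤ} {a : E × Bool}
    (h : ∀ b, G.tail b = G.tail a → b ≠ a → f b = v b) :
    ∑ b with G.tail b = G.tail a, f b = ∑ b with G.tail b = G.tail a, v b + f a - v a := by
  have ha : a ∈ Finset.univ.filter fun b => G.tail b = G.tail a := by simp
  rw [← Finset.add_sum_erase _ f ha, ← Finset.add_sum_erase _ v ha,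
    Finset.sum_congr rfl fun b hb => h b (by simp at hb; exact hb.2) (by simp at hb; exact hb.1)]
  ring

open Classical in
/-- The value at the dart `a` that gives the rotations around `tail a` the required sum. -/
noncomputable def fillVal (G : Multigraph V E) (v : E × Bool → ℤ) (a : E × Bool) : ℤ :=
  2 * (G.degree (G.tail a) : ℤ) - 4 - ∑ b with G.tail b = G.tail a, v b + v a

/-- The other `deg - 1` incidences have rotation at most `1`, which leaves at least `(2 deg - 4) -
(deg - 1) = deg - 3 ≥ -2`. -/
theorem neg_two_le_fillVal {G : Multigraph V E} {v : E × Bool → ℤ} (hv : ∀ d, v d ≤ 1)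
    (a : E × Bool) : -2 ≤ fillVal G v a := by
  classical
  have ha : a ∈ Finset.univ.filter fun b => G.tail b = G.tail a := by simp
  have h1 : ∑ b ∈ (Finset.univ.filter fun b => G.tail b = G.tail a).erase a, v b ≤ _ :=
    Finset.sum_le_card_nsmul _ v 1 fun b _ => hv b
  have h2 := Finset.add_sum_erase _ v ha
  have h3 := Finset.card_erase_add_one ha
  unfold fillVal
  rw [Multigraph.degree_eq]
  simp only [nsmul_eq_mul, mul_one] at h1
  have h4 := Finset.card_pos.2 ⟨a, ha⟩
  zify at h3
  omega

open Classical in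
theorem sum_tail_fill {G : Multigraph V E} {f v : E × Bool → ℤ} {a : E × Bool}
    (h : ∀ b, G.tail b = G.tail a → b ≠ a → f b = v b) (ha : f a = fillVal G v a) :
    ∑ b with G.tail b = G.tail a, f b = 2 * (G.degree (G.tail a) : ℤ) - 4 := by
  rw [sum_tail_congr_off h, ha]
  unfold fillVal
  ring

end VertexSum

namespace Gluing

variable {V₁ E₁ V₂ E₂ V E : Type} {G₁ : Multigraph V₁ E₁} {G₂ : Multigraph V₂ E₂}
  {G : Multigraph V E} {ι₁ : V₁ → V} {ι₂ : V₂ → V} {J₁ : E₁ × Bool → E × Bool}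
  {J₂ : E₂ × Bool → E × Bool} (h : Gluing G₁ G₂ G ι₁ ι₂ J₁ J₂)

include h

theorem symm : Gluing G₂ G₁ G ι₂ ι₁ J₂ J₁ where
  ι₁_inj := h.ι₂_inj
  ι₂_inj := h.ι₁_inj
  ι_cases v := (h.ι_cases v).symm
  J₁_inj := h.J₂_inj
  J₂_inj := h.J₁_inj
  J_disj a b := (h.J_disj b a).symm
  J_cases x := (h.J_cases x).symm
  tail_J₁ := h.tail_J₂
  tail_J₂ := h.tail_J₁
  rev_J₁ := h.rev_J₂
  rev_J₂ := h.rev_J₁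

theorem bijective : Function.Bijective (Sum.elim J₁ J₂) := by
  constructor
  · rintro (a | a) (b | b) hab
    · rw [h.J₁_inj hab]
    · exact absurd hab (h.J_disj a b)
    · exact absurd hab.symm (h.J_disj b a)
    · rw [h.J₂_inj hab]
  · intro x
    rcases h.J_cases x with ⟨a, rfl⟩ | ⟨b, rfl⟩
    · exact ⟨Sum.inl a, rfl⟩
    · exact ⟨Sum.inr b, rfl⟩

theorem exists_perm (n₁ : Perm (E₁ × Bool)) (n₂ : Perm (E₂ × Bool)) :
    ∃ n : Perm (E × Bool), (∀ a, n (J₁ a) = J₁ (n₁ a)) ∧ ∀ b, n (J₂ b) = J₂ (n₂ b) := by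
  let j := Equiv.ofBijective _ h.bijective
  have h1 : ∀ a, j.symm (J₁ a) = Sum.inl a := fun a => by rw [Equiv.symm_apply_eq]; rfl
  have h2 : ∀ b, j.symm (J₂ b) = Sum.inr b := fun a => by rw [Equiv.symm_apply_eq]; rfl
  refine ⟨(j.symm.trans (Equiv.sumCongr n₁ n₂)).trans j, fun a => ?_, fun b => ?_⟩
  · simp only [Equiv.trans_apply, h1]; rfl
  · simp only [Equiv.trans_apply, h2]; rfl

theorem exists_fun (f₁ : E₁ × Bool → ℤ) (f₂ : E₂ × Bool → ℤ) :
    ∃ f : E × Bool → ℤ, (∀ a, f (J₁ a) = f₁ a) ∧ ∀ b, f (J₂ b) = f₂ b := by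
  let j := Equiv.ofBijective _ h.bijective
  have h1 : ∀ a, j.symm (J₁ a) = Sum.inl a := fun a => by rw [Equiv.symm_apply_eq]; rfl
  have h2 : ∀ b, j.symm (J₂ b) = Sum.inr b := fun a => by rw [Equiv.symm_apply_eq]; rfl
  exact ⟨fun x => Sum.elim f₁ f₂ (j.symm x), fun a => by simp only [h1, Sum.elim_inl],
    fun b => by simp only [h2, Sum.elim_inr]⟩

variable [Fintype E₁] [Fintype E₂] [Fintype E]

open Classical in
theorem sum_tail (f : E × Bool → ℤ) (q : V) : ∑ x with G.tail x = q, f x =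
    ∑ a with ι₁ (G₁.tail a) = q, f (J₁ a) + ∑ b with ι₂ (G₂.tail b) = q, f (J₂ b) := by
  rw [Finset.sum_filter, Finset.sum_filter, Finset.sum_filter,
    ← Equiv.sum_comp (Equiv.ofBijective _ h.bijective), Fintype.sum_sum_type]
  simp only [Equiv.ofBijective_apply, Sum.elim_inl, Sum.elim_inr, h.tail_J₁, h.tail_J₂]

open Classical in
theorem sum_tail_unshared (f : E × Bool → ℤ) {u : V₁} (hu : ∀ w, ι₁ u ≠ ι₂ w) :
    ∑ x with G.tail x = ι₁ u, f x = ∑ a with G₁.tail a = u, f (J₁ a) := by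
  rw [h.sum_tail, add_eq_left.2]
  · simp only [h.ι₁_inj.eq_iff]
  · rw [Finset.sum_filter]
    exact Finset.sum_eq_zero fun b _ => if_neg (hu _).symm

open Classical in
theorem sum_tail_shared (f : E × Bool → ℤ) {u : V₁} {w : V₂} (hu : ι₁ u = ι₂ w) :
    ∑ x with G.tail x = ι₁ u, f x =
      ∑ a with G₁.tail a = u, f (J₁ a) + ∑ b with G₂.tail b = w, f (J₂ b) := by
  rw [h.sum_tail]
  simp only [hu, h.ι₂_inj.eq_iff]
  simp only [← hu, h.ι₁_inj.eq_iff]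

theorem degree_unshared {u : V₁} (hu : ∀ w, ι₁ u ≠ ι₂ w) : G.degree (ι₁ u) = G₁.degree u := by
  classical
  have := h.sum_tail_unshared (fun _ => 1) hu
  simp only [Finset.sum_const, nsmul_eq_mul, mul_one] at this
  rw [Multigraph.degree_eq, Multigraph.degree_eq]
  exact_mod_cast this

theorem degree_shared {u : V₁} {w : V₂} (hu : ι₁ u = ι₂ w) :
    G.degree (ι₁ u) = G₁.degree u + G₂.degree w := by
  classical
  have := h.sum_tail_shared (fun _ => 1) hu
  simp only [Finset.sum_const, nsmul_eq_mul, mul_one] at this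
  rw [Multigraph.degree_eq, Multigraph.degree_eq, Multigraph.degree_eq]
  exact_mod_cast this

/-- The required vertex sums satisfy `(2d₁ - 4) + (2d₂ - 4) = 2(d₁ + d₂) - 4 - 4`. If the rotations
`v` are at most `1`, the two filled values have a sum of at most `-2`; as each is at least `-2`,
both are at most `0` and hence admissible. -/
theorem fillVal_add {v : E × Bool → ℤ} {a : E₁ × Bool} {b : E₂ × Bool}
    (hab : G.tail (J₁ a) = G.tail (J₂ b))
    (hv : open Classical in ∑ x with G.tail x = G.tail (J₁ a), v x =
      2 * (G.degree (G.tail (J₁ a)) : ℤ) - 4) :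
    fillVal G₁ (fun a => v (J₁ a)) a + fillVal G₂ (fun b => v (J₂ b)) b =
      v (J₁ a) + v (J₂ b) - 4 := by
  classical
  rw [h.tail_J₁, h.tail_J₂] at hab
  rw [h.tail_J₁, h.sum_tail_shared _ hab, h.degree_shared hab] at hv
  unfold fillVal
  push_cast at hv
  linarith

omit [Fintype E₁] [Fintype E₂] [Fintype E] in
theorem tail_perm {n : Perm (E × Bool)} {n₁ : Perm (E₁ × Bool)} {n₂ : Perm (E₂ × Bool)}
    (hn₁ : ∀ a, n (J₁ a) = J₁ (n₁ a)) (hn₂ : ∀ b, n (J₂ b) = J₂ (n₂ b))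
    (h₁ : ∀ a, G₁.tail (n₁ a) = G₁.tail a) (h₂ : ∀ b, G₂.tail (n₂ b) = G₂.tail b)
    (x : E × Bool) : G.tail (n x) = G.tail x := by
  rcases h.J_cases x with ⟨a, rfl⟩ | ⟨b, rfl⟩
  · rw [hn₁, h.tail_J₁, h.tail_J₁, h₁]
  · rw [hn₂, h.tail_J₂, h.tail_J₂, h₂]

end Gluing

/-- A path along the boundary in one part is a path along the boundary of the whole, up to the
permutation `g` of the darts of `B` that glues the parts. -/
theorem Arc.glue {D D' : Type} {p g : Perm D} {p' : Perm D'} {J : D' → D} {e v : D → ℤ}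
    {e' v' : D' → ℤ} {B : Set D} {a₀ b₀ a b : D'} {r : ℤ}
    (hp : ∀ a, p (J a) = J (p' a)) (he : ∀ a, e (J a) = e' a)
    (hB : ∀ a, J a ∈ B ↔ a ∈ ({a₀, b₀} : Set _))
    (hv : ∀ a ∉ ({a₀, b₀} : Set _), v (J a) = v' a)
    (hg : ∀ d ∉ B, g d = d) (hgB : ∀ d ∈ B, g d ∈ B)
    (harc : Arc p' e' v' {a₀, b₀} a b r) : Arc (g * p) e v B (J a) (g (J b)) r :=
  (harc.map hp he hB hv).comp hg hgB

end BendCost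

/-! ### Restricting a representation to one of two glued parts -/

namespace BendCost

open Equiv

namespace Gluing

variable {V₁ E₁ V₂ E₂ V E : Type} {G₁ : PoleGraph V₁ E₁} {G₂ : PoleGraph V₂ E₂}
  {G : PoleGraph V E} {ι₁ : V₁ → V} {ι₂ : V₂ → V} {J₁ : E₁ × Bool → E × Bool}
  {J₂ : E₂ × Bool → E × Bool} [Fintype E₁] [Fintype E₂] [Fintype E]

open Classical in
/-- The rotations at the vertices of the first part, corrected at the darts of `A`. -/
noncomputable def fillRot (G₁ : PoleGraph V₁ E₁) (v : E₁ × Bool → ℤ) (A : Set (E₁ × Bool))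
    (a : E₁ × Bool) : ℤ := if a ∈ A then fillVal G₁.toMultigraph v a else v a

/-- The restriction of an orthogonal representation of `G` to one part. The permutation `g`,
supported on the set `B` of darts, separates the parts. The rotations at the darts of `A` are
corrected. -/
noncomputable def restrict
    (h : Gluing G₁.toMultigraph G₂.toMultigraph G.toMultigraph ι₁ ι₂ J₁ J₂) (R : OrthRep G)
    {g : Perm (E × Bool)} {B : Set (E × Bool)} {n₁ : Perm (E₁ × Bool)} {S T : E₁ × Bool}
    {A : Set (E₁ × Bool)}
    (hg : ∀ d ∉ B, g d = d) (hgB : ∀ d ∈ B, g d ∈ B) (houtS : R.outS ∈ B)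
    (hBJ : ∀ a, J₁ a ∈ B ↔ a ∈ ({S, T} : Set _)) (hgt : ∀ d, G.tail (g d) = G.tail d)
    (hn₁ : ∀ a, (g * R.next) (J₁ a) = J₁ (n₁ a))
    (hS : G₁.tail S = G₁.s) (hT : G₁.tail T = G₁.t) (hp : G₁.s ≠ G₁.t)
    (hA : A ⊆ {S, T}) (hAle : ∀ a ∈ A, fillVal G₁.toMultigraph (fun a => R.vRot (J₁ a)) a ≤ 1)
    (hAsh : ∀ u, (∃ a ∈ A, G₁.tail a = u) ∨ ∀ w, ι₁ u ≠ ι₂ w) : PreRep G₁ where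
  next := n₁
  eRot a := R.eRot (J₁ a)
  vRot := fillRot G₁ (fun a => R.vRot (J₁ a)) A
  outS := S
  outT := T
  tail_outS := hS
  tail_outT := hT
  sameCycle_next a a' := by
    have htail : ∀ a, G₁.tail (n₁ a) = G₁.tail a := fun a => by
      apply h.ι₁_inj
      rw [← h.tail_J₁, ← hn₁, Perm.mul_apply, hgt, R.tail_next, h.tail_J₁]
    refine ⟨fun hc => eq_of_sameCycle htail hc, fun hc => ?_⟩
    rw [← sameCycle_map (J := J₁) h.J₁_inj hn₁]
    have hnext : R.next.SameCycle (J₁ a) (J₁ a') := by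
      rw [R.sameCycle_next, h.tail_J₁, h.tail_J₁, hc]
    -- At a vertex without darts of `B` the cyclic order is unchanged. At any other vertex each dart
    -- of the part reaches, in the new cyclic order, one of the darts `S` and `T`, and the vertex
    -- decides which.
    by_cases hav : ∀ b ∈ B, ¬ R.next.SameCycle (J₁ a) b
    · exact (sameCycle_mul_of_avoid hg hav _).2 hnext
    · push Not at hav
      obtain ⟨b, hb, hab⟩ := hav
      have key : ∀ a, R.next.SameCycle (J₁ a) b → ∃ c ∈ ({S, T} : Set _),
          (g * R.next).SameCycle (J₁ a) (J₁ c) ∧ G₁.tail a = G₁.tail c := by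
        intro a hab
        obtain ⟨d, hd, had⟩ := exists_sameCycle_mul hg hgB hb hab
        obtain ⟨c, rfl, hc⟩ := (sameCycle_map_iff hn₁).1 had
        exact ⟨c, (hBJ c).1 hd, had, eq_of_sameCycle htail hc⟩
      obtain ⟨c, hcB, hac, htc⟩ := key a hab
      obtain ⟨c', hcB', hac', htc'⟩ := key a' (hnext.symm.trans hab)
      have hcc : c = c' := by
        rw [htc, htc'] at hc
        rcases hcB with rfl | rfl <;> rcases hcB' with rfl | rfl
        · rfl
        · exact absurd (hS.symm.trans (hc.trans hT)) hp
        · exact absurd (hS.symm.trans (hc.symm.trans hT)) hp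
        · rfl
      rw [← hcc] at hac'
      exact hac.trans hac'.symm
  sum_inner a haS haT := by
    have hface : ∀ a, (g * R.face) (J₁ a) = J₁ ((n₁ * rev E₁) a) := fun a => by
      have := hn₁ (rev E₁ a)
      rw [← h.rev_J₁] at this
      exact this
    -- A face of the part that avoids `S` and `T` avoids `B`. Hence it is also a face of `R`, and an
    -- inner one, because `B` contains `R.outS`.
    have hav : ∀ b ∈ B, ¬ (g * R.face).SameCycle (J₁ a) b := by
      intro b hb hab
      obtain ⟨c, rfl, hc⟩ := (sameCycle_map_iff hface).1 hab
      rcases (hBJ c).1 hb with rfl | rfl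
      · exact haS hc.symm
      · exact haT hc.symm
    have hg' : ∀ d ∉ B, g⁻¹ d = d := fun d hd => by
      rw [Perm.inv_eq_iff_eq, hg d hd]
    have hfac : R.face = g⁻¹ * (g * R.face) := by simp
    have h1 := cycleSum_mul_of_avoid hg' hav fun x => R.eRot x + R.vRot x
    rw [← hfac] at h1
    rw [R.cycleSum_inner, cycleSum_map h.J₁_inj hface] at h1
    · rw [h1]
      refine cycleSum_congr_fun fun x hx => ?_
      have hxA : x ∉ A := fun hxA => by
        rcases hA hxA with rfl | rfl
        · exact haS hx.symm
        · exact haT hx.symm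
      simp only [fillRot, if_neg hxA]
    · intro hout
      have h2 := sameCycle_mul_of_avoid hg' hav R.outS
      rw [← hfac] at h2
      exact hav _ houtS (h2.1 hout.symm)
  edge_rot a := by rw [← h.rev_J₁, R.edge_rot]
  sum_vertex u := by
    rcases hAsh u with ⟨a, ha, rfl⟩ | hu
    · refine sum_tail_fill (v := fun a => R.vRot (J₁ a)) (fun b hb hba => ?_) (by rw [fillRot, if_pos ha])
      rw [fillRot, if_neg]
      intro hbA
      rcases hA ha with rfl | rfl <;> rcases hA hbA with rfl | rfl
      · exact hba rfl
      · exact hp (hS.symm.trans (hb.symm.trans hT))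
      · exact hp (hS.symm.trans (hb.trans hT))
      · exact hba rfl
    · rw [← h.degree_unshared hu, ← R.sum_vertex, h.sum_tail_unshared _ hu]
      refine Finset.sum_congr rfl fun a ha => ?_
      rw [fillRot]
      -- At a vertex that is not shared the rotations already have the right sum, so that filling in
      -- changes nothing.
      split_ifs with haA
      · have h1 := h.sum_tail_unshared R.vRot hu
        rw [R.sum_vertex, h.degree_unshared hu] at h1
        simp only [Finset.mem_filter, Finset.mem_univ, true_and] at ha
        rw [fillVal, ha, ← h1]
        ring
      · rfl
  vRot_mem a := by
    rw [fillRot]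
    split_ifs with haA
    · exact ⟨neg_two_le_fillVal (fun d => (R.vRot_mem _).2) a, hAle a haA⟩
    · exact R.vRot_mem _

end Gluing

end BendCost

/-! ### Combining representations of two glued parts -/

namespace BendCost

open Equiv

theorem Arc.four_cycle {D : Type} {p : Perm D} {e v : D → ℤ} {B : Set D} {a b c d : D}
    {r₁ r₂ r₃ r₄ : ℤ} (h₁ : Arc p e v B a b r₁) (h₂ : Arc p e v B b c r₂)
    (h₃ : Arc p e v B c d r₃) (h₄ : Arc p e v B d a r₄) (hab : b ≠ a) (hbc : b ≠ c) (hca : c ≠ a)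
    (hda : d ≠ a) : Arc p e v {c} a c (r₁ + v b + r₂) ∧
      Arc p e v {a} a a (r₁ + v b + r₂ + v c + (r₃ + v d + r₄)) := by
  have ha := h₄.mem
  have hc := h₂.mem
  have h12 := h₁.trans (B' := {a, c}) (by rintro x (rfl | rfl) <;> assumption)
    (by rintro (h | h); exacts [hab h, hbc h])
    (h₂.anti (by rintro x (rfl | rfl) <;> assumption) (by simp))
  refine ⟨h12.anti (by simp) (by simp), ?_⟩
  refine h12.trans (by simp) (by simpa using hca) ?_
  exact h₃.trans (by simpa using ha) (by simpa using hda) (h₄.anti (by simpa using ha) (by simp))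

theorem exists_crossing {D : Type} [Finite D] {p : Perm D} {P : D → Prop} {x y : D}
    (h : p.SameCycle x y) (hx : P x) (hy : ¬ P y) :
    ∃ z, p.SameCycle x z ∧ P z ∧ ¬ P (p z) := by
  by_contra! hno
  obtain ⟨i, rfl⟩ := h.exists_nat_pow_eq
  have : ∀ i : ℕ, P ((p ^ i) x) := by
    intro i
    induction i with
    | zero => exact hx
    | succ i ih => 
      rw [pow_succ', Perm.mul_apply]
      exact hno _ ⟨i, by simp⟩ ih
  exact hy (this i)

theorem tail_swap {V E : Type} [DecidableEq (E × Bool)] {G : Multigraph V E} {x y : E × Bool} (hxy : G.tail x = G.tail y)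
    (d : E × Bool) : G.tail (swap x y d) = G.tail d := by
  rw [swap_apply_def]
  split_ifs with h1 h2
  · rw [h1, hxy]
  · rw [h2, hxy]
  · rfl

namespace Gluing

variable {V₁ E₁ V₂ E₂ V E : Type} {G₁ : PoleGraph V₁ E₁} {G₂ : PoleGraph V₂ E₂}
  {G : PoleGraph V E} {ι₁ : V₁ → V} {ι₂ : V₂ → V} {J₁ : E₁ × Bool → E × Bool}
  {J₂ : E₂ × Bool → E × Bool} [Fintype E₁] [Fintype E₂] [Fintype E]

/-- The combination of orthogonal representations of the two parts. The permutation `g`,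
supported on the set `B` of darts, glues the parts. -/
noncomputable def combine
    (h : Gluing G₁.toMultigraph G₂.toMultigraph G.toMultigraph ι₁ ι₂ J₁ J₂) (R₁ : OrthRep G₁)
    (R₂ : OrthRep G₂) {g n : Perm (E × Bool)} {B : Set (E × Bool)} {e v : E × Bool → ℤ}
    (S T : E × Bool)
    (hg : ∀ d ∉ B, g d = d) (hgB : ∀ d ∈ B, g d ∈ B)
    (hB₁ : ∀ a, J₁ a ∈ B ↔ a ∈ ({R₁.outS, R₁.outT} : Set _))
    (hB₂ : ∀ b, J₂ b ∈ B ↔ b ∈ ({R₂.outS, R₂.outT} : Set _))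
    (hn₁ : ∀ a, n (J₁ a) = J₁ (R₁.next a)) (hn₂ : ∀ b, n (J₂ b) = J₂ (R₂.next b))
    (he₁ : ∀ a, e (J₁ a) = R₁.eRot a) (he₂ : ∀ b, e (J₂ b) = R₂.eRot b)
    (hv₁ : ∀ a ∉ ({R₁.outS, R₁.outT} : Set _), v (J₁ a) = R₁.vRot a)
    (hv₂ : ∀ b ∉ ({R₂.outS, R₂.outT} : Set _), v (J₂ b) = R₂.vRot b)
    (hu₁ : ∀ a, (∀ w, ι₁ (G₁.tail a) ≠ ι₂ w) → v (J₁ a) = R₁.vRot a)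
    (hu₂ : ∀ b, (∀ u, ι₂ (G₂.tail b) ≠ ι₁ u) → v (J₂ b) = R₂.vRot b)
    (hsh : ∀ u w, ι₁ u = ι₂ w → ∃ a b, G₁.tail a = u ∧ G₂.tail b = w ∧
      (∀ a', G₁.tail a' = G₁.tail a → a' ≠ a → v (J₁ a') = R₁.vRot a') ∧
      (∀ b', G₂.tail b' = G₂.tail b → b' ≠ b → v (J₂ b') = R₂.vRot b') ∧
      v (J₁ a) + v (J₂ b) = R₁.vRot a + R₂.vRot b + 4)
    (hmem : ∀ d, v d ∈ Set.Icc (-2) 1)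
    (hnext : ∀ d d', (g * n).SameCycle d d' ↔ G.tail d = G.tail d')
    (hS : G.tail S = G.s) (hT : G.tail T = G.t)
    (hsum : ∀ b ∈ B, ¬ (g * n * rev E).SameCycle S b → ¬ (g * n * rev E).SameCycle T b →
      cycleSum (g * n * rev E) (fun x => e x + v x) b = 4) : PreRep G where
  next := g * n
  eRot := e
  vRot := v
  outS := S
  outT := T
  sameCycle_next := hnext
  tail_outS := hS
  tail_outT := hT
  edge_rot d := by
    rcases h.J_cases d with ⟨a, rfl⟩ | ⟨b, rfl⟩
    · rw [h.rev_J₁, he₁, he₁, R₁.edge_rot]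
    · rw [h.rev_J₂, he₂, he₂, R₂.edge_rot]
  vRot_mem := hmem
  sum_inner d hdS hdT := by
    have hf₁ : ∀ a, (n * rev E) (J₁ a) = J₁ (R₁.face a) := fun a => by
      rw [Perm.mul_apply, h.rev_J₁, hn₁]; rfl
    have hf₂ : ∀ a, (n * rev E) (J₂ a) = J₂ (R₂.face a) := fun a => by
      rw [Perm.mul_apply, h.rev_J₂, hn₂]; rfl
    -- A face that avoids `B` lies in one part, where it is an inner face, and is untouched by `g`.
    -- Any other face meets `B` after the gluing as well and is covered by `hsum`.
    by_cases hav : ∀ b ∈ B, ¬ (n * rev E).SameCycle d b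
    · rw [mul_assoc, cycleSum_mul_of_avoid hg hav]
      rcases h.J_cases d with ⟨a, rfl⟩ | ⟨b, rfl⟩
      · have hav' : ∀ x, R₁.face.SameCycle a x → x ∉ ({R₁.outS, R₁.outT} : Set _) := fun x hx hx' =>
          hav (J₁ x) ((hB₁ x).2 hx') ((sameCycle_map h.J₁_inj hf₁).2 hx)
        rw [cycleSum_map h.J₁_inj hf₁, ← R₁.cycleSum_inner (d := a)
          fun h' => hav' _ h'.symm (by simp)]
        exact cycleSum_congr_fun fun x hx => by rw [he₁, hv₁ x (hav' x hx)]
      · have hav' : ∀ x, R₂.face.SameCycle b x → x ∉ ({R₂.outS, R₂.outT} : Set _) := fun x hx hx' =>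
          hav (J₂ x) ((hB₂ x).2 hx') ((sameCycle_map h.J₂_inj hf₂).2 hx)
        rw [cycleSum_map h.J₂_inj hf₂, ← R₂.cycleSum_inner (d := b)
          fun h' => hav' _ h'.symm (by simp)]
        exact cycleSum_congr_fun fun x hx => by rw [he₂, hv₂ x (hav' x hx)]
    · push Not at hav
      obtain ⟨b, hb, hdb⟩ := hav
      obtain ⟨c, hc, hdc⟩ := exists_sameCycle_mul hg hgB hb hdb
      rw [← mul_assoc] at hdc
      rw [cycleSum_congr hdc]
      exact hsum c hc (fun h' => hdS (h'.trans hdc.symm)) fun h' => hdT (h'.trans hdc.symm)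
  sum_vertex q := by
    rcases h.ι_cases q with ⟨u, rfl⟩ | ⟨w, rfl⟩
    · by_cases hu : ∀ w, ι₁ u ≠ ι₂ w
      · rw [h.sum_tail_unshared _ hu, h.degree_unshared hu, ← R₁.sum_vertex u]
        refine Finset.sum_congr rfl fun a ha => hu₁ a ?_
        simp only [Finset.mem_filter, Finset.mem_univ, true_and] at ha
        rwa [ha]
      · push Not at hu
        obtain ⟨w, hw⟩ := hu
        obtain ⟨a, b, rfl, rfl, ha, hb, hab⟩ := hsh u w hw
        -- The surplus `4` of the glued angles compensates for subtracting `4` twice in the two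
        -- vertex sums of the parts.
        rw [h.sum_tail_shared _ hw, h.degree_shared hw,
          sum_tail_congr_off (f := fun a => v (J₁ a)) ha,
          sum_tail_congr_off (f := fun a => v (J₂ a)) hb, R₁.sum_vertex, R₂.sum_vertex]
        push_cast
        linarith
    · by_cases hu : ∀ u, ι₂ w ≠ ι₁ u
      · rw [h.symm.sum_tail_unshared _ hu, h.symm.degree_unshared hu, ← R₂.sum_vertex w]
        refine Finset.sum_congr rfl fun a ha => hu₂ a ?_
        simp only [Finset.mem_filter, Finset.mem_univ, true_and] at ha
        rwa [ha]
      · push Not at hu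
        obtain ⟨u, hw⟩ := hu
        obtain ⟨a, b, rfl, rfl, ha, hb, hab⟩ := hsh u w hw.symm
        rw [h.symm.sum_tail_shared _ hw, h.symm.degree_shared hw,
          sum_tail_congr_off (f := fun a => v (J₁ a)) ha,
          sum_tail_congr_off (f := fun a => v (J₂ a)) hb, R₁.sum_vertex, R₂.sum_vertex]
        push_cast
        linarith

end Gluing

/-! ### Series composition of orthogonal representations -/

/-- The gluing of a series composition. -/
structure SeriesGluing {V₁ E₁ V₂ E₂ V E : Type} (G₁ : PoleGraph V₁ E₁) (G₂ : PoleGraph V₂ E₂)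
    (G : PoleGraph V E) (ι₁ : V₁ → V) (ι₂ : V₂ → V) (J₁ : E₁ × Bool → E × Bool)
    (J₂ : E₂ × Bool → E × Bool) : Prop
    extends Gluing G₁.toMultigraph G₂.toMultigraph G.toMultigraph ι₁ ι₂ J₁ J₂ where
  share : ∀ u w, ι₁ u = ι₂ w ↔ u = G₁.t ∧ w = G₂.s
  s_eq : G.s = ι₁ G₁.s
  t_eq : G.t = ι₂ G₂.t

/-- The orthogonal representation `R` of a series composition consists of `R₁` and `R₂`. -/
structure SeriesLink {V₁ E₁ V₂ E₂ V E : Type} [Fintype E₁] [Fintype E₂] [Fintype E]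
    {G₁ : PoleGraph V₁ E₁} {G₂ : PoleGraph V₂ E₂} {G : PoleGraph V E}
    (J₁ : E₁ × Bool → E × Bool) (J₂ : E₂ × Bool → E × Bool) (R : OrthRep G) (R₁ : OrthRep G₁)
    (R₂ : OrthRep G₂) : Prop where
  eRot₁ : ∀ a, R.eRot (J₁ a) = R₁.eRot a
  eRot₂ : ∀ b, R.eRot (J₂ b) = R₂.eRot b
  vRot₁ : ∀ a ≠ R₁.outT, R.vRot (J₁ a) = R₁.vRot a
  vRot₂ : ∀ b ≠ R₂.outS, R.vRot (J₂ b) = R₂.vRot b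
  outS : R.outS = J₁ R₁.outS
  outT : R.outT = J₂ R₂.outT
  glue : R.vRot (J₁ R₁.outT) + R.vRot (J₂ R₂.outS) = R₁.vRot R₁.outT + R₂.vRot R₂.outS + 4
  rot : R.rotPath R.outS R.outT = R₁.rotPath R₁.outS R₁.outT + R.vRot (J₂ R₂.outS) +
    R₂.rotPath R₂.outS R₂.outT

section FourPoints

variable {D D₁ D₂ : Type} {J₁ : D₁ → D} {J₂ : D₂ → D} {S₁ T₁ : D₁} {S₂ T₂ : D₂}

theorem mem_fourPoints₁ (hJ : Function.Injective J₁) (hd : ∀ a b, J₁ a ≠ J₂ b) (a : D₁) :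
    J₁ a ∈ ({J₁ S₁, J₁ T₁, J₂ S₂, J₂ T₂} : Set D) ↔ a ∈ ({S₁, T₁} : Set D₁) := by
  simp [hJ.eq_iff, hd]

theorem mem_fourPoints₂ (hJ : Function.Injective J₂) (hd : ∀ a b, J₁ a ≠ J₂ b) (b : D₂) :
    J₂ b ∈ ({J₁ S₁, J₁ T₁, J₂ S₂, J₂ T₂} : Set D) ↔ b ∈ ({S₂, T₂} : Set D₂) := by
  simp [hJ.eq_iff, (hd _ _).symm]

theorem swap_fix_of_mem [DecidableEq D] {B : Set D} {x y : D} (hx : x ∈ B) (hy : y ∈ B) :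
    ∀ d ∉ B, swap x y d = d := fun _ hd =>
  swap_apply_of_ne_of_ne (fun h => hd (h ▸ hx)) fun h => hd (h ▸ hy)

theorem swap_maps_of_mem [DecidableEq D] {B : Set D} {x y : D} (hx : x ∈ B) (hy : y ∈ B) :
    ∀ d ∈ B, swap x y d ∈ B := fun d hd => by
  rw [swap_apply_def]
  split_ifs <;> assumption

end FourPoints

/-- The four first return paths along the outer face of a series composition. -/
theorem series_arcs {D D₁ D₂ : Type} [DecidableEq D] {J₁ : D₁ → D} {J₂ : D₂ → D} (hJ₁ : Function.Injective J₁)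
    (hJ₂ : Function.Injective J₂) (hd : ∀ a b, J₁ a ≠ J₂ b) {p : Perm D} {p₁ : Perm D₁}
    {p₂ : Perm D₂} (hp₁ : ∀ a, p (J₁ a) = J₁ (p₁ a)) (hp₂ : ∀ b, p (J₂ b) = J₂ (p₂ b))
    {e v : D → ℤ} {e₁ v₁ : D₁ → ℤ} {e₂ v₂ : D₂ → ℤ} (he₁ : ∀ a, e (J₁ a) = e₁ a)
    (he₂ : ∀ b, e (J₂ b) = e₂ b) {S₁ T₁ : D₁} {S₂ T₂ : D₂} (h₁ : S₁ ≠ T₁) (h₂ : S₂ ≠ T₂)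
    (hv₁ : ∀ a ∉ ({S₁, T₁} : Set _), v (J₁ a) = v₁ a)
    (hv₂ : ∀ b ∉ ({S₂, T₂} : Set _), v (J₂ b) = v₂ b) {r₁ q₁ r₂ q₂ : ℤ}
    (hr₁ : Arc p₁ e₁ v₁ {S₁, T₁} S₁ T₁ r₁) (hq₁ : Arc p₁ e₁ v₁ {S₁, T₁} T₁ S₁ q₁)
    (hr₂ : Arc p₂ e₂ v₂ {S₂, T₂} S₂ T₂ r₂) (hq₂ : Arc p₂ e₂ v₂ {S₂, T₂} T₂ S₂ q₂) :
    (∀ x ∈ ({J₁ S₁, J₁ T₁, J₂ S₂, J₂ T₂} : Set D),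
      (swap (J₁ T₁) (J₂ S₂) * p).SameCycle (J₁ S₁) x) ∧
    Arc (swap (J₁ T₁) (J₂ S₂) * p) e v {J₂ T₂} (J₁ S₁) (J₂ T₂) (r₁ + v (J₂ S₂) + r₂) ∧
    Arc (swap (J₁ T₁) (J₂ S₂) * p) e v {J₁ S₁} (J₁ S₁) (J₁ S₁)
      (r₁ + v (J₂ S₂) + r₂ + v (J₂ T₂) + (q₂ + v (J₁ T₁) + q₁)) := by
  set B : Set D := {J₁ S₁, J₁ T₁, J₂ S₂, J₂ T₂} with hB
  have hg := swap_fix_of_mem (B := B) (x := J₁ T₁) (y := J₂ S₂) (by simp [hB]) (by simp [hB])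
  have hgB := swap_maps_of_mem (B := B) (x := J₁ T₁) (y := J₂ S₂) (by simp [hB]) (by simp [hB])
  have hB₁ := mem_fourPoints₁ (S₁ := S₁) (T₁ := T₁) (S₂ := S₂) (T₂ := T₂) hJ₁ hd
  have hB₂ := mem_fourPoints₂ (S₁ := S₁) (T₁ := T₁) (S₂ := S₂) (T₂ := T₂) hJ₂ hd
  have a₁ := hr₁.glue hp₁ he₁ hB₁ hv₁ hg hgB
  have a₂ := hr₂.glue hp₂ he₂ hB₂ hv₂ hg hgB
  have a₃ := hq₂.glue hp₂ he₂ hB₂ hv₂ hg hgB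
  have a₄ := hq₁.glue hp₁ he₁ hB₁ hv₁ hg hgB
  rw [swap_apply_left] at a₁
  rw [swap_apply_of_ne_of_ne (hd _ _).symm (hJ₂.ne h₂.symm)] at a₂
  rw [swap_apply_right] at a₃
  rw [swap_apply_of_ne_of_ne (hJ₁.ne h₁) (hd _ _)] at a₄
  refine ⟨?_, a₁.four_cycle a₂ a₃ a₄ (hd _ _).symm (hJ₂.ne h₂) (hd _ _).symm (hJ₁.ne h₁.symm)⟩
  rintro x (rfl | rfl | rfl | rfl)
  · exact Perm.SameCycle.refl _ _
  · exact a₄.sameCycle.symm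
  · exact a₁.sameCycle
  · exact a₁.sameCycle.trans a₂.sameCycle

end BendCost

namespace BendCost

open Equiv

namespace SeriesGluing

variable {V₁ E₁ V₂ E₂ V E : Type} {G₁ : PoleGraph V₁ E₁} {G₂ : PoleGraph V₂ E₂}
  {G : PoleGraph V E} {ι₁ : V₁ → V} {ι₂ : V₂ → V} {J₁ : E₁ × Bool → E × Bool}
  {J₂ : E₂ × Bool → E × Bool}

theorem poles_ne (h : SeriesGluing G₁ G₂ G ι₁ ι₂ J₁ J₂) (hp₁ : G₁.s ≠ G₁.t) : G.s ≠ G.t := by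
  rw [h.s_eq, h.t_eq]
  exact fun h' => hp₁ ((h.share _ _).1 h').1

variable [Fintype E₁] [Fintype E₂] [Fintype E]

/-- The swap at the identified vertex merges the two vertex cycles and also the two outer faces. The
merged face is a cycle of four arcs with sum `-4 - 4 + 4 = -4`, the last summand being the surplus
in `hxy`. -/
theorem exists_link [Fintype V] (h : SeriesGluing G₁ G₂ G ι₁ ι₂ J₁ J₂) (hp₁ : G₁.s ≠ G₁.t)
    (hp₂ : G₂.s ≠ G₂.t) (R₁ : OrthRep G₁) (R₂ : OrthRep G₂) {x y : ℤ} (hx : x ∈ Set.Icc (-2) 1)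
    (hy : y ∈ Set.Icc (-2) 1) (hxy : y + x = R₁.vRot R₁.outT + R₂.vRot R₂.outS + 4) :
    ∃ R : OrthRep G, SeriesLink J₁ J₂ R R₁ R₂ ∧ R.vRot (J₂ R₂.outS) = x ∧
      R.vRot (J₁ R₁.outT) = y := by
  classical
  obtain ⟨n, hn₁, hn₂⟩ := h.exists_perm R₁.next R₂.next
  obtain ⟨e, he₁, he₂⟩ := h.exists_fun R₁.eRot R₂.eRot
  obtain ⟨v', hv'₁, hv'₂⟩ := h.exists_fun R₁.vRot R₂.vRot
  set v : E × Bool → ℤ := Function.update (Function.update v' (J₁ R₁.outT) y) (J₂ R₂.outS) x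
    with hv
  have hvx : v (J₂ R₂.outS) = x := by simp [hv]
  have hvy : v (J₁ R₁.outT) = y := by
    rw [hv, Function.update_of_ne (h.J_disj _ _), Function.update_self]
  have hv₁ : ∀ a ≠ R₁.outT, v (J₁ a) = R₁.vRot a := fun a ha => by
    rw [hv, Function.update_of_ne (h.J_disj _ _), Function.update_of_ne (h.J₁_inj.ne ha), hv'₁]
  have hv₂ : ∀ b ≠ R₂.outS, v (J₂ b) = R₂.vRot b := fun b hb => by
    rw [hv, Function.update_of_ne (h.J₂_inj.ne hb), Function.update_of_ne (h.J_disj _ _).symm, hv'₂]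
  have htail : G.tail (J₁ R₁.outT) = G.tail (J₂ R₂.outS) := by
    rw [h.tail_J₁, h.tail_J₂, R₁.tail_outT, R₂.tail_outS, h.share]
    exact ⟨rfl, rfl⟩
  have hnt := h.tail_perm hn₁ hn₂ R₁.tail_next R₂.tail_next
  have hns : ∀ a b, ¬ n.SameCycle (J₁ a) (J₂ b) := fun a b hab => by
    obtain ⟨c, hc, -⟩ := (sameCycle_map_iff hn₁).1 hab
    exact h.J_disj _ _ hc
  have hnext : ∀ d d', (swap (J₁ R₁.outT) (J₂ R₂.outS) * n).SameCycle d d' ↔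
      G.tail d = G.tail d' := by
    intro d d'
    constructor
    · exact fun hc => eq_of_sameCycle (f := G.tail) (fun d => by
        rw [Perm.mul_apply, tail_swap htail, hnt]) hc
    · have h11 : ∀ a a', G.tail (J₁ a) = G.tail (J₁ a') →
          (swap (J₁ R₁.outT) (J₂ R₂.outS) * n).SameCycle (J₁ a) (J₁ a') := by
        intro a a' haa
        rw [h.tail_J₁, h.tail_J₁, h.ι₁_inj.eq_iff, ← R₁.sameCycle_next,
          ← sameCycle_map h.J₁_inj hn₁] at haa
        exact SameCycle.swap_mul (hns _ _) haa
      have h22 : ∀ a a', G.tail (J₂ a) = G.tail (J₂ a') →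
          (swap (J₁ R₁.outT) (J₂ R₂.outS) * n).SameCycle (J₂ a) (J₂ a') := by
        intro a a' haa
        rw [h.tail_J₂, h.tail_J₂, h.ι₂_inj.eq_iff, ← R₂.sameCycle_next,
          ← sameCycle_map h.J₂_inj hn₂] at haa
        exact SameCycle.swap_mul (hns _ _) haa
      have h12 : ∀ a b, G.tail (J₁ a) = G.tail (J₂ b) →
          (swap (J₁ R₁.outT) (J₂ R₂.outS) * n).SameCycle (J₁ a) (J₂ b) := by
        intro a b hab
        have hab' := hab
        rw [h.tail_J₁, h.tail_J₂, h.share] at hab'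
        have ha : G.tail (J₁ a) = G.tail (J₁ R₁.outT) := by
          rw [h.tail_J₁, h.tail_J₁, hab'.1, R₁.tail_outT]
        exact (h11 _ _ ha).trans ((sameCycle_swap_mul (hns _ _)).trans
          (h22 _ _ (htail.symm.trans (ha.symm.trans hab))))
      intro hdd
      rcases h.J_cases d with ⟨a, rfl⟩ | ⟨b, rfl⟩ <;> rcases h.J_cases d' with ⟨a', rfl⟩ | ⟨b', rfl⟩
      · exact h11 _ _ hdd
      · exact h12 _ _ hdd
      · exact (h12 _ _ hdd.symm).symm
      · exact h22 _ _ hdd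
  have hf₁ : ∀ a, (n * rev E) (J₁ a) = J₁ (R₁.face a) := fun a => by
    rw [Perm.mul_apply, h.rev_J₁, hn₁]; rfl
  have hf₂ : ∀ a, (n * rev E) (J₂ a) = J₂ (R₂.face a) := fun a => by
    rw [Perm.mul_apply, h.rev_J₂, hn₂]; rfl
  have hne₁ : R₁.outS ≠ R₁.outT := OrthRep.outS_ne_outT hp₁
  have hne₂ : R₂.outS ≠ R₂.outT := OrthRep.outS_ne_outT hp₂
  obtain ⟨hall, hST, hSS⟩ := series_arcs h.J₁_inj h.J₂_inj h.J_disj hf₁ hf₂ he₁ he₂ hne₁ hne₂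
    (fun a ha => hv₁ a fun h' => ha (by simp [h'])) (fun b hb => hv₂ b fun h' => hb (by simp [h']))
    (OrthRep.arc_outS hp₁) (OrthRep.arc_outT hp₁) (OrthRep.arc_outS hp₂) (OrthRep.arc_outT hp₂)
  rw [← mul_assoc] at hall hST hSS
  let P : PreRep G := h.combine R₁ R₂ (e := e) (v := v) (J₁ R₁.outS) (J₂ R₂.outT)
    (swap_fix_of_mem (by simp) (by simp)) (swap_maps_of_mem (by simp) (by simp))
    (mem_fourPoints₁ h.J₁_inj h.J_disj) (mem_fourPoints₂ h.J₂_inj h.J_disj) hn₁ hn₂ he₁ he₂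
    (fun a ha => hv₁ a fun h' => ha (by simp [h'])) (fun b hb => hv₂ b fun h' => hb (by simp [h']))
    (fun a ha => hv₁ a fun h' => by
      rw [h', R₁.tail_outT] at ha
      exact ha _ ((h.share _ _).2 ⟨rfl, rfl⟩))
    (fun b hb => hv₂ b fun h' => by
      rw [h', R₂.tail_outS] at hb
      exact hb _ ((h.share _ _).2 ⟨rfl, rfl⟩).symm)
    (by
      intro u w huw
      obtain ⟨rfl, rfl⟩ := (h.share _ _).1 huw
      exact ⟨R₁.outT, R₂.outS, R₁.tail_outT, R₂.tail_outS, fun a _ ha => hv₁ a ha,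
        fun b _ hb => hv₂ b hb, by rw [hvx, hvy, hxy]⟩)
    (by
      intro d
      rcases h.J_cases d with ⟨a, rfl⟩ | ⟨b, rfl⟩
      · by_cases ha : a = R₁.outT
        · rw [ha, hvy]; exact hy
        · rw [hv₁ a ha]; exact R₁.vRot_mem a
      · by_cases hb : b = R₂.outS
        · rw [hb, hvx]; exact hx
        · rw [hv₂ b hb]; exact R₂.vRot_mem b)
    hnext (by rw [h.tail_J₁, R₁.tail_outS, h.s_eq]) (by rw [h.tail_J₂, R₂.tail_outT, h.t_eq])
    -- All four darts of `B` lie on the outer face, so no inner face meets `B`.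
    (fun b hb hb' _ => absurd (hall b hb) hb')
  have hsum : P.faceSum P.outS = -4 := by
    have h1 := OrthRep.rotPath_add (R := R₁) hp₁
    have h2 := OrthRep.rotPath_add (R := R₂) hp₂
    refine hSS.cycleSum_eq.trans ?_
    rw [hvx, hvy, hv₁ _ hne₁, hv₂ _ hne₂.symm]
    linarith
  refine ⟨P.toOrthRep (hall (J₂ R₂.outT) (by simp)) hsum, ⟨he₁, he₂, hv₁, hv₂, rfl, rfl, ?_, ?_⟩, hvx, hvy⟩
  · change v _ + v _ = _
    rw [hvx, hvy, hxy]
  · exact OrthRep.rotPath_eq _ (h.J_disj _ _) hST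

end SeriesGluing

end BendCost

/-! ### Decomposing a representation of a series composition -/

namespace BendCost

open Equiv

section Split

variable {V E : Type} [Fintype E] {G : PoleGraph V E}

/-- Splitting a vertex at two incidences to the outer face disconnects the graph. -/
theorem OrthRep.not_transitive_of_split [Fintype V] [DecidableEq (E × Bool)] (R : OrthRep G)
    (hsurj : ∀ v, ∃ d, G.tail d = v) {x y : E × Bool} (hxy : x ≠ y) (htail : G.tail x = G.tail y)
    (hx : R.face.SameCycle R.outS x) (hy : R.face.SameCycle R.outS y) :
    ¬ Transitive (swap x y * R.next) := by
  classical
  intro htr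
  have hfxy := hx.symm.trans hy
  have hnot := not_sameCycle_swap_mul hxy hfxy
  have hnotn := not_sameCycle_swap_mul hxy ((R.sameCycle_next _ _).2 htail)
  have h1 := euler_inequality htr
  -- The split vertex counts twice; the new cycle through `y` receives the label `none`.
  have h2 : Nat.card (Option V) ≤ cycleCount (swap x y * R.next) := by
    refine card_le_cycleCount (f := fun d =>
      if (swap x y * R.next).SameCycle y d then none else some (G.tail d)) (fun d => ?_) ?_
    · have h3 : G.tail ((swap x y * R.next) d) = G.tail d := by
        rw [Perm.mul_apply, tail_swap htail, R.tail_next]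
      simp only [Perm.sameCycle_apply_right, h3]
    · have h3 : ∀ d, (swap x y * R.next).SameCycle y d → G.tail d = G.tail y := fun d hd =>
        (eq_of_sameCycle (f := G.tail) (fun d => by
          rw [Perm.mul_apply, tail_swap htail, R.tail_next]) hd).symm
      intro v
      cases v with
      | none => exact ⟨y, if_pos (Perm.SameCycle.refl _ _)⟩
      | some v =>
        by_cases hv : v = G.tail y
        · refine ⟨x, (if_neg fun h' => hnotn (Perm.SameCycle.symm h')).trans ?_⟩
          rw [htail, hv]
        · obtain ⟨d, rfl⟩ := hsurj v
          exact ⟨d, if_neg fun h => hv (h3 d h)⟩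
  have h3 := cycleSum_swap_mul hxy hfxy R.eRot R.vRot
  -- The outer face is split as well, into two faces whose sums still add up to `-4`. So the number
  -- of faces is `|E| - |V| + 3`, which together with at least `|V| + 1` vertex cycles violates
  -- Euler's inequality.
  have h4 := four_mul_cycleCount_two (f := fun x => R.eRot x + R.vRot x) hnot (by
    intro d hdx hdy
    have hav : ∀ b ∈ ({x, y} : Set _), ¬ (swap x y * R.face).SameCycle d b := by
      rintro b (rfl | rfl) h
      · exact hdx h.symm
      · exact hdy h.symm
    have h5 := cycleSum_mul_of_avoid swap_fix hav fun x => R.eRot x + R.vRot x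
    have h6 := sameCycle_mul_of_avoid swap_fix hav x
    rw [← mul_assoc, swap_mul_self, one_mul] at h5 h6
    rw [← h5]
    refine R.cycleSum_inner fun hd => hav x (by simp) (h6.1 (hd.symm.trans hx)))
  rw [sum_rotations R.edge_rot R.sum_vertex] at h4
  rw [← cycleSum_congr hx, R.cycleSum_outS] at h3
  rw [mul_assoc] at h1
  change cycleCount _ + cycleCount (swap x y * R.face) ≤ _ at h1
  rw [Finite.card_option] at h2
  omega

end Split

namespace Gluing

variable {V₁ E₁ V₂ E₂ V E : Type} {G₁ : PoleGraph V₁ E₁} {G₂ : PoleGraph V₂ E₂}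
  {G : PoleGraph V E} {ι₁ : V₁ → V} {ι₂ : V₂ → V} {J₁ : E₁ × Bool → E × Bool}
  {J₂ : E₂ × Bool → E × Bool} [Fintype E]
  (h : Gluing G₁.toMultigraph G₂.toMultigraph G.toMultigraph ι₁ ι₂ J₁ J₂)

include h

omit [Fintype E] in
theorem exists_tail (h₁ : G₁.IsSTGraph) (h₂ : G₂.IsSTGraph) (v : V) : ∃ d, G.tail d = v := by
  rcases h.ι_cases v with ⟨u, rfl⟩ | ⟨w, rfl⟩
  · obtain ⟨a, rfl⟩ := h₁.exists_tail u
    exact ⟨J₁ a, h.tail_J₁ a⟩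
  · obtain ⟨a, rfl⟩ := h₂.exists_tail w
    exact ⟨J₂ a, h.tail_J₂ a⟩

/-- The swap changes the cyclic order only at the vertex `p`. Since `p` is not a cutvertex of the
part, the part stays connected without using that order. -/
theorem const_part [DecidableEq (E × Bool)] (hst : G₁.IsSTGraph) {p : V₁}
    (hp : p = G₁.s ∨ p = G₁.t) (R : OrthRep G)
    {x y : E × Bool} (hx : G.tail x = ι₁ p) (hy : G.tail y = ι₁ p) {α : Type*}
    {f : E × Bool → α} (hf : ∀ d, f ((swap x y * R.next) d) = f d)
    (hrev : ∀ d, f (rev E d) = f d) (a a' : E₁ × Bool) : f (J₁ a) = f (J₁ a') := by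
  refine hst.eq_of_invariant hp (f := fun a => f (J₁ a)) (fun a => ?_) (fun a a' haa ha => ?_) a a'
  · rw [← h.rev_J₁, hrev]
  · refine eq_of_sameCycle hf ((sameCycle_mul_of_avoid swap_fix ?_ _).2 ((R.sameCycle_next _ _).2 ?_))
    · rintro b hb hab
      rw [R.sameCycle_next, h.tail_J₁] at hab
      refine ha (h.ι₁_inj (hab.trans ?_))
      rcases hb with rfl | rfl <;> assumption
    · rw [h.tail_J₁, h.tail_J₁, haa]

end Gluing

namespace SeriesGluing

variable {V₁ E₁ V₂ E₂ V E : Type} {G₁ : PoleGraph V₁ E₁} {G₂ : PoleGraph V₂ E₂}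
  {G : PoleGraph V E} {ι₁ : V₁ → V} {ι₂ : V₂ → V} {J₁ : E₁ × Bool → E × Bool}
  {J₂ : E₂ × Bool → E × Bool} [Fintype E]

/-- The darts of the two parts do not interleave at the cutvertex. -/
theorem exists_switch [Fintype V] [DecidableEq (E × Bool)] (h : SeriesGluing G₁ G₂ G ι₁ ι₂ J₁ J₂)
    (h₁ : G₁.IsSTGraph) (h₂ : G₂.IsSTGraph) (R : OrthRep G) :
    ∃ S₁ T₁ S₂ T₂, R.outS = J₁ S₁ ∧ R.outT = J₂ T₂ ∧ G₁.tail T₁ = G₁.t ∧ G₂.tail S₂ = G₂.s ∧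
      R.face.SameCycle R.outS (J₁ T₁) ∧ R.face.SameCycle R.outS (J₂ S₂) ∧
      (∀ a, ∃ a', (swap (J₁ T₁) (J₂ S₂) * R.next) (J₁ a) = J₁ a') ∧
      ∀ b, ∃ b', (swap (J₁ T₁) (J₂ S₂) * R.next) (J₂ b) = J₂ b' := by
  obtain ⟨S₁, hS₁⟩ : ∃ S₁, J₁ S₁ = R.outS := by
    rcases h.J_cases R.outS with ha | ⟨b, hb⟩
    · exact ha
    · have := R.tail_outS
      rw [← hb, h.tail_J₂, h.s_eq] at this
      exact absurd ((h.share _ _).1 this.symm).1 h₁.poles_ne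
  obtain ⟨T₂, hT₂⟩ : ∃ T₂, J₂ T₂ = R.outT := by
    rcases h.J_cases R.outT with ⟨a, ha⟩ | hb
    · have := R.tail_outT
      rw [← ha, h.tail_J₁, h.t_eq] at this
      exact absurd ((h.share _ _).1 this).2 h₂.poles_ne.symm
    · exact hb
  -- The outer face contains `outS` in the first part and `outT` in the second, so it changes parts
  -- in both directions. A change of parts is possible only at the identified vertex and yields the
  -- darts to be swapped.
  obtain ⟨z, hz, ⟨a, rfl⟩, hz'⟩ := exists_crossing (P := fun x => ∃ a, J₁ a = x) R.same_outer
    ⟨S₁, hS₁⟩ (by rintro ⟨a, ha⟩; exact h.J_disj _ _ (ha.trans hT₂.symm))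
  obtain ⟨w, hw, ⟨b, rfl⟩, hw'⟩ := exists_crossing (P := fun x => ∃ b, J₂ b = x) R.same_outer.symm
    ⟨T₂, hT₂⟩ (by rintro ⟨b, hb⟩; exact h.J_disj _ _ (hS₁.trans hb.symm))
  obtain ⟨S₂, hS₂⟩ := (h.J_cases (R.face (J₁ a))).resolve_left hz'
  obtain ⟨T₁, hT₁⟩ := (h.J_cases (R.face (J₂ b))).resolve_right hw'
  have tS : G₂.tail S₂ = G₂.s := by
    have : G.tail (R.face (J₁ a)) = G.tail (rev E (J₁ a)) := R.tail_next _
    rw [← hS₂, h.rev_J₁, h.tail_J₁, h.tail_J₂] at this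
    exact ((h.share _ _).1 this.symm).2
  have tT : G₁.tail T₁ = G₁.t := by
    have : G.tail (R.face (J₂ b)) = G.tail (rev E (J₂ b)) := R.tail_next _
    rw [← hT₁, h.rev_J₂, h.tail_J₁, h.tail_J₂] at this
    exact ((h.share _ _).1 this).1
  have hoS : R.face.SameCycle R.outS (J₂ S₂) := by rwa [hS₂, Perm.sameCycle_apply_right]
  have hoT : R.face.SameCycle R.outS (J₁ T₁) := by
    rw [hT₁, Perm.sameCycle_apply_right]
    exact R.same_outer.trans hw
  have hshare : ι₁ G₁.t = ι₂ G₂.s := (h.share _ _).2 ⟨rfl, rfl⟩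
  have htail : G.tail (J₁ T₁) = G.tail (J₂ S₂) := by
    rw [h.tail_J₁, h.tail_J₂, tS, tT, hshare]
  have hntr := R.not_transitive_of_split (h.exists_tail h₁ h₂) (h.J_disj T₁ S₂) htail hoT hoS
  have htn : ∀ d, G.tail ((swap (J₁ T₁) (J₂ S₂) * R.next) d) = G.tail d := fun d => by
    rw [Perm.mul_apply, tail_swap htail, R.tail_next]
  -- A cycle containing darts of both parts would connect the parts, each of which is connected by
  -- `const_part`, although the split map is disconnected.
  have hmix : ∀ a b, ¬ (swap (J₁ T₁) (J₂ S₂) * R.next).SameCycle (J₁ a) (J₂ b) := by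
    intro a b hab
    refine hntr fun f hf hrev => ?_
    have c₁ := h.const_part h₁ (p := G₁.t) (Or.inr rfl) R (x := J₁ T₁) (y := J₂ S₂)
      (by rw [h.tail_J₁, tT]) (by rw [h.tail_J₂, tS, hshare]) hf hrev
    have c₂ := h.symm.const_part h₂ (p := G₂.s) (Or.inl rfl) R (x := J₁ T₁) (y := J₂ S₂)
      (by rw [h.tail_J₁, tT, hshare]) (by rw [h.tail_J₂, tS]) hf hrev
    have c₃ : ∀ d, f d = f (J₁ a) := by
      intro d
      rcases h.J_cases d with ⟨a', rfl⟩ | ⟨b', rfl⟩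
      · exact c₁ _ _
      · rw [c₂ b' b]
        exact (eq_of_sameCycle hf hab).symm
    exact fun d d' => by rw [c₃ d, c₃ d']
  refine ⟨S₁, T₁, S₂, T₂, hS₁.symm, hT₂.symm, tT, tS, hoT, hoS, fun a => ?_, fun b => ?_⟩
  · rcases h.J_cases ((swap (J₁ T₁) (J₂ S₂) * R.next) (J₁ a)) with ⟨a', ha'⟩ | ⟨b', hb'⟩
    · exact ⟨a', ha'.symm⟩
    · exact absurd (by rw [hb']; exact Perm.sameCycle_apply_right.2 (Perm.SameCycle.refl _ _))
        (hmix a b')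
  · rcases h.J_cases ((swap (J₁ T₁) (J₂ S₂) * R.next) (J₂ b)) with ⟨a', ha'⟩ | ⟨b', hb'⟩
    · exact absurd (by rw [ha']; exact Perm.sameCycle_apply_left.2 (Perm.SameCycle.refl _ _))
        (hmix a' b)
    · exact ⟨b', hb'.symm⟩

variable [Fintype E₁] [Fintype E₂]

/-- The swap at the cutvertex separates the parts, and the two angles there are filled in to give
correct vertex sums. That the new outer faces sum to `-4` is forced by the bound of
`PreRep.faceSum_ge` for both parts. -/
theorem exists_parts [Fintype V₁] [Fintype V₂] [Fintype V] (h : SeriesGluing G₁ G₂ G ι₁ ι₂ J₁ J₂)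
    (h₁ : G₁.IsSTGraph) (h₂ : G₂.IsSTGraph) (R : OrthRep G) :
    ∃ (R₁ : OrthRep G₁) (R₂ : OrthRep G₂), SeriesLink J₁ J₂ R R₁ R₂ := by
  classical
  obtain ⟨S₁, T₁, S₂, T₂, hS₁, hT₂, tT₁, tS₂, hoT, hoS, hm₁, hm₂⟩ := h.exists_switch h₁ h₂ R
  obtain ⟨n₁, hn₁⟩ := exists_perm_restrict h.J₁_inj hm₁
  obtain ⟨n₂, hn₂⟩ := exists_perm_restrict h.J₂_inj hm₂
  have tS₁ : G₁.tail S₁ = G₁.s := by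
    have := R.tail_outS
    rwa [hS₁, h.tail_J₁, h.s_eq, h.ι₁_inj.eq_iff] at this
  have tT₂ : G₂.tail T₂ = G₂.t := by
    have := R.tail_outT
    rwa [hT₂, h.tail_J₂, h.t_eq, h.ι₂_inj.eq_iff] at this
  have hshare : ι₁ G₁.t = ι₂ G₂.s := (h.share _ _).2 ⟨rfl, rfl⟩
  have htail : G.tail (J₁ T₁) = G.tail (J₂ S₂) := by
    rw [h.tail_J₁, h.tail_J₂, tS₂, tT₁, hshare]
  have hne₁ : S₁ ≠ T₁ := fun h' => h₁.poles_ne (by rw [← tS₁, h', tT₁])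
  have hne₂ : S₂ ≠ T₂ := fun h' => h₂.poles_ne (by rw [← tS₂, h', tT₂])
  have hfill := h.fillVal_add (v := R.vRot) htail (R.sum_vertex _)
  have hge₁ := neg_two_le_fillVal (G := G₁.toMultigraph) (v := fun a => R.vRot (J₁ a))
    (fun d => (R.vRot_mem _).2) T₁
  have hge₂ := neg_two_le_fillVal (G := G₂.toMultigraph) (v := fun b => R.vRot (J₂ b))
    (fun d => (R.vRot_mem _).2) S₂
  have hle₁ := (R.vRot_mem (J₁ T₁)).2
  have hle₂ := (R.vRot_mem (J₂ S₂)).2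
  set B : Set (E × Bool) := {J₁ S₁, J₁ T₁, J₂ S₂, J₂ T₂} with hB
  have hg := swap_fix_of_mem (B := B) (x := J₁ T₁) (y := J₂ S₂) (by simp [hB]) (by simp [hB])
  have hgB := swap_maps_of_mem (B := B) (x := J₁ T₁) (y := J₂ S₂) (by simp [hB]) (by simp [hB])
  have hB₁ := mem_fourPoints₁ (S₁ := S₁) (T₁ := T₁) (S₂ := S₂) (T₂ := T₂) h.J₁_inj h.J_disj
  have hB₂ := mem_fourPoints₂ (S₁ := S₁) (T₁ := T₁) (S₂ := S₂) (T₂ := T₂) h.J₂_inj h.J_disj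
  have hoB : R.outS ∈ B := by rw [hS₁]; simp [hB]
  let P₁ : PreRep G₁ := h.toGluing.restrict R (A := {T₁}) hg hgB hoB hB₁ (tail_swap htail) hn₁ tS₁ tT₁
    h₁.poles_ne (by simp) (by rintro _ rfl; omega) (fun u => by
      by_cases hu : u = G₁.t
      · exact Or.inl ⟨T₁, rfl, by rw [tT₁, hu]⟩
      · exact Or.inr fun w huw => hu ((h.share _ _).1 huw).1)
  let P₂ : PreRep G₂ := h.symm.restrict R (A := {S₂}) hg hgB hoB hB₂ (tail_swap htail) hn₂ tS₂ tT₂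
    h₂.poles_ne (by simp) (by rintro _ rfl; omega) (fun w => by
      by_cases hw : w = G₂.s
      · exact Or.inl ⟨S₂, rfl, by rw [tS₂, hw]⟩
      · exact Or.inr fun u huw => hw ((h.share _ _).1 huw.symm).2)
  have hvT₁ : P₁.vRot T₁ = fillVal G₁.toMultigraph (fun a => R.vRot (J₁ a)) T₁ := if_pos rfl
  have hvS₂ : P₂.vRot S₂ = fillVal G₂.toMultigraph (fun b => R.vRot (J₂ b)) S₂ := if_pos rfl
  have hv₁ : ∀ a ≠ T₁, R.vRot (J₁ a) = P₁.vRot a := fun a ha => (if_neg ha).symm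
  have hv₂ : ∀ b ≠ S₂, R.vRot (J₂ b) = P₂.vRot b := fun b hb => (if_neg hb).symm
  set p := swap (J₁ T₁) (J₂ S₂) * R.face with hp
  have hface : swap (J₁ T₁) (J₂ S₂) * p = R.face := by
    rw [hp, ← mul_assoc, swap_mul_self, one_mul]
  have hp₁ : ∀ a, p (J₁ a) = J₁ (P₁.face a) := fun a => by
    have := hn₁ (rev E₁ a)
    rw [← h.rev_J₁] at this
    exact this
  have hp₂ : ∀ a, p (J₂ a) = J₂ (P₂.face a) := fun a => by
    have := hn₂ (rev E₂ a)
    rw [← h.rev_J₂] at this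
    exact this
  -- Otherwise the face of `S₁` in the part returns to `S₁` without meeting `T₁`. The swap fixes `J₁
  -- S₁`, so this would be the only dart of `B` on the outer face of `R`, contrary to `hoS`.
  have hsame₁ : P₁.face.SameCycle S₁ T₁ := by
    by_contra hnot
    obtain ⟨r, hr⟩ := exists_arc_single P₁.eRot P₁.vRot hnot
    have h1 := hr.glue hp₁ (e := R.eRot) (v := R.vRot) (fun _ => rfl) hB₁
      (fun a ha => hv₁ a fun h' => ha (by simp [h'])) hg hgB
    rw [swap_apply_of_ne_of_ne (h.J₁_inj.ne hne₁) (h.J_disj _ _), hface] at h1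
    exact h.J_disj _ _ (h1.eq_of_self (b := J₂ S₂) (by simp) (hS₁ ▸ hoS)).symm
  have hsame₂ : P₂.face.SameCycle S₂ T₂ := by
    by_contra hnot
    obtain ⟨r, hr⟩ := exists_arc_single P₂.eRot P₂.vRot fun h' => hnot h'.symm
    rw [Set.pair_comm] at hr
    have h1 := hr.glue hp₂ (e := R.eRot) (v := R.vRot) (fun _ => rfl) hB₂
      (fun b hb => hv₂ b fun h' => hb (by simp [h'])) hg hgB
    rw [swap_apply_of_ne_of_ne (h.J_disj _ _).symm (h.J₂_inj.ne hne₂.symm), hface] at h1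
    refine h.J_disj _ _ (h1.eq_of_self (b := J₁ T₁) (by simp) ?_)
    rw [← hT₂]
    exact R.same_outer.symm.trans hoT
  have arcs : ∀ {r₁ q₁ r₂ q₂ : ℤ}, _ → _ → _ → _ → _ := fun {r₁ q₁ r₂ q₂} =>
    series_arcs h.J₁_inj h.J₂_inj h.J_disj hp₁ hp₂ (e := R.eRot) (v := R.vRot)
      (e₁ := P₁.eRot) (e₂ := P₂.eRot) (v₁ := P₁.vRot) (v₂ := P₂.vRot)
      (fun _ => rfl) (fun _ => rfl) hne₁ hne₂
      (fun a ha => hv₁ a fun h' => ha (by simp [h'])) (fun b hb => hv₂ b fun h' => hb (by simp [h']))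
      (r₁ := r₁) (q₁ := q₁) (r₂ := r₂) (q₂ := q₂)
  obtain ⟨r₁, hr₁⟩ := exists_arc_pair P₁.eRot P₁.vRot hne₁ hsame₁
  obtain ⟨q₁, hq₁⟩ := exists_arc_pair P₁.eRot P₁.vRot hne₁.symm hsame₁.symm
  obtain ⟨r₂, hr₂⟩ := exists_arc_pair P₂.eRot P₂.vRot hne₂ hsame₂
  obtain ⟨q₂, hq₂⟩ := exists_arc_pair P₂.eRot P₂.vRot hne₂.symm hsame₂.symm
  rw [Set.pair_comm] at hq₁ hq₂
  obtain ⟨-, -, hSS⟩ := arcs hr₁ hq₁ hr₂ hq₂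
  have hout := hSS.cycleSum_eq
  rw [hface, ← hS₁, R.cycleSum_outS, hS₁, hv₁ _ hne₁, hv₂ _ hne₂.symm] at hout
  have hs₁ : P₁.faceSum P₁.outS = _ := ((hr₁.trans (B' := {S₁}) (by simp) (by simpa using hne₁.symm)
    (hq₁.anti (by simp) (by simp)))).cycleSum_eq
  have hs₂ : P₂.faceSum P₂.outS = _ := ((hr₂.trans (B' := {S₂}) (by simp) (by simpa using hne₂.symm)
    (hq₂.anti (by simp) (by simp)))).cycleSum_eq
  have hge := P₁.faceSum_ge h₁ hsame₁
  have hge' := P₂.faceSum_ge h₂ hsame₂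
  -- The filling lowers the outer sum `-4` by `4`, so the sums of the parts add up to `-8`, and each
  -- is at least `-4`.
  have hsum₁ : P₁.faceSum P₁.outS = -4 := by omega
  have hsum₂ : P₂.faceSum P₂.outS = -4 := by omega
  let R₁ := P₁.toOrthRep hsame₁ hsum₁
  let R₂ := P₂.toOrthRep hsame₂ hsum₂
  obtain ⟨-, hST, -⟩ := arcs (OrthRep.arc_outS (R := R₁) h₁.poles_ne)
    (OrthRep.arc_outT (R := R₁) h₁.poles_ne) (OrthRep.arc_outS (R := R₂) h₂.poles_ne)
    (OrthRep.arc_outT (R := R₂) h₂.poles_ne)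
  rw [hface] at hST
  refine ⟨R₁, R₂, fun _ => rfl, fun _ => rfl, hv₁, hv₂, hS₁, hT₂, ?_, ?_⟩
  · change _ = P₁.vRot T₁ + P₂.vRot S₂ + 4
    change R.vRot (J₁ T₁) + R.vRot (J₂ S₂) = _
    omega
  · rw [hS₁, hT₂]
    exact R.rotPath_eq (h.J_disj _ _) hST

end SeriesGluing

end BendCost

namespace BendCost

open Equiv

/-! ### Parallel composition of orthogonal representations -/

/-- The gluing of a parallel composition. -/
structure ParallelGluing {V₁ E₁ V₂ E₂ V E : Type} (G₁ : PoleGraph V₁ E₁) (G₂ : PoleGraph V₂ E₂)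
    (G : PoleGraph V E) (ι₁ : V₁ → V) (ι₂ : V₂ → V) (J₁ : E₁ × Bool → E × Bool)
    (J₂ : E₂ × Bool → E × Bool) : Prop
    extends Gluing G₁.toMultigraph G₂.toMultigraph G.toMultigraph ι₁ ι₂ J₁ J₂ where
  share : ∀ u w, ι₁ u = ι₂ w ↔ (u = G₁.s ∧ w = G₂.s) ∨ (u = G₁.t ∧ w = G₂.t)
  s_eq : G.s = ι₁ G₁.s
  t_eq : G.t = ι₁ G₁.t

/-- The orthogonal representation `R` of a parallel composition consists of `R₁` and `R₂`,
with `R₁` first at `s`. -/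
structure ParallelLink {V₁ E₁ V₂ E₂ V E : Type} [Fintype E₁] [Fintype E₂] [Fintype E]
    {G₁ : PoleGraph V₁ E₁} {G₂ : PoleGraph V₂ E₂} {G : PoleGraph V E}
    (J₁ : E₁ × Bool → E × Bool) (J₂ : E₂ × Bool → E × Bool) (R : OrthRep G) (R₁ : OrthRep G₁)
    (R₂ : OrthRep G₂) : Prop where
  eRot₁ : ∀ a, R.eRot (J₁ a) = R₁.eRot a
  eRot₂ : ∀ b, R.eRot (J₂ b) = R₂.eRot b
  vRot₁ : ∀ a, a ≠ R₁.outS → a ≠ R₁.outT → R.vRot (J₁ a) = R₁.vRot a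
  vRot₂ : ∀ b, b ≠ R₂.outS → b ≠ R₂.outT → R.vRot (J₂ b) = R₂.vRot b
  outS : R.outS = J₁ R₁.outS
  outT : R.outT = J₂ R₂.outT
  glueS : R.vRot (J₁ R₁.outS) + R.vRot (J₂ R₂.outS) = R₁.vRot R₁.outS + R₂.vRot R₂.outS + 4
  glueT : R.vRot (J₁ R₁.outT) + R.vRot (J₂ R₂.outT) = R₁.vRot R₁.outT + R₂.vRot R₂.outT + 4
  rot : R.rotPath R.outS R.outT = R₁.rotPath R₁.outS R₁.outT
  mid : R₂.rotPath R₂.outS R₂.outT + R.vRot (J₁ R₁.outT) + R₁.rotPath R₁.outT R₁.outS +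
    R.vRot (J₂ R₂.outS) = 4

/-- The first part precedes the second one at `s`, and follows it at `t`. -/
def FirstPrecedes {V E D₁ D₂ : Type} [Fintype E] {G : PoleGraph V E} (J₁ : D₁ → E × Bool)
    (J₂ : D₂ → E × Bool) (R : OrthRep G) : Prop :=
  R.outS ∈ Set.range J₁ ∧ R.outT ∈ Set.range J₂ ∧
  (∀ d, G.tail d = G.s → R.next d ≠ R.outS → R.next d ∈ Set.range J₁ → d ∈ Set.range J₁) ∧
  (∀ d, G.tail d = G.t → R.next d ≠ R.outT → R.next d ∈ Set.range J₂ → d ∈ Set.range J₂)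

section DoubleSwap

variable {D : Type} [DecidableEq D] {x y z w : D}

theorem swap_mul_swap_apply (hxz : x ≠ z) (hxw : x ≠ w) (hyz : y ≠ z) (hyw : y ≠ w) :
    (swap x y * swap z w) x = y ∧ (swap x y * swap z w) y = x ∧
      (swap x y * swap z w) z = w ∧ (swap x y * swap z w) w = z := by
  simp only [Perm.mul_apply, swap_apply_left, swap_apply_right]
  refine ⟨?_, ?_, ?_, ?_⟩
  · rw [swap_apply_of_ne_of_ne hxz hxw, swap_apply_left]
  · rw [swap_apply_of_ne_of_ne hyz hyw, swap_apply_right]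
  · rw [swap_apply_of_ne_of_ne hxw.symm hyw.symm]
  · rw [swap_apply_of_ne_of_ne hxz.symm hyz.symm]

theorem swap_mul_swap_fix {B : Set D} (hx : x ∈ B) (hy : y ∈ B) (hz : z ∈ B) (hw : w ∈ B) :
    ∀ d ∉ B, (swap x y * swap z w) d = d := fun d hd => by
  rw [Perm.mul_apply, swap_fix_of_mem hz hw d hd, swap_fix_of_mem hx hy d hd]

theorem swap_mul_swap_maps {B : Set D} (hx : x ∈ B) (hy : y ∈ B) (hz : z ∈ B) (hw : w ∈ B) :
    ∀ d ∈ B, (swap x y * swap z w) d ∈ B := fun d hd =>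
  swap_maps_of_mem hx hy _ (swap_maps_of_mem hz hw d hd)

theorem swap_mul_swap_mul_self (hxz : x ≠ z) (hxw : x ≠ w) (hyz : y ≠ z) (hyw : y ≠ w) :
    (swap x y * swap z w) * (swap x y * swap z w) = 1 := by
  obtain ⟨hx, hy, hz, hw⟩ := swap_mul_swap_apply hxz hxw hyz hyw
  ext d
  rw [Perm.mul_apply, Perm.one_apply]
  by_cases h1 : d = x
  · rw [h1, hx, hy]
  by_cases h2 : d = y
  · rw [h2, hy, hx]
  by_cases h3 : d = z
  · rw [h3, hz, hw]
  by_cases h4 : d = w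
  · rw [h4, hw, hz]
  have : (swap x y * swap z w) d = d := by
    rw [Perm.mul_apply, swap_apply_of_ne_of_ne h3 h4, swap_apply_of_ne_of_ne h1 h2]
  rw [this, this]

end DoubleSwap

/-- The two pairs of first return paths along the outer face and the middle face of a parallel
composition. -/
theorem parallel_arcs {D : Type} [Finite D] {p : Perm D} {e v : D → ℤ} {S₁ T₁ S₂ T₂ : D}
    {r₁ q₁ r₂ q₂ : ℤ} (hr₁ : Arc p e v {S₁, T₁, S₂, T₂} S₁ T₂ r₁)
    (hq₂ : Arc p e v {S₁, T₁, S₂, T₂} T₂ S₁ q₂) (hr₂ : Arc p e v {S₁, T₁, S₂, T₂} S₂ T₁ r₂)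
    (hq₁ : Arc p e v {S₁, T₁, S₂, T₂} T₁ S₂ q₁) (hST₁ : S₁ ≠ T₂) (hST₂ : S₂ ≠ T₁) (hS : S₂ ≠ S₁)
    (hT : S₂ ≠ T₂) :
    Arc p e v {T₂} S₁ T₂ r₁ ∧ Arc p e v {S₁} S₁ S₁ (r₁ + v T₂ + q₂) ∧
      Arc p e v {S₂} S₂ S₂ (r₂ + v T₁ + q₁) ∧ ¬ p.SameCycle S₁ S₂ := by
  refine ⟨hr₁.anti (by simp) (by simp), hr₁.trans (by simp) (by simpa using hST₁.symm)
    (hq₂.anti (by simp) (by simp)), hr₂.trans (by simp) (by simpa using hST₂.symm)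
    (hq₁.anti (by simp) (by simp)), fun hc => ?_⟩
  have := Arc.mem_of_closed (e := e) (v := v) (C := {S₁, T₂}) (b := S₂) (fun c hc => by
    rcases hc with rfl | rfl
    · exact ⟨_, by simp, _, hr₁⟩
    · exact ⟨_, by simp, _, hq₂⟩) (by simp) (by simp) hc
  rcases this with h | h
  · exact hS h
  · exact hT h

namespace ParallelGluing

variable {V₁ E₁ V₂ E₂ V E : Type} {G₁ : PoleGraph V₁ E₁} {G₂ : PoleGraph V₂ E₂}
  {G : PoleGraph V E} {ι₁ : V₁ → V} {ι₂ : V₂ → V} {J₁ : E₁ × Bool → E × Bool}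
  {J₂ : E₂ × Bool → E × Bool}

theorem poles_ne (h : ParallelGluing G₁ G₂ G ι₁ ι₂ J₁ J₂) (hp₁ : G₁.s ≠ G₁.t) : G.s ≠ G.t := by
  rw [h.s_eq, h.t_eq]
  exact h.ι₁_inj.ne hp₁

theorem share_s (h : ParallelGluing G₁ G₂ G ι₁ ι₂ J₁ J₂) : ι₁ G₁.s = ι₂ G₂.s :=
  (h.share _ _).2 (Or.inl ⟨rfl, rfl⟩)

theorem share_t (h : ParallelGluing G₁ G₂ G ι₁ ι₂ J₁ J₂) : ι₁ G₁.t = ι₂ G₂.t :=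
  (h.share _ _).2 (Or.inr ⟨rfl, rfl⟩)

variable [Fintype E₁] [Fintype E₂] [Fintype E]

/-- The swaps at both poles regroup the four boundary arcs. The outer face consists of the path from
`s` to `t` of the first part and the path from `t` to `s` of the second; the remaining two paths
bound the face between the parts. The condition `hmid` makes the latter sum to `4`, whereupon the
outer face sums to `-4`. -/
theorem exists_link [Fintype V] (h : ParallelGluing G₁ G₂ G ι₁ ι₂ J₁ J₂) (hp₁ : G₁.s ≠ G₁.t)
    (hp₂ : G₂.s ≠ G₂.t) (R₁ : OrthRep G₁) (R₂ : OrthRep G₂) {xS yS xT yT : ℤ}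
    (hxS : xS ∈ Set.Icc (-2) 1) (hyS : yS ∈ Set.Icc (-2) 1) (hxT : xT ∈ Set.Icc (-2) 1)
    (hyT : yT ∈ Set.Icc (-2) 1) (hS : xS + yS = R₁.vRot R₁.outS + R₂.vRot R₂.outS + 4)
    (hT : xT + yT = R₁.vRot R₁.outT + R₂.vRot R₂.outT + 4)
    (hmid : R₂.rotPath R₂.outS R₂.outT + xT + R₁.rotPath R₁.outT R₁.outS + yS = 4) :
    ∃ R : OrthRep G, ParallelLink J₁ J₂ R R₁ R₂ ∧ FirstPrecedes J₁ J₂ R ∧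
      R.vRot (J₁ R₁.outS) = xS ∧ R.vRot (J₂ R₂.outS) = yS ∧ R.vRot (J₁ R₁.outT) = xT ∧
      R.vRot (J₂ R₂.outT) = yT := by
  classical
  obtain ⟨n, hn₁, hn₂⟩ := h.exists_perm R₁.next R₂.next
  obtain ⟨e, he₁, he₂⟩ := h.exists_fun R₁.eRot R₂.eRot
  have hne₁ : R₁.outS ≠ R₁.outT := OrthRep.outS_ne_outT hp₁
  have hne₂ : R₂.outS ≠ R₂.outT := OrthRep.outS_ne_outT hp₂
  obtain ⟨v, hv1, hv2⟩ := h.exists_fun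
    (Function.update (Function.update R₁.vRot R₁.outT xT) R₁.outS xS)
    (Function.update (Function.update R₂.vRot R₂.outT yT) R₂.outS yS)
  have hvS₁ : v (J₁ R₁.outS) = xS := by rw [hv1, Function.update_self]
  have hvS₂ : v (J₂ R₂.outS) = yS := by rw [hv2, Function.update_self]
  have hvT₁ : v (J₁ R₁.outT) = xT := by
    rw [hv1, Function.update_of_ne hne₁.symm, Function.update_self]
  have hvT₂ : v (J₂ R₂.outT) = yT := by
    rw [hv2, Function.update_of_ne hne₂.symm, Function.update_self]
  have hv₁ : ∀ a ∉ ({R₁.outS, R₁.outT} : Set _), v (J₁ a) = R₁.vRot a := fun a ha => by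
    simp only [Set.mem_insert_iff, Set.mem_singleton_iff, not_or] at ha
    rw [hv1, Function.update_of_ne ha.1, Function.update_of_ne ha.2]
  have hv₂ : ∀ b ∉ ({R₂.outS, R₂.outT} : Set _), v (J₂ b) = R₂.vRot b := fun b ha => by
    simp only [Set.mem_insert_iff, Set.mem_singleton_iff, not_or] at ha
    rw [hv2, Function.update_of_ne ha.1, Function.update_of_ne ha.2]
  clear hv1 hv2
  have hpG := h.poles_ne hp₁
  have tS₁ : G.tail (J₁ R₁.outS) = G.s := by rw [h.tail_J₁, R₁.tail_outS, h.s_eq]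
  have tT₁ : G.tail (J₁ R₁.outT) = G.t := by rw [h.tail_J₁, R₁.tail_outT, h.t_eq]
  have tS₂ : G.tail (J₂ R₂.outS) = G.s := by rw [h.tail_J₂, R₂.tail_outS, h.s_eq, h.share_s]
  have tT₂ : G.tail (J₂ R₂.outT) = G.t := by rw [h.tail_J₂, R₂.tail_outT, h.t_eq, h.share_t]
  obtain ⟨hgS₁, hgS₂, hgT₁, hgT₂⟩ := swap_mul_swap_apply (h.J₁_inj.ne hne₁)
    (h.J_disj R₁.outS R₂.outT) (h.J_disj R₁.outT R₂.outS).symm (h.J₂_inj.ne hne₂)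
  set B : Set (E × Bool) := {J₁ R₁.outS, J₁ R₁.outT, J₂ R₂.outS, J₂ R₂.outT} with hB
  have hg := swap_mul_swap_fix (B := B) (x := J₁ R₁.outS) (y := J₂ R₂.outS) (z := J₁ R₁.outT)
    (w := J₂ R₂.outT) (by simp [hB]) (by simp [hB]) (by simp [hB]) (by simp [hB])
  have hgB := swap_mul_swap_maps (B := B) (x := J₁ R₁.outS) (y := J₂ R₂.outS) (z := J₁ R₁.outT)
    (w := J₂ R₂.outT) (by simp [hB]) (by simp [hB]) (by simp [hB]) (by simp [hB])
  have hB₁ := mem_fourPoints₁ (S₁ := R₁.outS) (T₁ := R₁.outT) (S₂ := R₂.outS) (T₂ := R₂.outT)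
    h.J₁_inj h.J_disj
  have hB₂ := mem_fourPoints₂ (S₁ := R₁.outS) (T₁ := R₁.outT) (S₂ := R₂.outS) (T₂ := R₂.outT)
    h.J₂_inj h.J_disj
  have hgt : ∀ d, G.tail ((swap (J₁ R₁.outS) (J₂ R₂.outS) * swap (J₁ R₁.outT) (J₂ R₂.outT)) d) =
      G.tail d := fun d => by
    rw [Perm.mul_apply, tail_swap (tS₁.trans tS₂.symm), tail_swap (tT₁.trans tT₂.symm)]
  have hnt := h.tail_perm hn₁ hn₂ R₁.tail_next R₂.tail_next
  have hnT : ∀ a b, ¬ n.SameCycle (J₁ a) (J₂ b) := fun a b hab => by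
    obtain ⟨c, hc, -⟩ := (sameCycle_map_iff hn₁).1 hab
    exact h.J_disj _ _ hc
  -- The swap at `t` does not affect the cycles at `s`, so the second swap again joins two distinct
  -- cycles.
  have hnS : ¬ (swap (J₁ R₁.outT) (J₂ R₂.outT) * n).SameCycle (J₁ R₁.outS) (J₂ R₂.outS) := by
    intro hc
    have hav : ∀ b ∈ ({J₁ R₁.outT, J₂ R₂.outT} : Set _), ¬ n.SameCycle (J₁ R₁.outS) b := by
      intro b hb hb'
      have := eq_of_sameCycle (f := G.tail) hnt hb'
      rw [tS₁] at this
      rcases hb with rfl | rfl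
      · exact hpG (this.trans tT₁)
      · exact hpG (this.trans tT₂)
    exact hnT _ _ ((sameCycle_mul_of_avoid swap_fix hav _).1 hc)
  set g := swap (J₁ R₁.outS) (J₂ R₂.outS) * swap (J₁ R₁.outT) (J₂ R₂.outT) with hgdef
  have hmono : ∀ {d d'}, n.SameCycle d d' → (g * n).SameCycle d d' := fun hc => by
    rw [hgdef, mul_assoc]
    exact SameCycle.swap_mul hnS (SameCycle.swap_mul (hnT _ _) hc)
  have hjS : (g * n).SameCycle (J₁ R₁.outS) (J₂ R₂.outS) := by
    rw [hgdef, mul_assoc]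
    exact sameCycle_swap_mul hnS
  have hjT : (g * n).SameCycle (J₁ R₁.outT) (J₂ R₂.outT) := by
    rw [hgdef, mul_assoc]
    exact SameCycle.swap_mul hnS (sameCycle_swap_mul (hnT _ _))
  have hnext : ∀ d d', (g * n).SameCycle d d' ↔ G.tail d = G.tail d' := by
    intro d d'
    constructor
    · exact fun hc => eq_of_sameCycle (f := G.tail) (fun d => by
        rw [Perm.mul_apply, hgt, hnt]) hc
    · have h11 : ∀ a a', G.tail (J₁ a) = G.tail (J₁ a') → (g * n).SameCycle (J₁ a) (J₁ a') := by
        intro a a' haa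
        rw [h.tail_J₁, h.tail_J₁, h.ι₁_inj.eq_iff, ← R₁.sameCycle_next,
          ← sameCycle_map h.J₁_inj hn₁] at haa
        exact hmono haa
      have h22 : ∀ a a', G.tail (J₂ a) = G.tail (J₂ a') → (g * n).SameCycle (J₂ a) (J₂ a') := by
        intro a a' haa
        rw [h.tail_J₂, h.tail_J₂, h.ι₂_inj.eq_iff, ← R₂.sameCycle_next,
          ← sameCycle_map h.J₂_inj hn₂] at haa
        exact hmono haa
      have h12 : ∀ a b, G.tail (J₁ a) = G.tail (J₂ b) → (g * n).SameCycle (J₁ a) (J₂ b) := by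
        intro a b hab
        have hab' := hab
        rw [h.tail_J₁, h.tail_J₂, h.share] at hab'
        rcases hab' with ⟨h1, h2⟩ | ⟨h1, h2⟩
        · have ha : G.tail (J₁ a) = G.s := by rw [h.tail_J₁, h1, h.s_eq]
          exact (h11 _ _ (ha.trans tS₁.symm)).trans (hjS.trans
            (h22 _ _ (tS₂.trans (ha.symm.trans hab))))
        · have ha : G.tail (J₁ a) = G.t := by rw [h.tail_J₁, h1, h.t_eq]
          exact (h11 _ _ (ha.trans tT₁.symm)).trans (hjT.trans
            (h22 _ _ (tT₂.trans (ha.symm.trans hab))))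
      intro hdd
      rcases h.J_cases d with ⟨a, rfl⟩ | ⟨b, rfl⟩ <;> rcases h.J_cases d' with ⟨a', rfl⟩ | ⟨b', rfl⟩
      · exact h11 _ _ hdd
      · exact h12 _ _ hdd
      · exact (h12 _ _ hdd.symm).symm
      · exact h22 _ _ hdd
  have hf₁ : ∀ a, (n * rev E) (J₁ a) = J₁ (R₁.face a) := fun a => by
    rw [Perm.mul_apply, h.rev_J₁, hn₁]; rfl
  have hf₂ : ∀ a, (n * rev E) (J₂ a) = J₂ (R₂.face a) := fun a => by
    rw [Perm.mul_apply, h.rev_J₂, hn₂]; rfl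
  have a₁ := (OrthRep.arc_outS (R := R₁) hp₁).glue hf₁ he₁ hB₁ hv₁ hg hgB
  have a₂ := (OrthRep.arc_outT (R := R₁) hp₁).glue hf₁ he₁ hB₁ hv₁ hg hgB
  have a₃ := (OrthRep.arc_outS (R := R₂) hp₂).glue hf₂ he₂ hB₂ hv₂ hg hgB
  have a₄ := (OrthRep.arc_outT (R := R₂) hp₂).glue hf₂ he₂ hB₂ hv₂ hg hgB
  rw [hgT₁] at a₁
  rw [hgS₁] at a₂
  rw [hgT₂] at a₃
  rw [hgS₂] at a₄
  obtain ⟨hST, hSS, hM, hnSM⟩ := parallel_arcs a₁ a₄ a₃ a₂ (h.J_disj _ _) (h.J_disj _ _).symm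
    (h.J_disj _ _).symm (h.J₂_inj.ne hne₂)
  rw [← mul_assoc] at hST hSS hM hnSM a₁ a₂ a₃ a₄
  have hMsum := hM.cycleSum_eq
  have hSsum := hSS.cycleSum_eq
  rw [hvT₁, hvS₂] at hMsum
  rw [hvT₂, hvS₁] at hSsum
  have hR₁ := OrthRep.rotPath_add (R := R₁) hp₁
  have hR₂ := OrthRep.rotPath_add (R := R₂) hp₂
  let P : PreRep G := h.combine R₁ R₂ (g := g) (e := e) (v := v) (J₁ R₁.outS) (J₂ R₂.outT)
    hg hgB hB₁ hB₂ hn₁ hn₂ he₁ he₂ hv₁ hv₂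
    (fun a ha => hv₁ a (by
      rintro (h' | h')
      · rw [h', R₁.tail_outS] at ha
        exact ha _ h.share_s
      · rw [h', R₁.tail_outT] at ha
        exact ha _ h.share_t))
    (fun a ha => hv₂ a (by
      rintro (h' | h')
      · rw [h', R₂.tail_outS] at ha
        exact ha _ h.share_s.symm
      · rw [h', R₂.tail_outT] at ha
        exact ha _ h.share_t.symm))
    (by
      intro u w huw
      rcases (h.share _ _).1 huw with ⟨rfl, rfl⟩ | ⟨rfl, rfl⟩
      · refine ⟨R₁.outS, R₂.outS, R₁.tail_outS, R₂.tail_outS, fun a ha' ha => hv₁ a ?_,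
          fun b hb' hb => hv₂ b ?_, by rw [hvS₁, hvS₂, hS]⟩
        · rintro (h' | h')
          · exact ha h'
          · rw [h', R₁.tail_outS, R₁.tail_outT] at ha'
            exact hp₁ ha'.symm
        · rintro (h' | h')
          · exact hb h'
          · rw [h', R₂.tail_outS, R₂.tail_outT] at hb'
            exact hp₂ hb'.symm
      · refine ⟨R₁.outT, R₂.outT, R₁.tail_outT, R₂.tail_outT, fun a ha' ha => hv₁ a ?_,
          fun b hb' hb => hv₂ b ?_, by rw [hvT₁, hvT₂, hT]⟩
        · rintro (h' | h')
          · rw [h', R₁.tail_outS, R₁.tail_outT] at ha'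
            exact hp₁ ha'
          · exact ha h'
        · rintro (h' | h')
          · rw [h', R₂.tail_outS, R₂.tail_outT] at hb'
            exact hp₂ hb'
          · exact hb h')
    (by
      intro d
      rcases h.J_cases d with ⟨a, rfl⟩ | ⟨b, rfl⟩
      · by_cases ha : a ∈ ({R₁.outS, R₁.outT} : Set _)
        · rcases ha with rfl | rfl
          · rw [hvS₁]; exact hxS
          · rw [hvT₁]; exact hxT
        · rw [hv₁ a ha]; exact R₁.vRot_mem a
      · by_cases hb : b ∈ ({R₂.outS, R₂.outT} : Set _)
        · rcases hb with rfl | rfl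
          · rw [hvS₂]; exact hyS
          · rw [hvT₂]; exact hyT
        · rw [hv₂ b hb]; exact R₂.vRot_mem b)
    hnext tS₁ tT₂
    (by
      -- Only the middle face remains, namely the common face of `J₁ R₁.outT` and `J₂ R₂.outS`.
      rintro b (rfl | rfl | rfl | rfl) hbS hbT
      · exact absurd (Perm.SameCycle.refl _ _) hbS
      · rw [cycleSum_congr a₂.sameCycle, hMsum]
        linarith
      · rw [hMsum]
        linarith
      · exact absurd (Perm.SameCycle.refl _ _) hbT)
  have hsum : P.faceSum P.outS = -4 := hSsum.trans (by linarith)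
  refine ⟨P.toOrthRep a₁.sameCycle hsum,
    ⟨he₁, he₂, fun a h1 h2 => hv₁ a (by rintro (h' | h'); exacts [h1 h', h2 h']),
      fun b h1 h2 => hv₂ b (by rintro (h' | h'); exacts [h1 h', h2 h']), rfl, rfl, ?_, ?_, ?_, ?_⟩,
    ⟨⟨_, rfl⟩, ⟨_, rfl⟩, ?_, ?_⟩, hvS₁, hvS₂, hvT₁, hvT₂⟩
  · change v _ + v _ = _
    rw [hvS₁, hvS₂, hS]
  · change v _ + v _ = _
    rw [hvT₁, hvT₂, hT]
  · exact OrthRep.rotPath_eq _ (h.J_disj _ _) hST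
  · change _ + v _ + _ + v _ = _
    rw [hvT₁, hvS₂, hmid]
  · intro d hd hdo hdr
    rcases h.J_cases d with ⟨a, rfl⟩ | ⟨b, rfl⟩
    · exact ⟨a, rfl⟩
    -- The glued order at `s` passes from the second part to the first only where `g` replaces `J₂
    -- R₂.outS` by `J₁ R₁.outS`, that is, on entering the outer dart.
    · exfalso
      change (g * n) (J₂ b) ≠ J₁ R₁.outS at hdo
      obtain ⟨a, ha⟩ : (g * n) (J₂ b) ∈ Set.range J₁ := hdr
      rw [Perm.mul_apply, hn₂] at hdo ha
      by_cases hbB : J₂ (R₂.next b) ∈ B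
      · rcases (hB₂ _).1 hbB with h' | h'
        · rw [h'] at hdo
          exact hdo hgS₂
        · have := hnt (J₂ b)
          rw [hn₂, h', tT₂, hd] at this
          exact hpG this.symm
      · rw [hg _ hbB] at ha
        exact h.J_disj _ _ ha
  · intro d hd hdo hdr
    rcases h.J_cases d with ⟨a, rfl⟩ | ⟨b, rfl⟩
    · exfalso
      change (g * n) (J₁ a) ≠ J₂ R₂.outT at hdo
      obtain ⟨b, hb⟩ : (g * n) (J₁ a) ∈ Set.range J₂ := hdr
      rw [Perm.mul_apply, hn₁] at hdo hb
      by_cases haB : J₁ (R₁.next a) ∈ B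
      · rcases (hB₁ _).1 haB with h' | h'
        · have := hnt (J₁ a)
          rw [hn₁, h', tS₁, hd] at this
          exact hpG this
        · rw [h'] at hdo
          exact hdo hgT₁
      · rw [hg _ haB] at hb
        exact h.J_disj _ _ hb.symm
    · exact ⟨b, rfl⟩

end ParallelGluing

end BendCost

/-! ### Decomposing a representation of a parallel composition -/

namespace BendCost

open Equiv

/-- If `p` maps the points of `P` to points of `P`, no other point is mapped to `P`. -/
theorem of_apply_mem {D : Type} [Finite D] {p : Perm D} {P : D → Prop} (hP : ∀ d, P d → P (p d))
    {d : D} (hd : P (p d)) : P d := by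
  by_contra hnot
  obtain ⟨z, -, hz, hz'⟩ := exists_crossing (p := p) (P := P) (x := p d) (y := d)
    (Perm.sameCycle_apply_left.2 (Perm.SameCycle.refl _ _)) hd hnot
  exact hz' (hP z hz)

namespace ParallelGluing

variable {V₁ E₁ V₂ E₂ V E : Type} {G₁ : PoleGraph V₁ E₁} {G₂ : PoleGraph V₂ E₂}
  {G : PoleGraph V E} {ι₁ : V₁ → V} {ι₂ : V₂ → V} {J₁ : E₁ × Bool → E × Bool}
  {J₂ : E₂ × Bool → E × Bool} [Fintype E]

/-- Around each pole the parts change exactly twice, once at the outer dart and once between the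
parts. Swapping the darts that follow these two changes closes the order of each part separately. -/
theorem exists_switch [DecidableEq (E × Bool)] (h : ParallelGluing G₁ G₂ G ι₁ ι₂ J₁ J₂)
    (h₁ : G₁.IsSTGraph) (h₂ : G₂.IsSTGraph) (R : OrthRep G) (hR : FirstPrecedes J₁ J₂ R) :
    ∃ S₁ T₁ S₂ T₂, R.outS = J₁ S₁ ∧ R.outT = J₂ T₂ ∧ G₁.tail S₁ = G₁.s ∧ G₁.tail T₁ = G₁.t ∧
      G₂.tail S₂ = G₂.s ∧ G₂.tail T₂ = G₂.t ∧
      (∀ a, ∃ a', (swap (J₁ S₁) (J₂ S₂) * swap (J₁ T₁) (J₂ T₂) * R.next) (J₁ a) = J₁ a') ∧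
      ∀ b, ∃ b', (swap (J₁ S₁) (J₂ S₂) * swap (J₁ T₁) (J₂ T₂) * R.next) (J₂ b) = J₂ b' := by
  obtain ⟨⟨S₁, hS₁⟩, ⟨T₂, hT₂⟩, hside, htide⟩ := hR
  have hpG := h.poles_ne h₁.poles_ne
  have hι₁s : ∀ a, G.tail (J₁ a) = G.s ↔ G₁.tail a = G₁.s := fun a => by
    rw [h.tail_J₁, h.s_eq, h.ι₁_inj.eq_iff]
  have hι₁t : ∀ a, G.tail (J₁ a) = G.t ↔ G₁.tail a = G₁.t := fun a => by
    rw [h.tail_J₁, h.t_eq, h.ι₁_inj.eq_iff]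
  have hι₂s : ∀ b, G.tail (J₂ b) = G.s ↔ G₂.tail b = G₂.s := fun a => by
    rw [h.tail_J₂, h.s_eq, h.share_s, h.ι₂_inj.eq_iff]
  have hι₂t : ∀ b, G.tail (J₂ b) = G.t ↔ G₂.tail b = G₂.t := fun a => by
    rw [h.tail_J₂, h.t_eq, h.share_t, h.ι₂_inj.eq_iff]
  have toS₁ : G.tail (J₁ S₁) = G.s := by rw [hS₁, R.tail_outS]
  have toT₂ : G.tail (J₂ T₂) = G.t := by rw [hT₂, R.tail_outT]
  obtain ⟨b₀, hb₀⟩ := h₂.exists_tail G₂.s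
  obtain ⟨a₀, ha₀⟩ := h₁.exists_tail G₁.t
  have hb₀' : R.next.SameCycle (J₁ S₁) (J₂ b₀) := by
    rw [R.sameCycle_next, toS₁, (hι₂s b₀).2 hb₀]
  have ha₀' : R.next.SameCycle (J₂ T₂) (J₁ a₀) := by
    rw [R.sameCycle_next, toT₂, (hι₁t a₀).2 ha₀]
  obtain ⟨_, hzc, ⟨z, rfl⟩, hz⟩ := exists_crossing (P := fun x => ∃ a, J₁ a = x) hb₀' ⟨S₁, rfl⟩
    (by rintro ⟨a, ha⟩; exact h.J_disj _ _ ha)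
  obtain ⟨_, hwc, ⟨w, rfl⟩, hw⟩ := exists_crossing (P := fun x => ∃ b, J₂ b = x) ha₀' ⟨T₂, rfl⟩
    (by rintro ⟨a, ha⟩; exact h.J_disj _ _ ha.symm)
  obtain ⟨S₂, hS₂⟩ := (h.J_cases _).resolve_left hz
  obtain ⟨T₁, hT₁⟩ := (h.J_cases _).resolve_right hw
  have toS₂ : G.tail (J₂ S₂) = G.s := by
    rw [hS₂, R.tail_next, ← (R.sameCycle_next _ _).1 hzc, toS₁]
  have toT₁ : G.tail (J₁ T₁) = G.t := by
    rw [hT₁, R.tail_next, ← (R.sameCycle_next _ _).1 hwc, toT₂]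
  have hne₁ : J₁ S₁ ≠ J₁ T₁ := fun h' => hpG (by rw [← toS₁, h', toT₁])
  have hne₂ : J₂ S₂ ≠ J₂ T₂ := fun h' => hpG (by rw [← toS₂, h', toT₂])
  obtain ⟨hgS₁, -, -, hgT₂⟩ := swap_mul_swap_apply hne₁ (h.J_disj S₁ T₂) (h.J_disj T₁ S₂).symm hne₂
  set g := swap (J₁ S₁) (J₂ S₂) * swap (J₁ T₁) (J₂ T₂) with hg
  have hgt : ∀ d, G.tail (g d) = G.tail d := fun d => by
    rw [Perm.mul_apply, tail_swap (toS₁.trans toS₂.symm), tail_swap (toT₁.trans toT₂.symm)]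
  have hnt : ∀ d, G.tail ((g * R.next) d) = G.tail d := fun d => by
    rw [Perm.mul_apply, hgt, R.tail_next]
  have hfix : ∀ d, d ≠ J₁ S₁ → d ≠ J₁ T₁ → d ≠ J₂ S₂ → d ≠ J₂ T₂ → g d = d := by
    intro d h1 h2 h3 h4
    rw [hg, Perm.mul_apply, swap_apply_of_ne_of_ne h2 h4, swap_apply_of_ne_of_ne h1 h3]
  -- After the swaps, the darts of the second part at `s` are mapped to themselves, and by `hB`
  -- likewise those of the first part at `t`. By finiteness (`of_apply_mem`) the other part at each
  -- pole is then closed, too.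
  have hA : ∀ d, (G.tail d = G.s ∧ ∃ b, J₂ b = d) →
      G.tail ((g * R.next) d) = G.s ∧ ∃ b, J₂ b = (g * R.next) d := by
    rintro _ ⟨hd, b, rfl⟩
    refine ⟨(hnt _).trans hd, ?_⟩
    rw [Perm.mul_apply]
    rcases h.J_cases (R.next (J₂ b)) with ⟨a', ha'⟩ | ⟨b', hb'⟩
    · have hout : R.next (J₂ b) = R.outS := by
        by_contra hne
        obtain ⟨a, ha⟩ := hside _ hd hne ⟨a', ha'⟩
        exact h.J_disj _ _ ha
      rw [hout, ← hS₁, hgS₁]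
      exact ⟨_, rfl⟩
    · refine ⟨b', ?_⟩
      rw [← hb', hfix _ (h.J_disj _ _).symm (h.J_disj _ _).symm]
      · intro h'
        rw [h', hS₂] at hb'
        exact h.J_disj _ _ (R.next.injective hb')
      · intro h'
        have := R.tail_next (J₂ b)
        rw [← hb', h', toT₂, hd] at this
        exact hpG this.symm
  have hB : ∀ d, (G.tail d = G.t ∧ ∃ a, J₁ a = d) →
      G.tail ((g * R.next) d) = G.t ∧ ∃ a, J₁ a = (g * R.next) d := by
    rintro _ ⟨hd, a, rfl⟩
    refine ⟨(hnt _).trans hd, ?_⟩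
    rw [Perm.mul_apply]
    rcases h.J_cases (R.next (J₁ a)) with ⟨a', ha'⟩ | ⟨b', hb'⟩
    · refine ⟨a', ?_⟩
      rw [← ha', hfix _ _ _ (h.J_disj _ _) (h.J_disj _ _)]
      · intro h'
        have := R.tail_next (J₁ a)
        rw [← ha', h', toS₁, hd] at this
        exact hpG this
      · intro h'
        rw [h', hT₁] at ha'
        exact h.J_disj _ _ (R.next.injective ha').symm
    · have hout : R.next (J₁ a) = R.outT := by
        by_contra hne
        obtain ⟨b, hb⟩ := htide _ hd hne ⟨b', hb'⟩
        exact h.J_disj _ _ hb.symm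
      rw [hout, ← hT₂, hgT₂]
      exact ⟨_, rfl⟩
  have hfar : ∀ d, G.tail d ≠ G.s → G.tail d ≠ G.t → (g * R.next) d = R.next d := by
    intro d hs ht
    rw [Perm.mul_apply]
    apply hfix <;> intro h' <;> have := R.tail_next d <;> rw [h'] at this
    · exact hs (this.symm.trans toS₁)
    · exact ht (this.symm.trans toT₁)
    · exact hs (this.symm.trans toS₂)
    · exact ht (this.symm.trans toT₂)
  refine ⟨S₁, T₁, S₂, T₂, hS₁.symm, hT₂.symm, (hι₁s _).1 toS₁, (hι₁t _).1 toT₁, (hι₂s _).1 toS₂,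
    (hι₂t _).1 toT₂, fun a => ?_, fun b => ?_⟩
  · rcases h.J_cases ((g * R.next) (J₁ a)) with ⟨a', ha'⟩ | ⟨b', hb'⟩
    · exact ⟨a', ha'.symm⟩
    exfalso
    by_cases hs : G.tail (J₁ a) = G.s
    · obtain ⟨b, hb⟩ := (of_apply_mem hA (d := J₁ a) ⟨(hnt _).trans hs, b', hb'⟩).2
      exact h.J_disj _ _ hb.symm
    by_cases ht : G.tail (J₁ a) = G.t
    · obtain ⟨a', ha'⟩ := (hB _ ⟨ht, a, rfl⟩).2
      exact h.J_disj _ _ (ha'.trans hb'.symm)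
    have htail := R.tail_next (J₁ a)
    rw [← hfar _ hs ht, ← hb', h.tail_J₂, h.tail_J₁] at htail
    rcases (h.share _ _).1 htail.symm with ⟨h', -⟩ | ⟨h', -⟩
    · exact hs ((hι₁s a).2 h')
    · exact ht ((hι₁t a).2 h')
  · rcases h.J_cases ((g * R.next) (J₂ b)) with ⟨a', ha'⟩ | ⟨b', hb'⟩
    swap
    · exact ⟨b', hb'.symm⟩
    exfalso
    by_cases ht : G.tail (J₂ b) = G.t
    · obtain ⟨b, hb⟩ := (of_apply_mem hB (d := J₂ b) ⟨(hnt _).trans ht, a', ha'⟩).2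
      exact h.J_disj _ _ hb
    by_cases hs : G.tail (J₂ b) = G.s
    · obtain ⟨b', hb'⟩ := (hA _ ⟨hs, b, rfl⟩).2
      exact h.J_disj _ _ (ha'.trans hb'.symm)
    have htail := R.tail_next (J₂ b)
    rw [← hfar _ hs ht, ← ha', h.tail_J₂, h.tail_J₁] at htail
    rcases (h.share _ _).1 htail with ⟨-, h'⟩ | ⟨-, h'⟩
    · exact hs ((hι₂s b).2 h')
    · exact ht ((hι₂t b).2 h')

variable [Fintype E₁] [Fintype E₂]

/-- It is not known in advance that the poles of each part remain on a common face. The possible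
distributions of the four distinguished darts are examined: if exactly one part has its poles on
different faces, the rotation sums are too small; if both do, the poles of `R` do not share a face.
Otherwise the sums of the parts are forced to be `-4`. -/
theorem exists_parts [Fintype V₁] [Fintype V₂] (h : ParallelGluing G₁ G₂ G ι₁ ι₂ J₁ J₂)
    (h₁ : G₁.IsSTGraph) (h₂ : G₂.IsSTGraph) (R : OrthRep G) (hR : FirstPrecedes J₁ J₂ R) :
    ∃ (R₁ : OrthRep G₁) (R₂ : OrthRep G₂), ParallelLink J₁ J₂ R R₁ R₂ := by
  classical
  obtain ⟨S₁, T₁, S₂, T₂, hS₁, hT₂, tS₁, tT₁, tS₂, tT₂, hm₁, hm₂⟩ := h.exists_switch h₁ h₂ R hR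
  obtain ⟨n₁, hn₁⟩ := exists_perm_restrict h.J₁_inj hm₁
  obtain ⟨n₂, hn₂⟩ := exists_perm_restrict h.J₂_inj hm₂
  have htailS : G.tail (J₁ S₁) = G.tail (J₂ S₂) := by
    rw [h.tail_J₁, h.tail_J₂, tS₁, tS₂, h.share_s]
  have htailT : G.tail (J₁ T₁) = G.tail (J₂ T₂) := by
    rw [h.tail_J₁, h.tail_J₂, tT₁, tT₂, h.share_t]
  have hne₁ : S₁ ≠ T₁ := fun h' => h₁.poles_ne (by rw [← tS₁, h', tT₁])
  have hne₂ : S₂ ≠ T₂ := fun h' => h₂.poles_ne (by rw [← tS₂, h', tT₂])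
  have hfillS := h.fillVal_add (v := R.vRot) htailS (R.sum_vertex _)
  have hfillT := h.fillVal_add (v := R.vRot) htailT (R.sum_vertex _)
  have hge₁ := neg_two_le_fillVal (G := G₁.toMultigraph) (v := fun a => R.vRot (J₁ a))
    (fun d => (R.vRot_mem _).2)
  have hge₂ := neg_two_le_fillVal (G := G₂.toMultigraph) (v := fun b => R.vRot (J₂ b))
    (fun d => (R.vRot_mem _).2)
  have bS₁ := (R.vRot_mem (J₁ S₁)).2
  have bS₂ := (R.vRot_mem (J₂ S₂)).2
  have bT₁ := (R.vRot_mem (J₁ T₁)).2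
  have bT₂ := (R.vRot_mem (J₂ T₂)).2
  have cS₁ := hge₁ S₁
  have cS₂ := hge₂ S₂
  have cT₁ := hge₁ T₁
  have cT₂ := hge₂ T₂
  set B : Set (E × Bool) := {J₁ S₁, J₁ T₁, J₂ S₂, J₂ T₂} with hB
  have hg := swap_mul_swap_fix (B := B) (x := J₁ S₁) (y := J₂ S₂) (z := J₁ T₁)
    (w := J₂ T₂) (by simp [hB]) (by simp [hB]) (by simp [hB]) (by simp [hB])
  have hgB := swap_mul_swap_maps (B := B) (x := J₁ S₁) (y := J₂ S₂) (z := J₁ T₁)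
    (w := J₂ T₂) (by simp [hB]) (by simp [hB]) (by simp [hB]) (by simp [hB])
  have hB₁ := mem_fourPoints₁ (S₁ := S₁) (T₁ := T₁) (S₂ := S₂) (T₂ := T₂) h.J₁_inj h.J_disj
  have hB₂ := mem_fourPoints₂ (S₁ := S₁) (T₁ := T₁) (S₂ := S₂) (T₂ := T₂) h.J₂_inj h.J_disj
  obtain ⟨hgS₁, hgS₂, hgT₁, hgT₂⟩ := swap_mul_swap_apply (h.J₁_inj.ne hne₁)
    (h.J_disj S₁ T₂) (h.J_disj T₁ S₂).symm (h.J₂_inj.ne hne₂)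
  have hgg := swap_mul_swap_mul_self (h.J₁_inj.ne hne₁)
    (h.J_disj S₁ T₂) (h.J_disj T₁ S₂).symm (h.J₂_inj.ne hne₂)
  have hgt : ∀ d, G.tail ((swap (J₁ S₁) (J₂ S₂) * swap (J₁ T₁) (J₂ T₂)) d) = G.tail d := fun d => by
    rw [Perm.mul_apply, tail_swap htailS, tail_swap htailT]
  set g := swap (J₁ S₁) (J₂ S₂) * swap (J₁ T₁) (J₂ T₂)
  have hoB : R.outS ∈ B := by rw [hS₁]; simp [hB]
  let P₁ : PreRep G₁ := h.toGluing.restrict R (A := {S₁, T₁}) hg hgB hoB hB₁ hgt hn₁ tS₁ tT₁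
    h₁.poles_ne subset_rfl (by rintro _ (rfl | rfl) <;> omega) (fun u => by
      by_cases hs : u = G₁.s
      · exact Or.inl ⟨S₁, by simp, by rw [tS₁, hs]⟩
      by_cases ht : u = G₁.t
      · exact Or.inl ⟨T₁, by simp, by rw [tT₁, ht]⟩
      · exact Or.inr fun w huw => ((h.share _ _).1 huw).elim (fun h' => hs h'.1) fun h' => ht h'.1)
  let P₂ : PreRep G₂ := h.symm.restrict R (A := {S₂, T₂}) hg hgB hoB hB₂ hgt hn₂ tS₂ tT₂
    h₂.poles_ne subset_rfl (by rintro _ (rfl | rfl) <;> omega) (fun w => by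
      by_cases hs : w = G₂.s
      · exact Or.inl ⟨S₂, by simp, by rw [tS₂, hs]⟩
      by_cases ht : w = G₂.t
      · exact Or.inl ⟨T₂, by simp, by rw [tT₂, ht]⟩
      · exact Or.inr fun u huw =>
          ((h.share _ _).1 huw.symm).elim (fun h' => hs h'.2) fun h' => ht h'.2)
  have hvS₁ : P₁.vRot S₁ = fillVal G₁.toMultigraph (fun a => R.vRot (J₁ a)) S₁ := if_pos (by simp)
  have hvT₁ : P₁.vRot T₁ = fillVal G₁.toMultigraph (fun a => R.vRot (J₁ a)) T₁ := if_pos (by simp)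
  have hvS₂ : P₂.vRot S₂ = fillVal G₂.toMultigraph (fun b => R.vRot (J₂ b)) S₂ := if_pos (by simp)
  have hvT₂ : P₂.vRot T₂ = fillVal G₂.toMultigraph (fun b => R.vRot (J₂ b)) T₂ := if_pos (by simp)
  have hv₁ : ∀ a ∉ ({S₁, T₁} : Set _), R.vRot (J₁ a) = P₁.vRot a := fun a ha => (if_neg ha).symm
  have hv₂ : ∀ b ∉ ({S₂, T₂} : Set _), R.vRot (J₂ b) = P₂.vRot b := fun b hb => (if_neg hb).symm
  set p := g * R.face with hp
  have hface : g * p = R.face := by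
    rw [hp, ← mul_assoc, hgg, one_mul]
  have hp₁ : ∀ a, p (J₁ a) = J₁ (P₁.face a) := fun a => by
    have := hn₁ (rev E₁ a)
    rw [← h.rev_J₁] at this
    exact this
  have hp₂ : ∀ a, p (J₂ a) = J₂ (P₂.face a) := fun a => by
    have := hn₂ (rev E₂ a)
    rw [← h.rev_J₂] at this
    exact this
  have lift₁ : ∀ {a b r}, Arc P₁.face P₁.eRot P₁.vRot {S₁, T₁} a b r →
      Arc R.face R.eRot R.vRot B (J₁ a) (g (J₁ b)) r := fun {a b r} ha => by
    rw [← hface]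
    exact ha.glue hp₁ (fun _ => rfl) hB₁ hv₁ hg hgB
  have lift₂ : ∀ {a b r}, Arc P₂.face P₂.eRot P₂.vRot {S₂, T₂} a b r →
      Arc R.face R.eRot R.vRot B (J₂ a) (g (J₂ b)) r := fun {a b r} ha => by
    rw [← hface]
    exact ha.glue hp₂ (fun _ => rfl) hB₂ hv₂ hg hgB
  have hout := R.cycleSum_outS
  have hoT : R.face.SameCycle (J₁ S₁) (J₂ T₂) := by
    rw [← hS₁, ← hT₂]
    exact R.same_outer
  by_cases c₁ : P₁.face.SameCycle S₁ T₁
  · obtain ⟨r₁, hr₁⟩ := exists_arc_pair P₁.eRot P₁.vRot hne₁ c₁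
    obtain ⟨q₁, hq₁⟩ := exists_arc_pair P₁.eRot P₁.vRot hne₁.symm c₁.symm
    rw [Set.pair_comm] at hq₁
    have hs₁ : P₁.faceSum S₁ = _ := ((hr₁.trans (B' := {S₁}) (by simp)
      (by simpa using hne₁.symm) (hq₁.anti (by simp) (by simp)))).cycleSum_eq
    have hge := P₁.faceSum_ge h₁ c₁
    change -4 ≤ P₁.faceSum S₁ at hge
    have a₁ := lift₁ hr₁
    have a₂ := lift₁ hq₁
    rw [hgT₁] at a₁
    rw [hgS₁] at a₂
    by_cases c₂ : P₂.face.SameCycle S₂ T₂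
    · obtain ⟨r₂, hr₂⟩ := exists_arc_pair P₂.eRot P₂.vRot hne₂ c₂
      obtain ⟨q₂, hq₂⟩ := exists_arc_pair P₂.eRot P₂.vRot hne₂.symm c₂.symm
      rw [Set.pair_comm] at hq₂
      have hs₂ : P₂.faceSum S₂ = _ := ((hr₂.trans (B' := {S₂}) (by simp)
        (by simpa using hne₂.symm) (hq₂.anti (by simp) (by simp)))).cycleSum_eq
      have hge' := P₂.faceSum_ge h₂ c₂
      change -4 ≤ P₂.faceSum S₂ at hge'
      have a₃ := lift₂ hr₂
      have a₄ := lift₂ hq₂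
      rw [hgT₂] at a₃
      rw [hgS₂] at a₄
      obtain ⟨hST, hSS, hM, hnSM⟩ := parallel_arcs a₁ a₄ a₃ a₂ (h.J_disj _ _) (h.J_disj _ _).symm
        (h.J_disj _ _).symm (h.J₂_inj.ne hne₂)
      rw [← hS₁] at hnSM
      have hmid := hM.cycleSum_eq
      rw [R.cycleSum_inner hnSM] at hmid
      have hSsum := hSS.cycleSum_eq
      rw [← hS₁, hout, hS₁] at hSsum
      -- The outer and the middle face have the sums `-4` and `4`. Filling in at both poles
      -- subtracts `8`, so the sums of the parts add up to `-8`, and each is at least `-4`.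
      have hsum₁ : P₁.faceSum S₁ = -4 := by omega
      have hsum₂ : P₂.faceSum S₂ = -4 := by omega
      let R₁ := P₁.toOrthRep c₁ hsum₁
      let R₂ := P₂.toOrthRep c₂ hsum₂
      have er₁ : R₁.rotPath S₁ T₁ = r₁ := R₁.rotPath_eq hne₁ (hr₁.anti (by simp) (by simp))
      have eq₁ : R₁.rotPath T₁ S₁ = q₁ := R₁.rotPath_eq hne₁.symm (hq₁.anti (by simp) (by simp))
      have er₂ : R₂.rotPath S₂ T₂ = r₂ := R₂.rotPath_eq hne₂ (hr₂.anti (by simp) (by simp))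
      refine ⟨R₁, R₂, fun _ => rfl, fun _ => rfl,
        fun a h1 h2 => hv₁ a (by rintro (h' | h'); exacts [h1 h', h2 h']),
        fun b h1 h2 => hv₂ b (by rintro (h' | h'); exacts [h1 h', h2 h']), hS₁, hT₂, ?_, ?_, ?_, ?_⟩
      · change R.vRot (J₁ S₁) + R.vRot (J₂ S₂) = P₁.vRot S₁ + P₂.vRot S₂ + 4
        omega
      · change R.vRot (J₁ T₁) + R.vRot (J₂ T₂) = P₁.vRot T₁ + P₂.vRot T₂ + 4
        omega
      · change _ = R₁.rotPath S₁ T₁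
        rw [er₁, hS₁, hT₂]
        exact R.rotPath_eq (h.J_disj _ _) hST
      · change R₂.rotPath S₂ T₂ + R.vRot (J₁ T₁) + R₁.rotPath T₁ S₁ + R.vRot (J₂ S₂) = 4
        omega
    · exfalso
      obtain ⟨u, hu⟩ := exists_arc_single P₂.eRot P₂.vRot c₂
      obtain ⟨w, hw⟩ := exists_arc_single P₂.eRot P₂.vRot fun h' => c₂ h'.symm
      rw [Set.pair_comm] at hw
      have hs₂ : P₂.faceSum S₂ = _ := (hu.anti (B' := {S₂}) (by simp) (by simp)).cycleSum_eq
      have hs₂' : P₂.faceSum T₂ = _ := (hw.anti (B' := {T₂}) (by simp) (by simp)).cycleSum_eq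
      have hge' := P₂.faceSum_add_ge h₂ c₂
      change 0 ≤ P₂.faceSum S₂ + P₂.faceSum T₂ at hge'
      have a₃ := lift₂ hu
      have a₄ := lift₂ hw
      rw [hgS₂] at a₃
      rw [hgT₂] at a₄
      -- Now all four darts lie on the outer face. Its sum `-4`, lowered by `8`, contradicts the
      -- lower bounds `-4` for the first part and `0` for the two faces of the second.
      have hSsum := (a₁.four_cycle a₄ a₂ a₃ (h.J_disj _ _).symm (h.J_disj _ _).symm
        (h.J₁_inj.ne hne₁.symm) (h.J_disj _ _).symm).2.cycleSum_eq
      rw [← hS₁, hout, hS₁] at hSsum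
      omega
  · exfalso
    obtain ⟨u, hu⟩ := exists_arc_single P₁.eRot P₁.vRot c₁
    obtain ⟨w, hw⟩ := exists_arc_single P₁.eRot P₁.vRot fun h' => c₁ h'.symm
    rw [Set.pair_comm] at hw
    have hs₁ : P₁.faceSum S₁ = _ := (hu.anti (B' := {S₁}) (by simp) (by simp)).cycleSum_eq
    have hs₁' : P₁.faceSum T₁ = _ := (hw.anti (B' := {T₁}) (by simp) (by simp)).cycleSum_eq
    have hge := P₁.faceSum_add_ge h₁ c₁
    change 0 ≤ P₁.faceSum S₁ + P₁.faceSum T₁ at hge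
    have a₁ := lift₁ hu
    have a₂ := lift₁ hw
    rw [hgS₁] at a₁
    rw [hgT₁] at a₂
    by_cases c₂ : P₂.face.SameCycle S₂ T₂
    · obtain ⟨r₂, hr₂⟩ := exists_arc_pair P₂.eRot P₂.vRot hne₂ c₂
      obtain ⟨q₂, hq₂⟩ := exists_arc_pair P₂.eRot P₂.vRot hne₂.symm c₂.symm
      rw [Set.pair_comm] at hq₂
      have hs₂ : P₂.faceSum S₂ = _ := ((hr₂.trans (B' := {S₂}) (by simp)
        (by simpa using hne₂.symm) (hq₂.anti (by simp) (by simp)))).cycleSum_eq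
      have hge' := P₂.faceSum_ge h₂ c₂
      change -4 ≤ P₂.faceSum S₂ at hge'
      have a₃ := lift₂ hr₂
      have a₄ := lift₂ hq₂
      rw [hgT₂] at a₃
      rw [hgS₂] at a₄
      have hSsum := (a₁.four_cycle a₃ a₂ a₄ (h.J_disj _ _).symm (h.J_disj _ _).symm
        (h.J₁_inj.ne hne₁.symm) (h.J_disj _ _).symm).2.cycleSum_eq
      rw [← hS₁, hout, hS₁] at hSsum
      omega
    · obtain ⟨u', hu'⟩ := exists_arc_single P₂.eRot P₂.vRot c₂
      have a₃ := lift₂ hu'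
      rw [hgS₂] at a₃
      -- The outer face would alternate between `J₁ S₁` and `J₂ S₂` and never reach `outT`.
      have := Arc.mem_of_closed (e := R.eRot) (v := R.vRot) (C := {J₁ S₁, J₂ S₂}) (b := J₂ T₂)
        (fun c hc => by
          rcases hc with rfl | rfl
          · exact ⟨_, by simp, _, a₁⟩
          · exact ⟨_, by simp, _, a₃⟩) (by simp) (by simp [hB]) hoT
      rcases this with h' | h'
      · exact h.J_disj _ _ h'.symm
      · exact hne₂ (h.J₂_inj h').symm

end ParallelGluing

end BendCost

namespace BendCost

open Equiv

/-! ### Restricted representations of glued graphs -/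

section GluedRestriction

variable {V₁ E₁ V₂ E₂ V E : Type} [Fintype E₁] [Fintype E₂] [Fintype E]

theorem Multigraph.degree_pos {G : Multigraph V E} {v : V} {d : E × Bool} (hd : G.tail d = v) :
    0 < G.degree v := by
  classical
  rw [Multigraph.degree_eq, Finset.card_pos]
  exact ⟨d, by simpa using hd⟩

theorem Multigraph.eq_of_degree_le_one {G : Multigraph V E} {v : V} {d d' : E × Bool}
    (h : G.degree v ≤ 1) (hd : G.tail d = v) (hd' : G.tail d' = v) : d = d' := by
  classical
  rw [Multigraph.degree_eq] at h
  exact Finset.card_le_one.1 h d (by simpa using hd) d' (by simpa using hd')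

namespace Gluing

variable {G₁ : PoleGraph V₁ E₁} {G₂ : PoleGraph V₂ E₂} {G : PoleGraph V E} {ι₁ : V₁ → V}
  {ι₂ : V₂ → V} {J₁ : E₁ × Bool → E × Bool} {J₂ : E₂ × Bool → E × Bool} {R : OrthRep G}
  {R₁ : OrthRep G₁} {R₂ : OrthRep G₂} {W : Set V}

theorem restricted (h : Gluing G₁.toMultigraph G₂.toMultigraph G.toMultigraph ι₁ ι₂ J₁ J₂)
    (hv₁ : ∀ a, (∀ w, ι₁ (G₁.tail a) ≠ ι₂ w) → R.vRot (J₁ a) = R₁.vRot a)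
    (hv₂ : ∀ b, (∀ u, ι₁ u ≠ ι₂ (G₂.tail b)) → R.vRot (J₂ b) = R₂.vRot b)
    (hs : ∀ u w, ι₁ u = ι₂ w → ι₁ u ∈ W → ∃ d, G.tail d = ι₁ u ∧ R.vRot d = 1)
    (h₁ : R₁.Restricted (ι₁ ⁻¹' W)) (h₂ : R₂.Restricted (ι₂ ⁻¹' W)) : R.Restricted W := by
  intro v hv hdeg
  by_cases hsh : ∃ u w, ι₁ u = ι₂ w ∧ ι₁ u = v
  · obtain ⟨u, w, huw, rfl⟩ := hsh
    exact hs u w huw hv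
  · push Not at hsh
    rcases h.ι_cases v with ⟨u, rfl⟩ | ⟨w, rfl⟩
    · have hu : ∀ w, ι₁ u ≠ ι₂ w := fun w hw => hsh u w hw rfl
      obtain ⟨a, ha, hr⟩ := h₁ u hv (by rw [← h.degree_unshared hu, hdeg])
      exact ⟨J₁ a, by rw [h.tail_J₁, ha], by rw [hv₁ a (by rwa [ha]), hr]⟩
    · have hw : ∀ u, ι₁ u ≠ ι₂ w := fun u hu => hsh u w hu hu
      obtain ⟨b, hb, hr⟩ := h₂ w hv (by
        rw [← h.symm.degree_unshared fun u => (hw u).symm, hdeg])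
      exact ⟨J₂ b, by rw [h.tail_J₂, hb], by rw [hv₂ b (by rwa [hb]), hr]⟩

/-- A vertex of `W` with degree two in the part is not shared, since the other part would raise its
degree above two. So its angles are those in `R`. -/
theorem restricted_left (h : Gluing G₁.toMultigraph G₂.toMultigraph G.toMultigraph ι₁ ι₂ J₁ J₂)
    (hv₁ : ∀ a, (∀ w, ι₁ (G₁.tail a) ≠ ι₂ w) → R.vRot (J₁ a) = R₁.vRot a)
    (ht : ∀ w, ∃ b, G₂.tail b = w) (hdeg : ∀ v ∈ W, G.degree v ≤ 2) (hR : R.Restricted W) :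
    R₁.Restricted (ι₁ ⁻¹' W) := by
  intro u hu hdu
  have hun : ∀ w, ι₁ u ≠ ι₂ w := fun w hw => by
    obtain ⟨b, hb⟩ := ht w
    have h1 := h.degree_shared hw
    have h2 := hdeg _ hu
    have h3 := Multigraph.degree_pos hb
    omega
  obtain ⟨d, hd, hr⟩ := hR _ hu (by rw [h.degree_unshared hun, hdu])
  rcases h.J_cases d with ⟨a, rfl⟩ | ⟨b, rfl⟩
  · rw [h.tail_J₁] at hd
    refine ⟨a, h.ι₁_inj hd, ?_⟩
    rw [← hv₁ a (by rwa [h.ι₁_inj hd]), hr]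
  · rw [h.tail_J₂] at hd
    exact absurd hd.symm (hun _)

theorem restricted_right (h : Gluing G₁.toMultigraph G₂.toMultigraph G.toMultigraph ι₁ ι₂ J₁ J₂)
    (hv₂ : ∀ b, (∀ u, ι₁ u ≠ ι₂ (G₂.tail b)) → R.vRot (J₂ b) = R₂.vRot b)
    (ht : ∀ u, ∃ a, G₁.tail a = u) (hdeg : ∀ v ∈ W, G.degree v ≤ 2) (hR : R.Restricted W) :
    R₂.Restricted (ι₂ ⁻¹' W) :=
  h.symm.restricted_left (fun b hb => hv₂ b fun u => (hb u).symm) ht hdeg hR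

/-- A shared vertex of `W` has degree one in each part, hence the darts `a` and `b` represent its
only two angles. -/
theorem restricted_shared (h : Gluing G₁.toMultigraph G₂.toMultigraph G.toMultigraph ι₁ ι₂ J₁ J₂)
    (hdeg : ∀ v ∈ W, G.degree v ≤ 2) (hR : R.Restricted W) {a : E₁ × Bool} {b : E₂ × Bool}
    (hab : ι₁ (G₁.tail a) = ι₂ (G₂.tail b)) (hW : ι₁ (G₁.tail a) ∈ W) :
    R.vRot (J₁ a) = 1 ∨ R.vRot (J₂ b) = 1 := by
  have h1 := h.degree_shared hab
  have h2 := hdeg _ hW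
  have h3 := Multigraph.degree_pos (rfl : G₁.tail a = _)
  have h4 := Multigraph.degree_pos (rfl : G₂.tail b = _)
  obtain ⟨d, hd, hr⟩ := hR _ hW (by omega)
  rcases h.J_cases d with ⟨a', rfl⟩ | ⟨b', rfl⟩
  · rw [h.tail_J₁] at hd
    rw [Multigraph.eq_of_degree_le_one (by omega) rfl (h.ι₁_inj hd)]
    exact Or.inl hr
  · rw [h.tail_J₂, hab] at hd
    rw [Multigraph.eq_of_degree_le_one (by omega) rfl (h.ι₂_inj hd)]
    exact Or.inr hr

end Gluing

/-! ### From bend numbers to rotations and back -/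

namespace OrthRep

variable {G : PoleGraph V E}

/-- `(σ, τ)`-orthogonal representations in the class `A` in which the path from `s` to `t` on the
outer face has the rotation `ρ`, and whose cost is `x`. -/
def Realizes (A : Set (OrthRep G)) (w : E → ℕ → WithTop ℝ) (σ τ : ℕ) (ρ : ℤ) (x : WithTop ℝ) :
    Prop :=
  ∃ R ∈ A, R.IsST σ τ ∧ R.rotPath R.outS R.outT = ρ ∧ R.cost w = x

/-- Mirroring exchanges the two boundary paths, and `rotPath_add` expresses the rotation of one by
that of the other. -/
theorem Realizes.flip [Fintype V] (hG : G.s ≠ G.t) {A : Set (OrthRep G)}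
    (hA : ∀ R ∈ A, R.mirror ∈ A) {w : E → ℕ → WithTop ℝ} {σ τ : ℕ} {ρ : ℤ} {x : WithTop ℝ}
    (h : Realizes A w σ τ ρ x) : Realizes A w σ τ (2 - σ - τ - ρ) x := by
  obtain ⟨R, hR, hst, hρ, hx⟩ := h
  refine ⟨R.mirror, hA R hR, R.isST_mirror hst, ?_, by rw [R.cost_mirror, hx]⟩
  rw [R.rotPath_mirror hG]
  have := rotPath_add (R := R) hG
  rw [hst.1, hst.2, hρ] at this
  omega

end OrthRep

/-- The rotation of the path from `s` to `t` for `β` bends; `k = σ + τ - 2`. -/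
def bendRot (f : Bool) (k β : ℤ) : ℤ := if f then -β else β - k

/-- The number of bends for the rotation `ρ` of the path from `s` to `t`. -/
def rotBend (k ρ : ℤ) : ℤ := max (-ρ) (ρ + k)

theorem rotBend_eq_iff {k ρ β : ℤ} (h : rotBend k ρ = β) : ∃ f, ρ = bendRot f k β := by
  rcases max_choice (-ρ) (ρ + k) with h1 | h1
  · exact ⟨true, by simp only [bendRot, if_true]; rw [rotBend, h1] at h; omega⟩
  · refine ⟨false, ?_⟩
    rw [rotBend, h1] at h
    simp only [bendRot, Bool.false_eq_true, if_false]
    omega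

namespace IsCostFunctions

open OrthRep

variable {G : PoleGraph V E} {w : E → ℕ → WithTop ℝ} {A : Set (OrthRep G)}
  {c : ℕ → ℕ → ℕ → WithTop ℝ}

/-- A minimal representation has one of the two rotations belonging to `β` bends, and its mirror
image has the other. So the sign `f` can be chosen freely and independently in the two parts. -/
theorem realizes [Fintype V] (hc : IsCostFunctions G w A c) (hG : G.s ≠ G.t)
    (hA : ∀ R ∈ A, R.mirror ∈ A) (f : Bool) {σ τ β : ℕ} (h : c σ τ β ≠ ⊤) :
    Realizes A w σ τ (bendRot f (σ + τ - 2) β) (c σ τ β) := by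
  obtain h1 | ⟨R, hR, hst, hβ, hx⟩ := (hc σ τ β).1
  · exact absurd h1 h
  have h2 := bends_eq hG hst
  rw [hβ] at h2
  obtain ⟨g, hg⟩ := rotBend_eq_iff (k := σ + τ - 2) (ρ := R.rotPath R.outS R.outT) (β := β)
    (by rw [h2, rotBend]; congr 1; ring)
  have h3 : Realizes A w σ τ (bendRot g (σ + τ - 2) β) (c σ τ β) := ⟨R, hR, hst, hg, hx⟩
  by_cases hfg : f = g
  · rwa [hfg]
  · convert h3.flip hG hA using 1
    cases f <;> cases g <;> simp [bendRot] at hfg ⊢ <;> ring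

theorem le_cost (hc : IsCostFunctions G w A c) (hG : G.s ≠ G.t) {σ τ : ℕ} {R : OrthRep G}
    (hR : R ∈ A) (hst : R.IsST σ τ) : ∃ (f : Bool) (β : ℕ),
      R.rotPath R.outS R.outT = bendRot f (σ + τ - 2) β ∧
      rotBend (σ + τ - 2) (R.rotPath R.outS R.outT) = β ∧ c σ τ β ≤ R.cost w := by
  have h : rotBend (σ + τ - 2) (R.rotPath R.outS R.outT) = R.bends := by
    rw [bends_eq hG hst, rotBend]; congr 1; ring
  obtain ⟨f, hf⟩ := rotBend_eq_iff h
  exact ⟨f, R.bends, hf, h, (hc σ τ R.bends).2 (Or.inr ⟨R, hR, hst, rfl, rfl⟩)⟩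

end IsCostFunctions

end GluedRestriction

/-! ### The concrete compositions -/

section Concrete

variable {V₁ E₁ V₂ E₂ V : Type}

def inlDart (a : E₁ × Bool) : (E₁ ⊕ E₂) × Bool := (Sum.inl a.1, a.2)

def inrDart (b : E₂ × Bool) : (E₁ ⊕ E₂) × Bool := (Sum.inr b.1, b.2)

theorem inlDart_injective : Function.Injective (inlDart : E₁ × Bool → (E₁ ⊕ E₂) × Bool) := by
  rintro ⟨a, x⟩ ⟨b, y⟩ h
  simpa [inlDart] using h

theorem inrDart_injective : Function.Injective (inrDart : E₂ × Bool → (E₁ ⊕ E₂) × Bool) := by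
  rintro ⟨a, x⟩ ⟨b, y⟩ h
  simpa [inrDart] using h

theorem dart_cases (x : (E₁ ⊕ E₂) × Bool) :
    (∃ a : E₁ × Bool, inlDart a = x) ∨ ∃ b : E₂ × Bool, inrDart b = x := by
  obtain ⟨e | e, b⟩ := x
  · exact Or.inl ⟨(e, b), rfl⟩
  · exact Or.inr ⟨(e, b), rfl⟩

theorem mem_range_inlDart (x : (E₁ ⊕ E₂) × Bool) :
    x ∈ Set.range (inlDart : E₁ × Bool → _) ↔ x.1.isRight = false := by
  obtain ⟨e | e, b⟩ := x <;> simp [inlDart]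

theorem mem_range_inrDart (x : (E₁ ⊕ E₂) × Bool) :
    x ∈ Set.range (inrDart : E₂ × Bool → _) ↔ x.1.isRight = true := by
  obtain ⟨e | e, b⟩ := x <;> simp [inrDart]

theorem cost_sum [Fintype E₁] [Fintype E₂] {G₁ : PoleGraph V₁ E₁} {G₂ : PoleGraph V₂ E₂}
    {G : PoleGraph V (E₁ ⊕ E₂)} {R : OrthRep G} {R₁ : OrthRep G₁} {R₂ : OrthRep G₂}
    (h₁ : ∀ a, R.eRot (inlDart a) = R₁.eRot a) (h₂ : ∀ b, R.eRot (inrDart b) = R₂.eRot b)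
    (w₁ : E₁ → ℕ → WithTop ℝ) (w₂ : E₂ → ℕ → WithTop ℝ) :
    R.cost (Sum.elim w₁ w₂) = R₁.cost w₁ + R₂.cost w₂ := by
  simp only [OrthRep.cost, Fintype.sum_sum_type, Sum.elim_inl, Sum.elim_inr, ← h₁, ← h₂]
  rfl

theorem serIncl_self (q : V₁) (p : V₂) : serIncl q p p = Sum.inl q := by simp [serIncl]

theorem serIncl_of_ne (q : V₁) {p v : V₂} (h : v ≠ p) : serIncl q p v = Sum.inr ⟨v, h⟩ := by
  simp [serIncl, h]

theorem serIncl_injective (q : V₁) (p : V₂) : Function.Injective (serIncl q p) := by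
  intro v w h
  by_cases hv : v = p <;> by_cases hw : w = p
  · rw [hv, hw]
  · rw [hv, serIncl_self, serIncl_of_ne q hw] at h; cases h
  · rw [hw, serIncl_self, serIncl_of_ne q hv] at h; cases h
  · rw [serIncl_of_ne q hv, serIncl_of_ne q hw] at h; simpa using h

theorem parIncl_left (q q' : V₁) (p p' : V₂) : parIncl q q' p p' p = Sum.inl q := by
  simp [parIncl]

theorem parIncl_right (q q' : V₁) {p p' : V₂} (h : p ≠ p') :
    parIncl q q' p p' p' = Sum.inl q' := by simp [parIncl, h.symm]

theorem parIncl_of_ne (q q' : V₁) {p p' v : V₂} (h : v ≠ p ∧ v ≠ p') :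
    parIncl q q' p p' v = Sum.inr ⟨v, h⟩ := dif_pos h

theorem series_gluing (G₁ : PoleGraph V₁ E₁) (G₂ : PoleGraph V₂ E₂) :
    SeriesGluing G₁ G₂ (series G₁ G₂) Sum.inl (serIncl G₁.t G₂.s) inlDart inrDart where
  ι₁_inj := Sum.inl_injective
  ι₂_inj := serIncl_injective _ _
  ι_cases := by
    rintro (u | ⟨w, hw⟩)
    · exact Or.inl ⟨u, rfl⟩
    · exact Or.inr ⟨w, serIncl_of_ne _ hw⟩
  J₁_inj := inlDart_injective
  J₂_inj := inrDart_injective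
  J_disj a b := by simp [inlDart, inrDart]
  J_cases := dart_cases
  tail_J₁ a := rfl
  tail_J₂ b := rfl
  rev_J₁ a := rfl
  rev_J₂ b := rfl
  share u w := by
    by_cases hw : w = G₂.s
    · subst hw; simp [serIncl_self]
    · simp [serIncl_of_ne _ hw, hw]
  s_eq := rfl
  t_eq := rfl

theorem parallel_gluing {G₁ : PoleGraph V₁ E₁} {G₂ : PoleGraph V₂ E₂} (h₁ : G₁.s ≠ G₁.t)
    (h₂ : G₂.s ≠ G₂.t) :
    ParallelGluing G₁ G₂ (parallel G₁ G₂) Sum.inl (parIncl G₁.s G₁.t G₂.s G₂.t) inlDart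
      inrDart where
  ι₁_inj := Sum.inl_injective
  ι₂_inj := by
    intro v w h
    by_cases hv : v ≠ G₂.s ∧ v ≠ G₂.t <;> by_cases hw : w ≠ G₂.s ∧ w ≠ G₂.t
    · rw [parIncl_of_ne _ _ hv, parIncl_of_ne _ _ hw] at h; simpa using h
    · simp only [parIncl, dif_pos hv, dif_neg hw] at h; split_ifs at h
    · simp only [parIncl, dif_neg hv, dif_pos hw] at h; split_ifs at h
    · simp only [parIncl, dif_neg hv, dif_neg hw] at h
      split_ifs at h <;> grind
  ι_cases := by
    rintro (u | ⟨w, hw⟩)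
    · exact Or.inl ⟨u, rfl⟩
    · exact Or.inr ⟨w, parIncl_of_ne _ _ hw⟩
  J₁_inj := inlDart_injective
  J₂_inj := inrDart_injective
  J_disj a b := by simp [inlDart, inrDart]
  J_cases := dart_cases
  tail_J₁ a := rfl
  tail_J₂ b := rfl
  rev_J₁ a := rfl
  rev_J₂ b := rfl
  share u w := by
    by_cases hw : w ≠ G₂.s ∧ w ≠ G₂.t
    · simp [parIncl_of_ne _ _ hw, hw.1, hw.2]
    · by_cases hs : w = G₂.s
      · subst hs; simp [parIncl_left, h₂]
      · have ht : w = G₂.t := by tauto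
        subst ht; simp [parIncl_right _ _ h₂, hs]
  s_eq := rfl
  t_eq := rfl

variable {G₁ : PoleGraph V₁ E₁} {G₂ : PoleGraph V₂ E₂}

theorem exists_dart_parallel (h₁ : G₁.IsSTGraph) (h₂ : G₂.IsSTGraph) (b : Bool) :
    (∃ q, (parallel G₁ G₂).tail q = (parallel G₁ G₂).s ∧ q.1.isRight = b) ∧
    ∃ q, (parallel G₁ G₂).tail q = (parallel G₁ G₂).t ∧ q.1.isRight = b := by
  have h := parallel_gluing h₁.poles_ne h₂.poles_ne
  cases b
  · obtain ⟨a, ha⟩ := h₁.exists_tail G₁.s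
    obtain ⟨a', ha'⟩ := h₁.exists_tail G₁.t
    exact ⟨⟨inlDart a, by rw [h.tail_J₁, ha, h.s_eq], rfl⟩,
      ⟨inlDart a', by rw [h.tail_J₁, ha', h.t_eq], rfl⟩⟩
  · obtain ⟨a, ha⟩ := h₂.exists_tail G₂.s
    obtain ⟨a', ha'⟩ := h₂.exists_tail G₂.t
    exact ⟨⟨inrDart a, by rw [h.tail_J₂, ha, h.s_eq, h.share_s], rfl⟩,
      ⟨inrDart a', by rw [h.tail_J₂, ha', h.t_eq, h.share_t], rfl⟩⟩

variable [Fintype E₁] [Fintype E₂]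

theorem FirstPrecedes.sideBySide {R : OrthRep (parallel G₁ G₂)}
    (h : FirstPrecedes (inlDart : E₁ × Bool → _) (inrDart : E₂ × Bool → _) R) : SideBySide R := by
  obtain ⟨h1, h2, h3, h4⟩ := h
  simp only [mem_range_inlDart, mem_range_inrDart] at h1 h2 h3 h4
  exact ⟨false, h1, h2, h3, h4⟩

/-- If the predecessor of `o` satisfied `P`, one could walk backwards from `o` around the whole
cycle without leaving `P`. -/
theorem not_mem_of_forall_next {D : Type} [Finite D] {p : Perm D} {o q : D} {P : D → Prop}
    (ho : P o) (hP : ∀ d, p.SameCycle o d → p d ≠ o → P (p d) → P d) (hq : p.SameCycle o q)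
    (hnq : ¬ P q) : ¬ P (p⁻¹ o) := by
  intro hl
  have h : ∀ n : ℕ, P ((p⁻¹ ^ n) o) := by
    intro n
    induction n with
    | zero => exact ho
    | succ n ih =>
      rw [pow_succ', Perm.mul_apply]
      set x := (p⁻¹ ^ n) o with hx
      by_cases hxo : x = o
      · rwa [hxo]
      · refine hP _ ?_ (by rwa [perm_apply_inv]) (by rwa [perm_apply_inv])
        rw [← Perm.mul_apply, ← pow_succ']
        exact Perm.sameCycle_inv.1 ⟨(n + 1 : ℕ), by rw [zpow_natCast]⟩
  obtain ⟨n, hn⟩ := (Perm.sameCycle_inv.2 hq).exists_nat_pow_eq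
  exact hnq (hn ▸ h n)

/-- The outer dart of the mirror image is the predecessor of `o`, which belongs to the other part
because both parts have darts at `v`. The condition on consecutive darts passes to the reversed
order by contraposition. -/
theorem side_mirror {V E : Type} [Fintype E] {G : PoleGraph V E} {R : OrthRep G} {v : V}
    {o : E × Bool} {S : E × Bool → Bool} {side : Bool} (hov : G.tail o = v) (ho : S o = side)
    (hP : ∀ d, G.tail d = v → R.next d ≠ o → S (R.next d) = side → S d = side)
    (hq : ∀ b, ∃ q, G.tail q = v ∧ S q = b) :
    S (R.next⁻¹ o) = !side ∧ ∀ d, G.tail d = v → R.next⁻¹ d ≠ R.next⁻¹ o →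
      S (R.next⁻¹ d) = !side → S d = !side := by
  constructor
  · obtain ⟨q, hqv, hqs⟩ := hq (!side)
    have := not_mem_of_forall_next (p := R.next) (P := fun d => S d = side) ho
      (fun d hd => hP d (((R.sameCycle_next o d).1 hd).symm.trans hov))
      ((R.sameCycle_next o q).2 (hov.trans hqv.symm)) (by simp [hqs])
    cases side <;> simpa using this
  · intro d hd hdo hs
    have h := hP (R.next⁻¹ d) (by rw [← R.tail_next, perm_apply_inv, hd])
    rw [perm_apply_inv] at h
    have h' := h (fun h' => hdo (by rw [h']))
    cases side <;> simp_all

theorem mirror_side [Fintype (V₁ ⊕ {v : V₂ // v ≠ G₂.s ∧ v ≠ G₂.t})] (h₁ : G₁.IsSTGraph)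
    (h₂ : G₂.IsSTGraph) {R : OrthRep (parallel G₁ G₂)} {side : Bool}
    (h : R.outS.1.isRight = side ∧ R.outT.1.isRight = !side ∧
      (∀ d, (parallel G₁ G₂).tail d = (parallel G₁ G₂).s → R.next d ≠ R.outS →
        (R.next d).1.isRight = side → d.1.isRight = side) ∧
      (∀ d, (parallel G₁ G₂).tail d = (parallel G₁ G₂).t → R.next d ≠ R.outT →
        (R.next d).1.isRight = !side → d.1.isRight = !side)) :
    R.mirror.outS.1.isRight = !side ∧ R.mirror.outT.1.isRight = !!side ∧
      (∀ d, (parallel G₁ G₂).tail d = (parallel G₁ G₂).s → R.mirror.next d ≠ R.mirror.outS →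
        (R.mirror.next d).1.isRight = !side → d.1.isRight = !side) ∧
      (∀ d, (parallel G₁ G₂).tail d = (parallel G₁ G₂).t → R.mirror.next d ≠ R.mirror.outT →
        (R.mirror.next d).1.isRight = !!side → d.1.isRight = !!side) := by
  obtain ⟨h3, h4, h5, h6⟩ := h
  have hS := side_mirror (S := fun d => d.1.isRight) R.tail_outS h3 h5
    fun b => (exists_dart_parallel h₁ h₂ b).1
  have hT := side_mirror (S := fun d => d.1.isRight) R.tail_outT h4 h6
    fun b => (exists_dart_parallel h₁ h₂ b).2
  exact ⟨hS.1, hT.1, hS.2, hT.2⟩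

theorem SideBySide.firstPrecedes [Fintype (V₁ ⊕ {v : V₂ // v ≠ G₂.s ∧ v ≠ G₂.t})]
    (h₁ : G₁.IsSTGraph) (h₂ : G₂.IsSTGraph) {R : OrthRep (parallel G₁ G₂)} (h : SideBySide R) :
    FirstPrecedes (inlDart : E₁ × Bool → _) (inrDart : E₂ × Bool → _) R ∨
    FirstPrecedes (inlDart : E₁ × Bool → _) (inrDart : E₂ × Bool → _) R.mirror := by
  simp only [FirstPrecedes, mem_range_inlDart, mem_range_inrDart]
  obtain ⟨side, h⟩ := h
  -- Mirroring exchanges the two values of `side`, so the second order of the parts is reduced to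
  -- the first.
  cases side
  · exact Or.inl h
  · exact Or.inr (mirror_side h₁ h₂ h)

end Concrete

end BendCost

namespace BendCost

open Equiv

/-! ### Values of representations of the compositions -/

section Values

open OrthRep

variable {V₁ E₁ V₂ E₂ : Type} [Fintype E₁] [Fintype E₂]
  {G₁ : PoleGraph V₁ E₁} {G₂ : PoleGraph V₂ E₂} {w₁ : E₁ → ℕ → WithTop ℝ}
  {w₂ : E₂ → ℕ → WithTop ℝ}

section Series

variable [Fintype (V₁ ⊕ {v : V₂ // v ≠ G₂.s})] {W : Set (V₁ ⊕ {v : V₂ // v ≠ G₂.s})}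

/-- Here `x` and `y` are the rotations of the identified vertex on the path from `s` to `t` and on
the path from `t` to `s`. Their sum is `(τ₁ - 3) + (σ₂ - 3) + 4`. -/
theorem realizes_series (h₁ : G₁.IsSTGraph) (h₂ : G₂.IsSTGraph) {σ τ₁ σ₂ τ : ℕ} {ρ₁ ρ₂ x y : ℤ}
    {v₁ v₂ : WithTop ℝ}
    (hr₁ : Realizes {R : OrthRep G₁ | R.Restricted (Sum.inl ⁻¹' W)} w₁ σ τ₁ ρ₁ v₁)
    (hr₂ : Realizes {R : OrthRep G₂ | R.Restricted (serIncl G₁.t G₂.s ⁻¹' W)} w₂ σ₂ τ ρ₂ v₂)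
    (hx : x ∈ Set.Icc (-2) 1) (hy : y ∈ Set.Icc (-2) 1) (hxy : y + x = τ₁ + σ₂ - 2)
    (hW : Sum.inl G₁.t ∈ W → y = 1 ∨ x = 1) :
    Realizes {R : OrthRep (series G₁ G₂) | R.Restricted W} (Sum.elim w₁ w₂) σ τ (ρ₁ + x + ρ₂)
      (v₁ + v₂) := by
  obtain ⟨R₁, hR₁, hst₁, rfl, rfl⟩ := hr₁
  obtain ⟨R₂, hR₂, hst₂, rfl, rfl⟩ := hr₂
  have h := series_gluing G₁ G₂
  obtain ⟨R, hl, hxR, hyR⟩ := h.exists_link h₁.poles_ne h₂.poles_ne R₁ R₂ hx hy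
    (by rw [hst₁.2, hst₂.1, hxy]; ring)
  refine ⟨R, ?_, ⟨?_, ?_⟩, by rw [hl.rot, hxR], cost_sum hl.eRot₁ hl.eRot₂ w₁ w₂⟩
  · refine h.restricted (fun a ha => hl.vRot₁ a ?_) (fun b hb => hl.vRot₂ b ?_) ?_ hR₁ hR₂
    · rintro rfl
      exact ha G₂.s ((h.share _ _).2 ⟨R₁.tail_outT, rfl⟩)
    · rintro rfl
      exact hb G₁.t ((h.share _ _).2 ⟨rfl, R₂.tail_outS⟩)
    · intro u w huw hu
      have := (h.share u w).1 huw
      rcases hW (this.1 ▸ hu) with h' | h'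
      · exact ⟨inlDart R₁.outT, by rw [h.tail_J₁, R₁.tail_outT, this.1], by rw [hyR, h']⟩
      · exact ⟨inrDart R₂.outS, by rw [h.tail_J₂, R₂.tail_outS, huw, this.2], by rw [hxR, h']⟩
  · rw [hl.outS, hl.vRot₁ _ (outS_ne_outT h₁.poles_ne), hst₁.1]
  · rw [hl.outT, hl.vRot₂ _ (outS_ne_outT h₂.poles_ne).symm, hst₂.2]

theorem exists_parts_series [Fintype V₁] [Fintype V₂] (h₁ : G₁.IsSTGraph) (h₂ : G₂.IsSTGraph)
    (hdeg : ∀ v ∈ W, (series G₁ G₂).degree v ≤ 2) {R : OrthRep (series G₁ G₂)}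
    (hR : R.Restricted W) {σ τ : ℕ} (hst : R.IsST σ τ) :
    ∃ (R₁ : OrthRep G₁) (R₂ : OrthRep G₂) (τ₁ σ₂ : ℕ) (x y : ℤ),
      R₁.Restricted (Sum.inl ⁻¹' W) ∧ R₂.Restricted (serIncl G₁.t G₂.s ⁻¹' W) ∧
      R₁.IsST σ τ₁ ∧ R₂.IsST σ₂ τ ∧ x ∈ Set.Icc (-2) 1 ∧ y ∈ Set.Icc (-2) 1 ∧
      y + x = τ₁ + σ₂ - 2 ∧ (Sum.inl G₁.t ∈ W → y = 1 ∨ x = 1) ∧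
      R.rotPath R.outS R.outT = R₁.rotPath R₁.outS R₁.outT + x + R₂.rotPath R₂.outS R₂.outT ∧
      R.cost (Sum.elim w₁ w₂) = R₁.cost w₁ + R₂.cost w₂ := by
  have h := series_gluing G₁ G₂
  obtain ⟨R₁, R₂, hl⟩ := h.exists_parts h₁ h₂ R
  obtain ⟨σ₁, τ₁, hst₁⟩ := R₁.exists_isST
  obtain ⟨σ₂, τ₂, hst₂⟩ := R₂.exists_isST
  have hσ := hst.1
  have hτ := hst.2
  rw [hl.outS, hl.vRot₁ _ (outS_ne_outT h₁.poles_ne), hst₁.1] at hσ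
  rw [hl.outT, hl.vRot₂ _ (outS_ne_outT h₂.poles_ne).symm, hst₂.2] at hτ
  obtain rfl : σ₁ = σ := by omega
  obtain rfl : τ₂ = τ := by omega
  refine ⟨R₁, R₂, τ₁, σ₂, _, R.vRot (inlDart R₁.outT), ?_, ?_, hst₁, hst₂, R.vRot_mem _,
    R.vRot_mem _, ?_, ?_, hl.rot,
    cost_sum hl.eRot₁ hl.eRot₂ w₁ w₂⟩
  · refine h.restricted_left (fun a ha => hl.vRot₁ a ?_) h₂.exists_tail hdeg hR
    rintro rfl
    exact ha G₂.s ((h.share _ _).2 ⟨R₁.tail_outT, rfl⟩)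
  · refine h.restricted_right (fun b hb => hl.vRot₂ b ?_) h₁.exists_tail hdeg hR
    rintro rfl
    exact hb G₁.t ((h.share _ _).2 ⟨rfl, R₂.tail_outS⟩)
  · rw [hl.glue, hst₁.2, hst₂.1]; ring
  · intro hW
    exact h.restricted_shared hdeg hR ((h.share _ _).2 ⟨R₁.tail_outT, R₂.tail_outS⟩)
      (by rwa [R₁.tail_outT])

end Series

section Parallel

variable {W : Set (V₁ ⊕ {v : V₂ // v ≠ G₂.s ∧ v ≠ G₂.t})}

/-- Here `p` and `q` are the rotations at `s` and `t` in the face between the parts. The conditions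
`hS` and `hT` come from the surplus `4` at each pole, as in `(σ - 3) + p = (σ₁ - 3) + (σ₂ - 3) + 4`.
The condition `hρ` says that the middle face sums to `4`, with `2 - σ₁ - τ₁ - ρ₁` for the path from
`t` to `s` of the first part. A rotation `1` in the outer face means `σ = 4` or `τ = 4`. -/
theorem realizes_parallel [Fintype (V₁ ⊕ {v : V₂ // v ≠ G₂.s ∧ v ≠ G₂.t})]
    (h₁ : G₁.IsSTGraph) (h₂ : G₂.IsSTGraph) {σ σ₁ σ₂ τ τ₁ τ₂ : ℕ}
    {ρ₁ ρ₂ p q : ℤ} {v₁ v₂ : WithTop ℝ}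
    (hr₁ : Realizes {R : OrthRep G₁ | R.Restricted (Sum.inl ⁻¹' W)} w₁ σ₁ τ₁ ρ₁ v₁)
    (hr₂ : Realizes {R : OrthRep G₂ | R.Restricted (parIncl G₁.s G₁.t G₂.s G₂.t ⁻¹' W)} w₂
      σ₂ τ₂ ρ₂ v₂)
    (hσ : σ ∈ Finset.Icc 1 4) (hτ : τ ∈ Finset.Icc 1 4)
    (hp : p ∈ Set.Icc (-2) 1) (hq : q ∈ Set.Icc (-2) 1)
    (hS : (σ₁ + σ₂ : ℤ) = σ + p - 1) (hT : (τ₁ + τ₂ : ℤ) = τ + q - 1)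
    (hρ : ρ₂ = 2 - p - q + σ₁ + τ₁ + ρ₁)
    (hWs : Sum.inl G₁.s ∈ W → σ = 4 ∨ p = 1) (hWt : Sum.inl G₁.t ∈ W → q = 1 ∨ τ = 4) :
    Realizes {R : OrthRep (parallel G₁ G₂) | R.Restricted W ∧ SideBySide R} (Sum.elim w₁ w₂) σ τ
      ρ₁ (v₁ + v₂) := by
  obtain ⟨R₁, hR₁, hst₁, rfl, rfl⟩ := hr₁
  obtain ⟨R₂, hR₂, hst₂, rfl, rfl⟩ := hr₂
  have h := parallel_gluing h₁.poles_ne h₂.poles_ne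
  have hadd := rotPath_add (R := R₁) h₁.poles_ne
  rw [hst₁.1, hst₁.2] at hadd
  rw [Finset.mem_Icc] at hσ hτ
  obtain ⟨R, hl, hf, h1, h2, h3, h4⟩ := h.exists_link h₁.poles_ne h₂.poles_ne R₁ R₂
    (xS := σ - 3) (yS := p) (xT := q) (yT := τ - 3) (by rw [Set.mem_Icc]; omega) hp hq
    (by rw [Set.mem_Icc]; omega)
    (by rw [hst₁.1, hst₂.1]; omega) (by rw [hst₁.2, hst₂.2]; omega) (by omega)
  refine ⟨R, ⟨?_, hf.sideBySide⟩, ⟨by rw [hl.outS, h1], by rw [hl.outT, h4]⟩, hl.rot,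
    cost_sum hl.eRot₁ hl.eRot₂ w₁ w₂⟩
  refine h.restricted (fun a ha => hl.vRot₁ a ?_ ?_) (fun b hb => hl.vRot₂ b ?_ ?_) ?_ hR₁ hR₂
  · rintro rfl
    exact ha G₂.s ((h.share _ _).2 (Or.inl ⟨R₁.tail_outS, rfl⟩))
  · rintro rfl
    exact ha G₂.t ((h.share _ _).2 (Or.inr ⟨R₁.tail_outT, rfl⟩))
  · rintro rfl
    exact hb G₁.s ((h.share _ _).2 (Or.inl ⟨rfl, R₂.tail_outS⟩))
  · rintro rfl
    exact hb G₁.t ((h.share _ _).2 (Or.inr ⟨rfl, R₂.tail_outT⟩))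
  · intro u w huw hu
    rcases (h.share u w).1 huw with this | this
    · rcases hWs (this.1 ▸ hu) with h' | h'
      · exact ⟨inlDart R₁.outS, by rw [h.tail_J₁, R₁.tail_outS, this.1], by rw [h1, h']; norm_num⟩
      · exact ⟨inrDart R₂.outS, by rw [h.tail_J₂, R₂.tail_outS, huw, this.2], by rw [h2, h']⟩
    · rcases hWt (this.1 ▸ hu) with h' | h'
      · exact ⟨inlDart R₁.outT, by rw [h.tail_J₁, R₁.tail_outT, this.1], by rw [h3, h']⟩
      · exact ⟨inrDart R₂.outT, by rw [h.tail_J₂, R₂.tail_outT, huw, this.2],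
          by rw [h4, h']; norm_num⟩

theorem exists_parts_parallel [Fintype V₁] [Fintype V₂] (h₁ : G₁.IsSTGraph) (h₂ : G₂.IsSTGraph)
    (hdeg : ∀ v ∈ W, (parallel G₁ G₂).degree v ≤ 2) {R : OrthRep (parallel G₁ G₂)}
    (hR : R.Restricted W)
    (hf : FirstPrecedes (inlDart : E₁ × Bool → _) (inrDart : E₂ × Bool → _) R)
    {σ τ : ℕ} (hst : R.IsST σ τ) :
    ∃ (R₁ : OrthRep G₁) (R₂ : OrthRep G₂) (σ₁ τ₁ σ₂ τ₂ : ℕ) (p q : ℤ),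
      R₁.Restricted (Sum.inl ⁻¹' W) ∧ R₂.Restricted (parIncl G₁.s G₁.t G₂.s G₂.t ⁻¹' W) ∧
      R₁.IsST σ₁ τ₁ ∧ R₂.IsST σ₂ τ₂ ∧ p ∈ Set.Icc (-2) 1 ∧ q ∈ Set.Icc (-2) 1 ∧
      (σ₁ + σ₂ : ℤ) = σ + p - 1 ∧ (τ₁ + τ₂ : ℤ) = τ + q - 1 ∧
      R₂.rotPath R₂.outS R₂.outT = 2 - p - q + σ₁ + τ₁ + R₁.rotPath R₁.outS R₁.outT ∧
      (Sum.inl G₁.s ∈ W → σ = 4 ∨ p = 1) ∧ (Sum.inl G₁.t ∈ W → q = 1 ∨ τ = 4) ∧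
      R.rotPath R.outS R.outT = R₁.rotPath R₁.outS R₁.outT ∧
      R.cost (Sum.elim w₁ w₂) = R₁.cost w₁ + R₂.cost w₂ := by
  have h := parallel_gluing h₁.poles_ne h₂.poles_ne
  obtain ⟨R₁, R₂, hl⟩ := h.exists_parts h₁ h₂ R hf
  obtain ⟨σ₁, τ₁, hst₁⟩ := R₁.exists_isST
  obtain ⟨σ₂, τ₂, hst₂⟩ := R₂.exists_isST
  have hadd := rotPath_add (R := R₁) h₁.poles_ne
  have hσ := hst.1
  have hτ := hst.2
  have hS := hl.glueS
  have hT := hl.glueT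
  have hmid := hl.mid
  rw [hl.outS] at hσ
  rw [hl.outT] at hτ
  rw [hst₁.1, hst₁.2] at hadd
  rw [hst₁.1, hst₂.1, hσ] at hS
  rw [hst₁.2, hst₂.2, hτ] at hT
  refine ⟨R₁, R₂, σ₁, τ₁, σ₂, τ₂, R.vRot (inrDart R₂.outS), R.vRot (inlDart R₁.outT), ?_, ?_, hst₁,
    hst₂, R.vRot_mem _, R.vRot_mem _, by omega, by omega, by omega, ?_, ?_, hl.rot,
    cost_sum hl.eRot₁ hl.eRot₂ w₁ w₂⟩
  · refine h.restricted_left (fun a ha => hl.vRot₁ a ?_ ?_) h₂.exists_tail hdeg hR <;> rintro rfl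
    · exact ha G₂.s ((h.share _ _).2 (Or.inl ⟨R₁.tail_outS, rfl⟩))
    · exact ha G₂.t ((h.share _ _).2 (Or.inr ⟨R₁.tail_outT, rfl⟩))
  · refine h.restricted_right (fun b hb => hl.vRot₂ b ?_ ?_) h₁.exists_tail hdeg hR <;> rintro rfl
    · exact hb G₁.s ((h.share _ _).2 (Or.inl ⟨rfl, R₂.tail_outS⟩))
    · exact hb G₁.t ((h.share _ _).2 (Or.inr ⟨rfl, R₂.tail_outT⟩))
  · intro hW
    have := h.restricted_shared hdeg hR (a := R₁.outS) (b := R₂.outS)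
      ((h.share _ _).2 (Or.inl ⟨R₁.tail_outS, R₂.tail_outS⟩)) (by rwa [R₁.tail_outS])
    rw [hσ] at this
    omega
  · intro hW
    have := h.restricted_shared hdeg hR (a := R₁.outT) (b := R₂.outT)
      ((h.share _ _).2 (Or.inr ⟨R₁.tail_outT, R₂.tail_outT⟩)) (by rwa [R₁.tail_outT])
    rw [hτ] at this
    omega

end Parallel

end Values

end BendCost

namespace BendCost

/-! ### Running programs -/

/-- The program `P`, started in `S`, terminates after at most `N` steps in a state with the
property `Q`. -/
def Runs (P : Prog) (S : State) (N : ℕ) (Q : State → Prop) : Prop :=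
  ∃ n S', Exec P S n S' ∧ n ≤ N ∧ Q S'

theorem Instr.int_add_self (r a b : ℕ) (S : State) :
    ((Instr.add r a b).apply S).int r = S.int a + S.int b := Function.update_self r _ S.int

theorem Instr.int_const_self (r : ℕ) (z : ℤ) (S : State) :
    ((Instr.const r z).apply S).int r = z := by simp [Instr.apply]

namespace Runs

variable {P P' : Prog} {S : State} {M N : ℕ} {I Q : State → Prop}

theorem mono (h : Runs P S N Q) (hM : N ≤ M) (hI : ∀ S', Q S' → I S') : Runs P S M I := by
  obtain ⟨n, S', h1, h2, h3⟩ := h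
  exact ⟨n, S', h1, h2.trans hM, hI _ h3⟩

theorem seq (h : Runs P S M I) (h' : ∀ S', I S' → Runs P' S' N Q) :
    Runs (.seq P P') S (M + N) Q := by
  obtain ⟨m, S', h1, h2, h3⟩ := h
  obtain ⟨n, S'', h4, h5, h6⟩ := h' _ h3
  exact ⟨_, _, .seq h1 h4, by omega, h6⟩

theorem instr {i : Instr} (h : Q (i.apply S)) : Runs (.instr i) S 1 Q :=
  ⟨1, _, .instr i S, le_rfl, h⟩

end Runs

/-- Repeat `P` for the values of the integer register `r` up to that of the register `b`; the
register `o` holds the number one. -/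
def Prog.loop (r b o : ℕ) (P : Prog) : Prog :=
  .while (.le r b) (.seq P (.instr (.add r r o)))

/-- Each of the `L + 1` rounds costs the body, the increment and the test; one more test ends the
loop. -/
theorem Runs.loop {r b o L N : ℕ} {P : Prog} {I : ℕ → State → Prop}
    (hI : ∀ i S, I i S → S.int r = i ∧ S.int b = L)
    (hP : ∀ i ≤ L, ∀ S, I i S → Runs P S N fun S' => I (i + 1) ((Instr.add r r o).apply S'))
    {S : State} (h : I 0 S) : Runs (Prog.loop r b o P) S ((L + 1) * (N + 2) + 1) (I (L + 1)) := by
  have key : ∀ k i S, i + k = L + 1 → I i S →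
      Runs (Prog.loop r b o P) S (k * (N + 2) + 1) (I (L + 1)) := by
    intro k
    induction k with
    | zero =>
      intro i S hi hS
      obtain ⟨h1, h2⟩ := hI i S hS
      refine ⟨1, S, .while_false ?_, by omega, by rwa [← hi]⟩
      change ¬ S.int r ≤ S.int b
      omega
    | succ k ih =>
      intro i S hi hS
      obtain ⟨h1, h2⟩ := hI i S hS
      obtain ⟨m, S', h3, h4, h5⟩ := (hP i (by omega) S hS).seq fun S' h' => Runs.instr h'
      obtain ⟨n, S'', h6, h7, h8⟩ := ih (i + 1) S' (by omega) h5
      refine ⟨_, S'', .while_true ?_ h3 h6, ?_, h8⟩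
      · change S.int r ≤ S.int b
        omega
      · rw [add_mul]
        omega
  exact key (L + 1) 0 S (by omega) h

namespace Prog

def LoopFree : Prog → Prop
  | skip => True
  | instr _ => True
  | seq P Q => P.LoopFree ∧ Q.LoopFree
  | ite _ P Q => P.LoopFree ∧ Q.LoopFree
  | .while _ _ => False

def size : Prog → ℕ
  | skip => 0
  | instr _ => 1
  | seq P Q => P.size + Q.size
  | ite _ P Q => P.size + Q.size + 1
  | .while _ _ => 0

open Classical in
/-- The final state of a loop free program. -/
noncomputable def run : Prog → State → State
  | skip, S => S
  | instr i, S => i.apply S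
  | seq P Q, S => Q.run (P.run S)
  | ite b P Q, S => if b.Holds S then P.run S else Q.run S
  | .while _ _, S => S

theorem run_seq (P Q : Prog) (S : State) : (seq P Q).run S = Q.run (P.run S) := rfl

theorem run_instr (i : Instr) (S : State) : (instr i).run S = i.apply S := rfl

theorem LoopFree.runs {P : Prog} (h : P.LoopFree) (S : State) :
    Runs P S P.size fun S' => S' = P.run S := by
  induction P generalizing S with
  | skip => exact ⟨0, S, .skip S, le_rfl, rfl⟩
  | instr i => exact Runs.instr rfl
  | seq P Q ihP ihQ => exact (ihP h.1 S).seq fun S' hS' => by subst hS'; exact ihQ h.2 _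
  | ite b P Q ihP ihQ =>
    by_cases hb : b.Holds S
    · obtain ⟨n, S', h1, h2, h3⟩ := ihP h.1 S
      exact ⟨_, S', .ite_true hb h1, by simp only [size]; omega, by simp only [run, if_pos hb, h3]⟩
    · obtain ⟨n, S', h1, h2, h3⟩ := ihQ h.2 S
      exact ⟨_, S', .ite_false hb h1, by simp only [size]; omega, by simp only [run, if_neg hb, h3]⟩
  | _ => exact h.elim

/-- The programs `f a` for the members `a` of a list, one after the other. -/
def all {α : Type} (f : α → Prog) (l : List α) : Prog := l.foldr (fun a P => .seq (f a) P) .skip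

theorem loopFree_all {α : Type} {f : α → Prog} {l : List α} (h : ∀ a, (f a).LoopFree) :
    (all f l).LoopFree := by
  induction l with
  | nil => trivial
  | cons a l ih => exact ⟨h a, ih⟩

end Prog

/-! ### Relaxation of tables -/

/-- From `S` to `S'`, the integer registers in `F` and the arrays `(k, σ, τ)` with `k ≠ 0` are
unchanged; the values in the arrays `(0, σ, τ)` are unchanged or decrease to values that satisfy
`V`. -/
structure Relaxes (F : Set ℕ) (V : ℕ → ℕ → ℤ → WithTop ℝ → Prop) (S S' : State) : Prop where
  int : ∀ j ∈ F, S'.int j = S.int j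
  arr : ∀ k, k.1 ≠ 0 → S'.arr k = S.arr k
  le : ∀ σ τ i, S'.arr (0, σ, τ) i ≤ S.arr (0, σ, τ) i
  val : ∀ σ τ i, S'.arr (0, σ, τ) i = S.arr (0, σ, τ) i ∨ V σ τ i (S'.arr (0, σ, τ) i)

/-- The values in the arrays `(0, σ, τ)` satisfy the upper bounds given by `D`. -/
def Meets (D : ℕ → ℕ → ℤ → WithTop ℝ → Prop) (S : State) : Prop :=
  ∀ σ τ i x, D σ τ i x → S.arr (0, σ, τ) i ≤ x

section Relaxes

variable {F F' : Set ℕ} {V D : ℕ → ℕ → ℤ → WithTop ℝ → Prop} {S S' S'' : State}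

theorem Relaxes.refl (F V S) : Relaxes F V S S where
  int _ _ := rfl
  arr _ _ := rfl
  le _ _ _ := le_rfl
  val _ _ _ := Or.inl rfl

theorem Relaxes.trans (h : Relaxes F V S S') (h' : Relaxes F V S' S'') : Relaxes F V S S'' where
  int j hj := (h'.int j hj).trans (h.int j hj)
  arr k hk := (h'.arr k hk).trans (h.arr k hk)
  le σ τ i := (h'.le σ τ i).trans (h.le σ τ i)
  val σ τ i := by
    rcases h'.val σ τ i with h1 | h1
    · rw [h1]; exact h.val σ τ i
    · exact Or.inr h1

theorem Relaxes.anti (h : Relaxes F V S S') (hF : F' ⊆ F) : Relaxes F' V S S' :=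
  { h with int := fun j hj => h.int j (hF hj) }

theorem Relaxes.of_int (h : ∀ j ∈ F, S'.int j = S.int j) (ha : S'.arr = S.arr) :
    Relaxes F V S S' where
  int := h
  arr k _ := by rw [ha]
  le σ τ i := by rw [ha]
  val σ τ i := Or.inl (by rw [ha])

theorem Meets.relaxes (h : Meets D S) (h' : Relaxes F V S S') : Meets D S' :=
  fun σ τ i x hx => (h'.le σ τ i).trans (h σ τ i x hx)

/-- Entries never increase, so an upper bound established by one program survives all later ones. -/
theorem relaxes_all {α : Type} {f : α → Prog} {l : List α}
    {D : α → ℕ → ℕ → ℤ → WithTop ℝ → Prop} {S₀ : State}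
    (h : ∀ a ∈ l, ∀ S, Relaxes F V S₀ S → Relaxes F V S ((f a).run S) ∧ Meets (D a) ((f a).run S))
    (hS : Relaxes F V S₀ S) : Relaxes F V S ((Prog.all f l).run S) ∧
      ∀ a ∈ l, Meets (D a) ((Prog.all f l).run S) := by
  induction l generalizing S with
  | nil => exact ⟨Relaxes.refl _ _ _, fun a ha => absurd ha List.not_mem_nil⟩
  | cons b l ih =>
    obtain ⟨h1, h2⟩ := h b List.mem_cons_self S hS
    obtain ⟨h3, h4⟩ := ih (fun a ha => h a (List.mem_cons_of_mem _ ha)) (hS.trans h1)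
    refine ⟨h1.trans h3, fun a ha => ?_⟩
    rcases List.mem_cons.1 ha with rfl | ha
    · exact h2.relaxes h3
    · exact h4 a ha

/-- The counter `r` is outside `F` because the loop changes it, yet the body has to preserve it, as
expressed by `insert r F`. -/
theorem runs_relax_loop {r b o L N : ℕ} {P : Prog} {D : ℕ → ℕ → ℕ → ℤ → WithTop ℝ → Prop}
    {S₀ : State} (hb : b ∈ F) (ho : o ∈ F) (hr : r ∉ F) (hbL : S₀.int b = L) (hoL : S₀.int o = 1)
    (hP : ∀ i ≤ L, ∀ S, Relaxes F V S₀ S → S.int r = i →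
      Runs P S N fun S' => Relaxes (insert r F) V S S' ∧ Meets (D i) S')
    (hS : Relaxes F V S₀ S) (hSr : S.int r = 0) :
    Runs (Prog.loop r b o P) S ((L + 1) * (N + 2) + 1)
      fun S' => Relaxes F V S S' ∧ ∀ i ≤ L, Meets (D i) S' := by
  refine (Runs.loop (L := L) (I := fun i S' => Relaxes F V S S' ∧ S'.int r = i ∧
    ∀ j < i, Meets (D j) S') ?_ ?_ ?_).mono le_rfl ?_
  · intro i S' h
    exact ⟨h.2.1, by rw [(hS.trans h.1).int b hb, hbL]⟩
  · intro i hi S' h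
    refine (hP i hi S' (hS.trans h.1) h.2.1).mono le_rfl fun S'' h' => ?_
    have h1 : Relaxes F V S' S'' := h'.1.anti (Set.subset_insert _ _)
    have h2 : Relaxes F V S'' ((Instr.add r r o).apply S'') := by
      refine .of_int (fun j hj => ?_) rfl
      refine Function.update_of_ne ?_ _ _
      rintro rfl
      exact hr hj
    refine ⟨h.1.trans (h1.trans h2), ?_, fun j hj => ?_⟩
    · rw [Instr.int_add_self, h'.1.int r (Set.mem_insert _ _), h.2.1,
        (hS.trans (h.1.trans h1)).int o ho, hoL]
      push_cast
      rfl
    · rcases Nat.lt_succ_iff_lt_or_eq.1 hj with hj | rfl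
      · exact (h.2.2 j hj).relaxes (h1.trans h2)
      · exact h'.2.relaxes h2
  · exact ⟨.refl _ _ _, hSr, fun j hj => absurd hj (Nat.not_lt_zero _)⟩
  · exact fun S' h => ⟨h.1, fun i hi => h.2.2 i (Nat.lt_succ_of_le hi)⟩

end Relaxes

/-! ### Building blocks -/

section Blocks

open Prog

/-- `int r :=` the rotation for `int b` bends; `int 6 = 0`. -/
def rotProg (f : Bool) (k : ℤ) (r b : ℕ) : Prog :=
  if f then .instr (.sub r 6 b) else .seq (.instr (.const r k)) (.instr (.sub r b r))

theorem loopFree_rotProg (f : Bool) (k : ℤ) (r b : ℕ) : (rotProg f k r b).LoopFree := by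
  cases f <;> simp [rotProg, LoopFree]

theorem run_rotProg (f : Bool) (k : ℤ) {r b : ℕ} {S : State} (h6 : S.int 6 = 0) (hb : b ≠ r) :
    (rotProg f k r b).run S = { S with int := Function.update S.int r (bendRot f k (S.int b)) } := by
  cases f <;> simp [rotProg, run, Instr.apply, bendRot, h6, hb]

/-- `int d :=` the number of bends for the rotation `int r`; `int 6 = 0`. -/
def bendProg (k : ℤ) (d r t : ℕ) : Prog :=
  .seq (.instr (.sub d 6 r)) <| .seq (.instr (.const t k)) <| .seq (.instr (.add t r t)) <|
    .ite (.le d t) (.instr (.add d t 6)) .skip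

theorem loopFree_bendProg (k : ℤ) (d r t : ℕ) : (bendProg k d r t).LoopFree := by
  simp [bendProg, LoopFree]

theorem run_bendProg (k : ℤ) {d r t : ℕ} {S : State} (h6 : S.int 6 = 0) (hdr : d ≠ r)
    (hdt : d ≠ t) (hrt : r ≠ t) (hd : d ≠ 6) (ht : t ≠ 6) : (bendProg k d r t).run S =
      { S with int := Function.update (Function.update S.int t (S.int r + k)) d
                (rotBend k (S.int r)) } := by
  by_cases h : -S.int r ≤ S.int r + k
  · simp [bendProg, run, Instr.apply, Test.Holds, rotBend, h6, hdr.symm, hdt, hrt,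
      hd.symm, ht.symm, h]
    rw [Function.update_comm hdt, Function.update_idem]
  · have h' : S.int r + k ≤ -S.int r := (not_le.1 h).le
    simp [bendProg, run, Instr.apply, Test.Holds, rotBend, h6, hdr.symm, hdt, hrt, h, h']
    rw [Function.update_comm hdt]

/-- Execute `P` if `p` is true or `int r ≤ 0`; `int 6 = 0`. -/
def guardProg (p : Prop) [Decidable p] (r : ℕ) (P : Prog) : Prog :=
  if p then P else .ite (.le r 6) P .skip

theorem loopFree_guardProg {p : Prop} [Decidable p] {r : ℕ} {P : Prog} (h : P.LoopFree) :
    (guardProg p r P).LoopFree := by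
  unfold guardProg
  split_ifs
  · exact h
  · exact ⟨h, trivial⟩

theorem run_guardProg_pos {p : Prop} [Decidable p] {r : ℕ} {P : Prog} {S : State}
    (h6 : S.int 6 = 0) (h : p ∨ S.int r ≤ 0) : (guardProg p r P).run S = P.run S := by
  unfold guardProg
  split_ifs with hp
  · rfl
  · simp [run, Test.Holds, h6, h.resolve_left hp]

theorem run_guardProg_neg {p : Prop} [Decidable p] {r : ℕ} {P : Prog} {S : State}
    (h6 : S.int 6 = 0) (h : ¬ (p ∨ S.int r ≤ 0)) : (guardProg p r P).run S = S := by
  rw [not_or] at h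
  simp [guardProg, run, Test.Holds, h6, h]

/-- `arr k [int i] := min (arr k [int i], arr k₁ [int i₁] + arr k₂ [int i₂])`. -/
def relaxProg (k k₁ k₂ : ℕ × ℕ × ℕ) (i i₁ i₂ : ℕ) : Prog :=
  .seq (.instr (.load 0 k₁ i₁)) <| .seq (.instr (.load 1 k₂ i₂)) <| .seq (.instr (.vadd 2 0 1)) <|
    .seq (.instr (.load 3 k i)) <| .ite (.vle 2 3) (.instr (.store k i 2)) .skip

theorem loopFree_relaxProg (k k₁ k₂ : ℕ × ℕ × ℕ) (i i₁ i₂ : ℕ) :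
    (relaxProg k k₁ k₂ i i₁ i₂).LoopFree := by simp [relaxProg, LoopFree]

theorem relaxes_relaxProg {F : Set ℕ} {V : ℕ → ℕ → ℤ → WithTop ℝ → Prop} {σ τ : ℕ}
    {k₁ k₂ : ℕ × ℕ × ℕ} {i i₁ i₂ : ℕ} {S : State}
    (hV : V σ τ (S.int i) (S.arr k₁ (S.int i₁) + S.arr k₂ (S.int i₂))) :
    Relaxes F V S ((relaxProg (0, σ, τ) k₁ k₂ i i₁ i₂).run S) ∧
      ((relaxProg (0, σ, τ) k₁ k₂ i i₁ i₂).run S).arr (0, σ, τ) (S.int i) ≤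
        S.arr k₁ (S.int i₁) + S.arr k₂ (S.int i₂) := by
  set v := S.arr k₁ (S.int i₁) + S.arr k₂ (S.int i₂) with hv
  by_cases h : v ≤ S.arr (0, σ, τ) (S.int i)
  · have hi : ((relaxProg (0, σ, τ) k₁ k₂ i i₁ i₂).run S).int = S.int := by
      simp [relaxProg, run, Instr.apply, Test.Holds, ← hv, h]
    have ha : ((relaxProg (0, σ, τ) k₁ k₂ i i₁ i₂).run S).arr = Function.update S.arr (0, σ, τ)
        (Function.update (S.arr (0, σ, τ)) (S.int i) v) := by
      simp [relaxProg, run, Instr.apply, Test.Holds, ← hv, h]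
    refine ⟨⟨fun j _ => by rw [hi], fun k hk => ?_, fun σ' τ' i' => ?_, fun σ' τ' i' => ?_⟩, ?_⟩
    · rw [ha, Function.update_of_ne]
      rintro rfl
      exact hk rfl
    · rw [ha]
      by_cases hk : ((0, σ', τ') : ℕ × ℕ × ℕ) = (0, σ, τ)
      · rw [hk, Function.update_self]
        by_cases hi' : i' = S.int i
        · rw [hi', Function.update_self]; exact h
        · rw [Function.update_of_ne hi']
      · rw [Function.update_of_ne hk]
    · rw [ha]
      by_cases hk : ((0, σ', τ') : ℕ × ℕ × ℕ) = (0, σ, τ)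
      · obtain ⟨-, rfl, rfl⟩ : (0 : ℕ) = 0 ∧ σ' = σ ∧ τ' = τ := by simpa using hk
        rw [Function.update_self]
        by_cases hi' : i' = S.int i
        · rw [hi', Function.update_self]; exact Or.inr hV
        · rw [Function.update_of_ne hi']; exact Or.inl rfl
      · rw [Function.update_of_ne hk]; exact Or.inl rfl
    · rw [ha]; simp
  · have hi : ((relaxProg (0, σ, τ) k₁ k₂ i i₁ i₂).run S).int = S.int := by
      simp [relaxProg, run, Instr.apply, Test.Holds, ← hv, h]
    have ha : ((relaxProg (0, σ, τ) k₁ k₂ i i₁ i₂).run S).arr = S.arr := by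
      simp [relaxProg, run, Instr.apply, Test.Holds, ← hv, h]
    exact ⟨.of_int (fun j _ => by rw [hi]) ha, by rw [ha]; exact (not_le.1 h).le⟩

end Blocks

/-! ### Initialization -/

section Init

open Prog

/-- Store `val 0` at the index `int 3` of the tables. -/
noncomputable def clearProg : Prog :=
  all (fun a : ℕ × ℕ => .instr (.store (0, a.1, a.2) 3 0))
    (Finset.Icc 1 4 ×ˢ Finset.Icc 1 4).toList

/-- The fourth clause ensures that cells cleared earlier stay cleared: only the value of `val 0` is
ever stored. -/
theorem run_clear (l : List (ℕ × ℕ)) (S : State) :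
    let S' := (all (fun a : ℕ × ℕ => .instr (.store (0, a.1, a.2) 3 0)) l).run S
    S'.int = S.int ∧ S'.val = S.val ∧ (∀ k, k.1 ≠ 0 → S'.arr k = S.arr k) ∧
    (∀ k i, S'.arr k i = S.arr k i ∨ S'.arr k i = S.val 0) ∧
    ∀ a ∈ l, S'.arr (0, a.1, a.2) (S.int 3) = S.val 0 := by
  induction l generalizing S with
  | nil => simp [all, run]
  | cons a l ih =>
    obtain ⟨h1, h2, h3, h4, h5⟩ := ih ((Instr.store (0, a.1, a.2) 3 0).apply S)
    refine ⟨h1, h2, fun k hk => (h3 k hk).trans ?_, fun k i => ?_, fun b hb => ?_⟩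
    · refine Function.update_of_ne ?_ _ _
      rintro rfl
      exact hk rfl
    · rcases h4 k i with h | h
      · by_cases hk : k = (0, a.1, a.2)
        · subst hk
          by_cases hi : i = S.int 3
          · subst hi
            exact Or.inr (h.trans (by simp [Instr.apply]))
          · exact Or.inl (h.trans (by simp [Instr.apply, hi]))
        · exact Or.inl (h.trans (by simp [Instr.apply, hk]))
      · exact Or.inr h
    · rcases List.mem_cons.1 hb with rfl | hb
      · rcases h4 (0, b.1, b.2) (S.int 3) with h | h
        · exact h.trans (by simp [Instr.apply])
        · exact h
      · exact h5 b hb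

/-- The registers after the initialization. -/
structure Initialized (S₀ S : State) (ℓ m : ℕ) : Prop where
  int_zero : S.int 0 = m
  int_one : S.int 1 = S₀.int 1
  int_two : S.int 2 = S₀.int 2
  int_three : S.int 3 = 0
  int_five : S.int 5 = ℓ
  int_six : S.int 6 = 0
  int_seven : S.int 7 = 1
  arr : ∀ k, k.1 ≠ 0 → S.arr k = S₀.arr k
  top : ∀ σ ∈ Finset.Icc 1 4, ∀ τ ∈ Finset.Icc 1 4, ∀ β ≤ m, S.arr (0, σ, τ) (β : ℤ) = ⊤

/-- Set the registers, with `m = a ℓ + z` for `a = 1` or `a = 2`, and fill the tables with `∞`. -/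
noncomputable def initProg (twice : Bool) (z : ℤ) : Prog :=
  .seq (.seq (.instr (.const 6 0)) <| .seq (.instr (.const 7 1)) <| .seq (.instr (.add 5 0 6)) <|
    .seq (if twice then .instr (.add 0 0 0) else .skip) <| .seq (.instr (.const 3 z)) <|
    .seq (.instr (.add 0 0 3)) <| .seq (.instr (.const 3 0)) (.instr (.vtop 0))) <|
  .seq (loop 3 0 7 clearProg) (.instr (.const 3 0))

/-- Besides the `m + 1` rounds of clearing, the bound counts at most eight instructions of setup,
the last test of the loop and the reset of the counter. -/
theorem runs_initProg (twice : Bool) (z : ℕ) {ℓ m : ℕ} {S₀ : State} (h0 : S₀.int 0 = ℓ)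
    (hm : m = (if twice then 2 * ℓ else ℓ) + z) :
    Runs (initProg twice z) S₀ ((m + 1) * (clearProg.size + 2) + 10)
      (Initialized S₀ · ℓ m) := by
  have hlf : clearProg.LoopFree := loopFree_all fun _ => trivial
  have hset : Runs (.seq (.instr (.const 6 0)) <| .seq (.instr (.const 7 1)) <|
      .seq (.instr (.add 5 0 6)) <| .seq (if twice then .instr (.add 0 0 0) else .skip) <|
      .seq (.instr (.const 3 z)) <| .seq (.instr (.add 0 0 3)) <| .seq (.instr (.const 3 0))
      (.instr (.vtop 0))) S₀ 8 fun S => S.int 0 = m ∧ S.int 1 = S₀.int 1 ∧ S.int 2 = S₀.int 2 ∧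
        S.int 3 = 0 ∧ S.int 5 = ℓ ∧ S.int 6 = 0 ∧ S.int 7 = 1 ∧ S.arr = S₀.arr ∧ S.val 0 = ⊤ := by
    cases twice
    · refine (LoopFree.runs (by simp [LoopFree]) S₀).mono (by simp [size]) ?_
      rintro S rfl
      simp [run, Instr.apply, h0, hm]
    · refine (LoopFree.runs (by simp [LoopFree]) S₀).mono (by simp [size]) ?_
      rintro S rfl
      simp [run, Instr.apply, h0, hm]
      ring
  refine (hset.seq (N := (m + 1) * (clearProg.size + 2) + 1 + 1) fun S₁ h₁ => ?_).mono (by omega)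
    fun _ h => h
  obtain ⟨hi0, hi1, hi2, hi3, hi5, hi6, hi7, ha, hv⟩ := h₁
  refine (Runs.loop (L := m) (N := clearProg.size) (I := fun i S =>
    (∀ j, j ≠ 3 → S.int j = S₁.int j) ∧ S.int 3 = i ∧ S.val 0 = ⊤ ∧
    (∀ k, k.1 ≠ 0 → S.arr k = S₀.arr k) ∧ ∀ σ ∈ Finset.Icc 1 4, ∀ τ ∈ Finset.Icc 1 4, ∀ β < i,
      S.arr (0, σ, τ) (β : ℤ) = ⊤) ?_ ?_ ?_).seq fun S h => Runs.instr ?_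
  · intro i S h
    exact ⟨h.2.1, by rw [h.1 0 (by decide), hi0]⟩
  · rintro i hi S ⟨h1, h2, h3, h4, h5⟩
    refine (hlf.runs S).mono le_rfl ?_
    rintro S' rfl
    obtain ⟨g1, g2, g3, g4, g5⟩ := run_clear
      (Finset.Icc (1 : ℕ) 4 ×ˢ Finset.Icc (1 : ℕ) 4).toList S
    refine ⟨fun j hj => ?_, ?_, ?_, fun k hk => (g3 k hk).trans (h4 k hk), fun σ hσ τ hτ β hβ => ?_⟩
    · refine (Function.update_of_ne hj _ _).trans ?_
      rw [clearProg, g1, h1 j hj]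
    · rw [Instr.int_add_self, clearProg, g1, h2, h1 7 (by decide), hi7]
      push_cast
      rfl
    · change (clearProg.run S).val 0 = ⊤
      rw [clearProg, g2, h3]
    · rcases Nat.lt_succ_iff_lt_or_eq.1 hβ with hβ | rfl
      · rcases g4 (0, σ, τ) β with h | h
        · exact h.trans (h5 σ hσ τ hτ β hβ)
        · exact h.trans h3
      · have := g5 (σ, τ) (Finset.mem_toList.2 (Finset.mem_product.2 ⟨hσ, hτ⟩))
        rw [h2, h3] at this
        exact this
  · exact ⟨fun _ _ => rfl, hi3, hv, fun k _ => by rw [ha], fun _ _ _ _ β hβ =>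
      absurd hβ (Nat.not_lt_zero _)⟩
  · obtain ⟨h1, h2, h3, h4, h5⟩ := h
    have hu : ∀ j, j ≠ 3 → ((Instr.const 3 0).apply S).int j = S₁.int j := fun j hj =>
      (Function.update_of_ne hj _ _).trans (h1 j hj)
    exact
      { int_zero := (hu 0 (by decide)).trans hi0
        int_one := (hu 1 (by decide)).trans hi1
        int_two := (hu 2 (by decide)).trans hi2
        int_three := Function.update_self 3 0 S.int
        int_five := (hu 5 (by decide)).trans hi5
        int_six := (hu 6 (by decide)).trans hi6
        int_seven := (hu 7 (by decide)).trans hi7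
        arr := h4
        top := fun σ hσ τ hτ β hβ => h5 σ hσ τ hτ β (Nat.lt_succ_of_le hβ) }

end Init

end BendCost

namespace BendCost

open Prog OrthRep

/-! ### Reading off the cost functions -/

section Tables

variable {V E : Type} [Fintype E] {G : PoleGraph V E} {w : E → ℕ → WithTop ℝ}
  {A : Set (OrthRep G)}

/-- The value `x` is `∞` or the cost of a `(σ, τ)`-orthogonal representation with `i` bends. -/
def IsValue (A : Set (OrthRep G)) (w : E → ℕ → WithTop ℝ) (σ τ : ℕ) (i : ℤ) (x : WithTop ℝ) :
    Prop :=
  x ≠ ⊤ → ∃ ρ, i = rotBend (σ + τ - 2) ρ ∧ Realizes A w σ τ ρ x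

theorem bends_eq_rotBend (hG : G.s ≠ G.t) {σ τ : ℕ} {R : OrthRep G} (h : R.IsST σ τ) :
    (R.bends : ℤ) = rotBend (σ + τ - 2) (R.rotPath R.outS R.outT) := by
  rw [bends_eq hG h, rotBend]; congr 1; ring

/-- An entry is `∞` or attained, and it is a lower bound for all representations with its
parameters, so it is their minimum. Representations of cost `∞` need no entry, which is why only
those of finite cost must have at most `m` bends. -/
theorem exists_costFunctions (hG : G.s ≠ G.t) {S₁ S : State} {F : Set ℕ} {m : ℕ}
    (htop : ∀ σ ∈ Finset.Icc 1 4, ∀ τ ∈ Finset.Icc 1 4, ∀ β ≤ m, S₁.arr (0, σ, τ) (β : ℤ) = ⊤)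
    (hS : Relaxes F (IsValue A w) S₁ S)
    (hle : ∀ R ∈ A, ∀ σ τ, R.IsST σ τ → R.cost w ≠ ⊤ →
      ∃ i ≤ (m : ℤ), rotBend (σ + τ - 2) (R.rotPath R.outS R.outT) = i ∧
        S.arr (0, σ, τ) i ≤ R.cost w) :
    ∃ c, S.HoldsTable 0 m c ∧ TopAbove m c ∧ IsCostFunctions G w A c := by
  classical
  refine ⟨fun σ τ β => if σ ∈ Finset.Icc 1 4 ∧ τ ∈ Finset.Icc 1 4 ∧ β ≤ m then
    S.arr (0, σ, τ) β else ⊤, fun σ hσ τ hτ β hβ => (if_pos ⟨hσ, hτ, hβ⟩).symm,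
    fun σ τ β hβ => if_neg fun h => absurd h.2.2 (not_le.2 hβ), fun σ τ β => ⟨?_, ?_⟩⟩
  · simp only
    split_ifs with h
    · by_cases hx : S.arr (0, σ, τ) (β : ℤ) = ⊤
      · exact Or.inl hx
      · rcases hS.val σ τ β with h1 | h1
        · exact absurd (h1.trans (htop σ h.1 τ h.2.1 β h.2.2)) hx
        · obtain ⟨ρ, hρ, R, hR, hst, hr, hc⟩ := h1 hx
          refine Or.inr ⟨R, hR, hst, ?_, hc⟩
          have := bends_eq_rotBend hG hst
          rw [hr, ← hρ] at this
          exact_mod_cast this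
    · exact Or.inl rfl
  · rintro x (rfl | ⟨R, hR, hst, rfl, rfl⟩)
    · exact le_top
    · by_cases hc : R.cost w = ⊤
      · rw [hc]; exact le_top
      · obtain ⟨i, hi, h1, h2⟩ := hle R hR σ τ hst hc
        rw [← bends_eq_rotBend hG hst] at h1
        subst h1
        simp only
        rw [if_pos ⟨hst.mem_Icc.1, hst.mem_Icc.2, by exact_mod_cast hi⟩]
        exact h2

theorem bit_le_zero {p : Prop} : bit p ≤ 0 ↔ ¬ p := by
  unfold bit
  split_ifs with h <;> simp [h]

theorem TopAbove.le {ℓ σ τ β : ℕ} {c : ℕ → ℕ → ℕ → WithTop ℝ} (h : TopAbove ℓ c)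
    (hc : c σ τ β ≠ ⊤) : β ≤ ℓ := not_lt.1 fun hβ => hc (h σ τ β hβ)

theorem bendRot_le (f : Bool) {k β : ℤ} (hk : 0 ≤ k) (hβ : 0 ≤ β) : bendRot f k β ≤ β := by
  unfold bendRot; split_ifs <;> omega

theorem le_bendRot (f : Bool) {k β : ℤ} (hk : 0 ≤ k) (hβ : 0 ≤ β) : -β - k ≤ bendRot f k β := by
  unfold bendRot; split_ifs <;> omega

end Tables

/-! ### The program for the series composition -/

section SeriesProgram

/-- Combine `int 3` bends of the first part with `int 4` bends of the second part. -/
def seriesBlock (σ τ₁ σ₂ τ : ℕ) (x y : ℤ) (f₁ f₂ : Bool) : Prog :=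
  guardProg (y = 1 ∨ x = 1) 1 <|
    .seq (rotProg f₁ (σ + τ₁ - 2) 9 3) <| .seq (rotProg f₂ (σ₂ + τ - 2) 10 4) <|
    .seq (.instr (.const 11 x)) <| .seq (.instr (.add 9 9 11)) <| .seq (.instr (.add 9 9 10)) <|
    .seq (bendProg (σ + τ - 2) 8 9 10) (relaxProg (0, σ, τ) (1, σ, τ₁) (2, σ₂, τ) 8 3 4)

theorem loopFree_seriesBlock (σ τ₁ σ₂ τ : ℕ) (x y : ℤ) (f₁ f₂ : Bool) :
    (seriesBlock σ τ₁ σ₂ τ x y f₁ f₂).LoopFree :=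
  loopFree_guardProg ⟨loopFree_rotProg .., loopFree_rotProg .., trivial, trivial, trivial,
    loopFree_bendProg .., loopFree_relaxProg ..⟩

theorem seriesBlock_spec {V : ℕ → ℕ → ℤ → WithTop ℝ → Prop} {σ τ₁ σ₂ τ : ℕ} {x y β₁ β₂ i : ℤ}
    {f₁ f₂ : Bool} {S : State} (h6 : S.int 6 = 0) (h3 : S.int 3 = β₁) (h4 : S.int 4 = β₂)
    (hi : i = rotBend (σ + τ - 2) (bendRot f₁ (σ + τ₁ - 2) β₁ + x + bendRot f₂ (σ₂ + τ - 2) β₂))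
    (hV : (y = 1 ∨ x = 1) ∨ S.int 1 ≤ 0 → V σ τ i (S.arr (1, σ, τ₁) β₁ + S.arr (2, σ₂, τ) β₂)) :
    Relaxes {j | j < 8} V S ((seriesBlock σ τ₁ σ₂ τ x y f₁ f₂).run S) ∧
      ((y = 1 ∨ x = 1) ∨ S.int 1 ≤ 0 → ((seriesBlock σ τ₁ σ₂ τ x y f₁ f₂).run S).arr (0, σ, τ) i ≤
        S.arr (1, σ, τ₁) β₁ + S.arr (2, σ₂, τ) β₂) := by
  by_cases hg : (y = 1 ∨ x = 1) ∨ S.int 1 ≤ 0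
  -- The arithmetic uses only registers from `8` on, so the block is a single relaxation in a state
  -- with the same loop counters and constants.
  · obtain ⟨g, hg8, hgj, hrun⟩ : ∃ g : ℕ → ℤ, g 8 = i ∧ (∀ j < 8, g j = S.int j) ∧
        (seriesBlock σ τ₁ σ₂ τ x y f₁ f₂).run S =
          (relaxProg (0, σ, τ) (1, σ, τ₁) (2, σ₂, τ) 8 3 4).run { S with int := g } := by
      rw [seriesBlock, run_guardProg_pos h6 hg]
      simp only [run_seq, run_instr]
      rw [run_rotProg _ _ h6 (by decide), run_rotProg _ _ (by simpa using h6) (by decide),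
        run_bendProg _ (by simpa [Instr.apply] using h6) (by decide) (by decide) (by decide)
          (by decide) (by decide)]
      refine ⟨_, ?_, ?_, rfl⟩
      · simp [Instr.apply, hi, h3, h4]
      · intro j hj
        have h8 : j ≠ 8 := by omega
        have h9 : j ≠ 9 := by omega
        have h10 : j ≠ 10 := by omega
        have h11 : j ≠ 11 := by omega
        simp [Instr.apply, h8, h9, h10, h11]
    have h := relaxes_relaxProg (F := {j | j < 8}) (V := V) (σ := σ) (τ := τ) (k₁ := (1, σ, τ₁))
      (k₂ := (2, σ₂, τ)) (i := 8) (i₁ := 3) (i₂ := 4) (S := { S with int := g })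
      (by simpa [hg8, hgj, h3, h4] using hV hg)
    rw [← hrun] at h
    simp only [hg8, hgj 3 (by decide), hgj 4 (by decide), h3, h4] at h
    exact ⟨(Relaxes.of_int (S' := { S with int := g }) hgj rfl).trans h.1, fun _ => h.2⟩
  · rw [seriesBlock, run_guardProg_neg h6 hg]
    exact ⟨.refl _ _ _, fun h => absurd h hg⟩

/-- The rotations at the poles and at the identified vertex, and which of the two parts attain
their bends on the path from `s` to `t`. -/
noncomputable def seriesCases : Finset (ℕ × ℕ × ℕ × ℕ × ℤ × ℤ × Bool × Bool) :=
  (Finset.Icc 1 4 ×ˢ Finset.Icc 1 4 ×ˢ Finset.Icc 1 4 ×ˢ Finset.Icc 1 4 ×ˢ Finset.Icc (-2) 1 ×ˢ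
    Finset.Icc (-2) 1 ×ˢ Finset.univ ×ˢ Finset.univ).filter
    fun t => t.2.2.2.2.2.1 + t.2.2.2.2.1 = t.2.1 + t.2.2.1 - 2

theorem mem_seriesCases {σ τ₁ σ₂ τ : ℕ} {x y : ℤ} {f₁ f₂ : Bool} :
    (σ, τ₁, σ₂, τ, x, y, f₁, f₂) ∈ seriesCases ↔ (σ ∈ Finset.Icc 1 4 ∧ τ₁ ∈ Finset.Icc 1 4 ∧
      σ₂ ∈ Finset.Icc 1 4 ∧ τ ∈ Finset.Icc 1 4 ∧ x ∈ Set.Icc (-2) 1 ∧ y ∈ Set.Icc (-2) 1) ∧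
      y + x = τ₁ + σ₂ - 2 := by
  simp only [seriesCases, Finset.mem_filter, Finset.mem_product, Finset.mem_univ, and_true,
    Finset.mem_Icc, Set.mem_Icc]

noncomputable def seriesBody : Prog :=
  all (fun t => seriesBlock t.1 t.2.1 t.2.2.1 t.2.2.2.1 t.2.2.2.2.1 t.2.2.2.2.2.1 t.2.2.2.2.2.2.1
    t.2.2.2.2.2.2.2) seriesCases.toList

/-- Registers `3` and `4` run through the bend numbers of the parts up to `ℓ`. The constant `14` is
`6 + 6 + 2`: each `ρᵢ` is at least `-ℓ - 6`, and the rotation `x` between them is at least `-2`. -/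
noncomputable def seriesProg : Prog :=
  .seq (initProg true 14) (loop 3 5 7 (.seq (.instr (.const 4 0)) (loop 4 5 7 seriesBody)))

theorem series_steps (ℓ a b : ℕ) :
    (2 * ℓ + 14 + 1) * (b + 2) + 10 + ((ℓ + 1) * (1 + ((ℓ + 1) * (a + 2) + 1) + 2) + 1) ≤
      (2 * a + 17 * b + 100) * (ℓ ^ 2 + 1) := by
  have h : ℓ ≤ ℓ ^ 2 := Nat.le_self_pow (by decide) ℓ
  have h1 := Nat.mul_le_mul_right a h
  have h2 := Nat.mul_le_mul_right b h
  nlinarith [Nat.zero_le (ℓ ^ 2 * a), Nat.zero_le (ℓ ^ 2 * b)]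

theorem runs_seriesProg {V₁ E₁ V₂ E₂ : Type} [Fintype V₁] [Fintype E₁] [Fintype V₂] [Fintype E₂]
    {G₁ : PoleGraph V₁ E₁} {G₂ : PoleGraph V₂ E₂} {w₁ : E₁ → ℕ → WithTop ℝ}
    {w₂ : E₂ → ℕ → WithTop ℝ} {W : Set (V₁ ⊕ {v : V₂ // v ≠ G₂.s})} {ℓ : ℕ}
    {c₁ c₂ : ℕ → ℕ → ℕ → WithTop ℝ} (h₁ : G₁.IsSTGraph) (h₂ : G₂.IsSTGraph)
    (hdeg : ∀ v ∈ W, (series G₁ G₂).degree v ≤ 2)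
    (hc₁ : IsCostFunctions G₁ w₁ {R | R.Restricted (Sum.inl ⁻¹' W)} c₁)
    (hc₂ : IsCostFunctions G₂ w₂ {R | R.Restricted (serIncl G₁.t G₂.s ⁻¹' W)} c₂)
    (ht₁ : TopAbove ℓ c₁) (ht₂ : TopAbove ℓ c₂) {S₀ : State} (hi0 : S₀.int 0 = ℓ)
    (hi1 : S₀.int 1 = bit (Sum.inl G₁.t ∈ W)) (hT₁ : S₀.HoldsTable 1 ℓ c₁)
    (hT₂ : S₀.HoldsTable 2 ℓ c₂) :
    Runs seriesProg S₀ ((2 * seriesBody.size + 17 * clearProg.size + 100) * (ℓ ^ 2 + 1))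
      fun S => S.int 0 = (2 * ℓ + 14 : ℕ) ∧ ∃ c, S.HoldsTable 0 (2 * ℓ + 14) c ∧
        TopAbove (2 * ℓ + 14) c ∧
        IsCostFunctions (series G₁ G₂) (Sum.elim w₁ w₂) {R | R.Restricted W} c := by
  classical
  have : Fintype (V₁ ⊕ {v : V₂ // v ≠ G₂.s}) := Fintype.ofFinite _
  set A : Set (OrthRep (series G₁ G₂)) := {R | R.Restricted W}
  have hmir₁ : ∀ R ∈ {R : OrthRep G₁ | R.Restricted (Sum.inl ⁻¹' W)},
      R.mirror ∈ {R : OrthRep G₁ | R.Restricted (Sum.inl ⁻¹' W)} :=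
    fun R hR => R.restricted_mirror hR
  have hmir₂ : ∀ R ∈ {R : OrthRep G₂ | R.Restricted (serIncl G₁.t G₂.s ⁻¹' W)},
      R.mirror ∈ {R : OrthRep G₂ | R.Restricted (serIncl G₁.t G₂.s ⁻¹' W)} :=
    fun R hR => R.restricted_mirror hR
  refine ((runs_initProg true 14 (m := 2 * ℓ + 14) hi0 rfl).seq
    (N := (ℓ + 1) * (1 + ((ℓ + 1) * (seriesBody.size + 2) + 1) + 2) + 1) fun S₁ hS₁ => ?_).mono
    (series_steps ℓ seriesBody.size clearProg.size) fun _ h => h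
  -- `D β₁ β₂` lists the candidate values that the body offers for the two bend numbers, with the
  -- guard for the restriction at the identified vertex.
  set D : ℕ → ℕ → ℕ → ℕ → ℤ → WithTop ℝ → Prop := fun β₁ β₂ σ τ i v =>
    ∃ τ₁ σ₂ x y f₁ f₂, (σ, τ₁, σ₂, τ, x, y, f₁, f₂) ∈ seriesCases ∧
      ((y = 1 ∨ x = 1) ∨ S₁.int 1 ≤ 0) ∧
      i = rotBend (σ + τ - 2) (bendRot f₁ (σ + τ₁ - 2) β₁ + x + bendRot f₂ (σ₂ + τ - 2) β₂) ∧
      v = c₁ σ τ₁ β₁ + c₂ σ₂ τ β₂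
  have hbody : ∀ β₁ ≤ ℓ, ∀ β₂ ≤ ℓ, ∀ S, Relaxes ({j | j < 8} \ {3, 4})
      (IsValue A (Sum.elim w₁ w₂)) S₁ S → S.int 3 = β₁ → S.int 4 = β₂ →
      Runs seriesBody S seriesBody.size fun S' =>
        Relaxes {j | j < 8} (IsValue A (Sum.elim w₁ w₂)) S S' ∧ Meets (D β₁ β₂) S' := by
    intro β₁ hβ₁ β₂ hβ₂ S hS h3 h4
    refine (LoopFree.runs (loopFree_all fun t => loopFree_seriesBlock ..) S).mono le_rfl ?_
    rintro _ rfl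
    have key := relaxes_all (F := {j | j < 8}) (V := IsValue A (Sum.elim w₁ w₂)) (S₀ := S)
      (S := S) (l := seriesCases.toList)
      (f := fun t => seriesBlock t.1 t.2.1 t.2.2.1 t.2.2.2.1 t.2.2.2.2.1 t.2.2.2.2.2.1
        t.2.2.2.2.2.2.1 t.2.2.2.2.2.2.2)
      (D := fun t σ τ i v => σ = t.1 ∧ τ = t.2.2.2.1 ∧
        ((t.2.2.2.2.2.1 = 1 ∨ t.2.2.2.2.1 = 1) ∨ S₁.int 1 ≤ 0) ∧
        i = rotBend (t.1 + t.2.2.2.1 - 2) (bendRot t.2.2.2.2.2.2.1 (t.1 + t.2.1 - 2) β₁ +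
          t.2.2.2.2.1 + bendRot t.2.2.2.2.2.2.2 (t.2.2.1 + t.2.2.2.1 - 2) β₂) ∧
        v = c₁ t.1 t.2.1 β₁ + c₂ t.2.2.1 t.2.2.2.1 β₂) ?_ (.refl _ _ _)
    · refine ⟨key.1, ?_⟩
      rintro σ τ i v ⟨τ₁, σ₂, x, y, f₁, f₂, hm, hg, hi, hv⟩
      exact key.2 _ (Finset.mem_toList.2 hm) σ τ i v ⟨rfl, rfl, hg, hi, hv⟩
    · rintro ⟨σ, τ₁, σ₂, τ, x, y, f₁, f₂⟩ ht S' hS'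
      have hm := mem_seriesCases.1 (Finset.mem_toList.1 ht)
      obtain ⟨⟨hσ, hτ₁, hσ₂, hτ, hx, hy⟩, hxy⟩ := hm
      have hv : S'.arr (1, σ, τ₁) β₁ + S'.arr (2, σ₂, τ) β₂ = c₁ σ τ₁ β₁ + c₂ σ₂ τ β₂ := by
        rw [hS'.arr _ (by simp), hS'.arr _ (by simp), hS.arr _ (by simp), hS.arr _ (by simp),
          hS₁.arr _ (by simp), hS₁.arr _ (by simp), hT₁ σ hσ τ₁ hτ₁ β₁ hβ₁,
          hT₂ σ₂ hσ₂ τ hτ β₂ hβ₂]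
      have h6 : S'.int 6 = 0 := by
        rw [hS'.int 6 (by simp), hS.int 6 (by simp), hS₁.int_six]
      have h1 : S'.int 1 = S₁.int 1 := by rw [hS'.int 1 (by simp), hS.int 1 (by simp)]
      have := seriesBlock_spec (V := IsValue A (Sum.elim w₁ w₂)) (σ := σ) (τ₁ := τ₁) (σ₂ := σ₂)
        (τ := τ) (x := x) (y := y) (f₁ := f₁) (f₂ := f₂) (S := S') h6
        ((hS'.int 3 (by simp)).trans h3) ((hS'.int 4 (by simp)).trans h4) rfl ?_
      · rw [h1, hv] at this
        refine ⟨this.1, ?_⟩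
        rintro _ _ _ _ ⟨rfl, rfl, hg, rfl, rfl⟩
        exact this.2 hg
      · rw [h1, hv]
        intro hg htop
        -- A finite candidate is the cost of a representation: both summands are finite, hence
        -- attained, with the rotations prescribed by `f₁` and `f₂`.
        obtain ⟨hf₁, hf₂⟩ := WithTop.add_ne_top.1 htop
        refine ⟨_, rfl, realizes_series h₁ h₂ (hc₁.realizes h₁.poles_ne hmir₁ f₁ hf₁)
          (hc₂.realizes h₂.poles_ne hmir₂ f₂ hf₂) hx hy hxy fun hW => hg.resolve_right ?_⟩
        rw [hS₁.int_one, hi1, bit_le_zero]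
        exact not_not.2 hW
  have hloop : Runs (loop 3 5 7 (.seq (.instr (.const 4 0)) (loop 4 5 7 seriesBody))) S₁
      ((ℓ + 1) * (1 + ((ℓ + 1) * (seriesBody.size + 2) + 1) + 2) + 1) fun S =>
        Relaxes ({j | j < 8} \ {3, 4}) (IsValue A (Sum.elim w₁ w₂)) S₁ S ∧ ∀ β₁ ≤ ℓ,
          Meets (fun σ τ i v => ∃ β₂ ≤ ℓ, D β₁ β₂ σ τ i v) S := by
    refine runs_relax_loop (S₀ := S₁) (by simp) (by simp) (by simp) hS₁.int_five hS₁.int_seven ?_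
      (.refl _ _ _) hS₁.int_three
    intro β₁ hβ₁ S hS h3
    have hconst : Relaxes (insert 3 ({j | j < 8} \ {3, 4})) (IsValue A (Sum.elim w₁ w₂)) S
        ((Instr.const 4 0).apply S) := by
      refine .of_int (fun j hj => Function.update_of_ne ?_ _ _) rfl
      rintro rfl
      simp at hj
    refine (Runs.instr (Q := fun S' => S' = (Instr.const 4 0).apply S) rfl).seq ?_
    rintro _ rfl
    have hS' := hS.trans (hconst.anti (Set.subset_insert _ _))
    have h3' : ((Instr.const 4 0).apply S).int 3 = β₁ :=
      (hconst.int 3 (Set.mem_insert _ _)).trans h3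
    have hF : insert 4 (insert 3 ({j | j < 8} \ {3, 4})) = {j : ℕ | j < 8} := by
      ext j
      simp only [Set.mem_insert_iff, Set.mem_sdiff, Set.mem_ofPred_eq, Set.mem_singleton_iff]
      omega
    refine (runs_relax_loop (F := insert 3 ({j | j < 8} \ {3, 4}))
      (V := IsValue A (Sum.elim w₁ w₂)) (D := D β₁)
      (S₀ := (Instr.const 4 0).apply S) (L := ℓ) (N := seriesBody.size) (by simp) (by simp)
      (by simp) ?_ ?_ ?_ (.refl _ _ _) (Instr.int_const_self 4 0 S)).mono le_rfl ?_
    · exact (hS'.int 5 (by simp)).trans hS₁.int_five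
    · exact (hS'.int 7 (by simp)).trans hS₁.int_seven
    · intro β₂ hβ₂ S' hS'' h4
      rw [hF]
      exact hbody β₁ hβ₁ β₂ hβ₂ S' (hS'.trans (hS''.anti (Set.subset_insert _ _)))
        ((hS''.int 3 (Set.mem_insert _ _)).trans h3') h4
    · rintro S' ⟨hr, hm⟩
      exact ⟨hconst.trans hr, fun σ τ i v ⟨β₂, hβ₂, h⟩ => hm β₂ hβ₂ σ τ i v h⟩
  refine hloop.mono le_rfl fun S hS => ⟨?_, ?_⟩
  · rw [hS.1.int 0 (by simp), hS₁.int_zero]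
  · refine exists_costFunctions ((series_gluing G₁ G₂).poles_ne h₁.poles_ne) hS₁.top hS.1 ?_
    intro R hR σ τ hst hcost
    obtain ⟨R₁, R₂, τ₁, σ₂, x, y, hR₁, hR₂, hst₁, hst₂, hx, hy, hxy, hW, hrot, hsum⟩ :=
      exists_parts_series (w₁ := w₁) (w₂ := w₂) h₁ h₂ hdeg hR hst
    obtain ⟨f₁, β₁, hf₁, -, hle₁⟩ := hc₁.le_cost h₁.poles_ne hR₁ hst₁
    obtain ⟨f₂, β₂, hf₂, -, hle₂⟩ := hc₂.le_cost h₂.poles_ne hR₂ hst₂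
    rw [hsum] at hcost ⊢
    -- Finite total cost forces finite costs of the parts, so their bend numbers are at most `ℓ` and
    -- the loops have tried this pair.
    obtain ⟨hn₁, hn₂⟩ := WithTop.add_ne_top.1 hcost
    have hβ₁ := ht₁.le (ne_top_of_le_ne_top hn₁ hle₁)
    have hβ₂ := ht₂.le (ne_top_of_le_ne_top hn₂ hle₂)
    refine ⟨_, ?_, rfl, le_trans (hS.2 β₁ hβ₁ σ τ _ (c₁ σ τ₁ β₁ + c₂ σ₂ τ β₂)
      ⟨β₂, hβ₂, τ₁, σ₂, x, y, f₁, f₂, ?_, ?_, ?_, rfl⟩) (add_le_add hle₁ hle₂)⟩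
    -- The bound on the bends: `-ρ ≤ 2ℓ + 6 + 6 + 2` and `ρ + σ + τ - 2 ≤ 2ℓ + 1 + 6`.
    · have k1 := hst₁.mem_Icc
      have k2 := hst₂.mem_Icc
      simp only [Finset.mem_Icc] at k1 k2
      have k3 := bendRot_le f₁ (k := σ + τ₁ - 2) (β := β₁) (by omega) (by omega)
      have k4 := le_bendRot f₁ (k := σ + τ₁ - 2) (β := β₁) (by omega) (by omega)
      have k5 := bendRot_le f₂ (k := σ₂ + τ - 2) (β := β₂) (by omega) (by omega)
      have k6 := le_bendRot f₂ (k := σ₂ + τ - 2) (β := β₂) (by omega) (by omega)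
      rw [Set.mem_Icc] at hx
      rw [hrot, hf₁, hf₂, rotBend]
      push_cast
      omega
    · exact mem_seriesCases.2 ⟨⟨hst₁.mem_Icc.1, hst₁.mem_Icc.2, hst₂.mem_Icc.1, hst₂.mem_Icc.2,
        hx, hy⟩, hxy⟩
    · by_cases hb : Sum.inl G₁.t ∈ W
      · exact Or.inl (hW hb)
      · right
        rwa [hS₁.int_one, hi1, bit_le_zero]
    · rw [hrot, hf₁, hf₂]

end SeriesProgram

end BendCost

namespace BendCost

open Prog OrthRep

/-! ### The program for the parallel composition -/

section ParallelProgram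

/-- Combine `int 3` bends of the first part with a representation of the second part whose number
of bends is determined. -/
def parallelBlock (σ σ₁ σ₂ τ τ₁ τ₂ : ℕ) (p q : ℤ) (f : Bool) : Prog :=
  guardProg (σ = 4 ∨ p = 1) 1 <| guardProg (q = 1 ∨ τ = 4) 2 <|
    .seq (rotProg f (σ₁ + τ₁ - 2) 9 3) <| .seq (.instr (.const 10 (2 - p - q + σ₁ + τ₁))) <|
    .seq (.instr (.add 10 10 9)) <| .seq (bendProg (σ₂ + τ₂ - 2) 11 10 12) <|
    .seq (bendProg (σ + τ - 2) 8 9 13) <|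
    .ite (.le 11 5) (relaxProg (0, σ, τ) (1, σ₁, τ₁) (2, σ₂, τ₂) 8 3 11) .skip

theorem loopFree_parallelBlock (σ σ₁ σ₂ τ τ₁ τ₂ : ℕ) (p q : ℤ) (f : Bool) :
    (parallelBlock σ σ₁ σ₂ τ τ₁ τ₂ p q f).LoopFree :=
  loopFree_guardProg <| loopFree_guardProg ⟨loopFree_rotProg .., trivial, trivial,
    loopFree_bendProg .., loopFree_bendProg .., loopFree_relaxProg .., trivial⟩

/-- The test `i₂ ≤ S.int 5` protects against cells beyond the table of the second part, whose
contents are unspecified. For the intended tables nothing is lost, since the cost function is `∞`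
there. -/
theorem parallelBlock_spec {V : ℕ → ℕ → ℤ → WithTop ℝ → Prop} {σ σ₁ σ₂ τ τ₁ τ₂ : ℕ}
    {p q β₁ i₂ i ρ : ℤ} {f : Bool} {S : State} (h6 : S.int 6 = 0) (h3 : S.int 3 = β₁)
    (hρ : ρ = bendRot f (σ₁ + τ₁ - 2) β₁) (hi : i = rotBend (σ + τ - 2) ρ)
    (hi₂ : i₂ = rotBend (σ₂ + τ₂ - 2) (2 - p - q + σ₁ + τ₁ + ρ))
    (hV : ((σ = 4 ∨ p = 1) ∨ S.int 1 ≤ 0) ∧ ((q = 1 ∨ τ = 4) ∨ S.int 2 ≤ 0) ∧ i₂ ≤ S.int 5 →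
      V σ τ i (S.arr (1, σ₁, τ₁) β₁ + S.arr (2, σ₂, τ₂) i₂)) :
    Relaxes {j | j < 8} V S ((parallelBlock σ σ₁ σ₂ τ τ₁ τ₂ p q f).run S) ∧
      (((σ = 4 ∨ p = 1) ∨ S.int 1 ≤ 0) ∧ ((q = 1 ∨ τ = 4) ∨ S.int 2 ≤ 0) ∧ i₂ ≤ S.int 5 →
        ((parallelBlock σ σ₁ σ₂ τ τ₁ τ₂ p q f).run S).arr (0, σ, τ) i ≤
          S.arr (1, σ₁, τ₁) β₁ + S.arr (2, σ₂, τ₂) i₂) := by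
  by_cases hg₁ : (σ = 4 ∨ p = 1) ∨ S.int 1 ≤ 0
  swap
  · rw [parallelBlock, run_guardProg_neg h6 hg₁]
    exact ⟨.refl _ _ _, fun h => absurd h.1 hg₁⟩
  by_cases hg₂ : (q = 1 ∨ τ = 4) ∨ S.int 2 ≤ 0
  swap
  · rw [parallelBlock, run_guardProg_pos h6 hg₁, run_guardProg_neg h6 hg₂]
    exact ⟨.refl _ _ _, fun h => absurd h.2.1 hg₂⟩
  obtain ⟨g, hg8, hg11, hgj, hrun⟩ : ∃ g : ℕ → ℤ, g 8 = i ∧ g 11 = i₂ ∧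
      (∀ j < 8, g j = S.int j) ∧ (parallelBlock σ σ₁ σ₂ τ τ₁ τ₂ p q f).run S =
        (Prog.ite (.le 11 5) (relaxProg (0, σ, τ) (1, σ₁, τ₁) (2, σ₂, τ₂) 8 3 11) .skip).run
          { S with int := g } := by
    rw [parallelBlock, run_guardProg_pos h6 hg₁, run_guardProg_pos h6 hg₂]
    simp only [run_seq, run_instr]
    rw [run_rotProg _ _ h6 (by decide), run_bendProg (σ₂ + τ₂ - 2) (by simpa [Instr.apply] using h6)
      (by decide) (by decide) (by decide) (by decide) (by decide), run_bendProg _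
      (by simpa [Instr.apply] using h6) (by decide) (by decide) (by decide) (by decide) (by decide)]
    refine ⟨_, ?_, ?_, ?_, rfl⟩
    · simp [Instr.apply, hi, hρ, h3]
    · simp [Instr.apply, hi₂, hρ, h3]
    · intro j hj
      have h8 : j ≠ 8 := by omega
      have h9 : j ≠ 9 := by omega
      have h10 : j ≠ 10 := by omega
      have h11 : j ≠ 11 := by omega
      have h12 : j ≠ 12 := by omega
      have h13 : j ≠ 13 := by omega
      simp [Instr.apply, h8, h9, h10, h11, h12, h13]
  have h0 : Relaxes {j | j < 8} V S { S with int := g } := .of_int hgj rfl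
  by_cases hg₃ : i₂ ≤ S.int 5
  · have h := relaxes_relaxProg (F := {j | j < 8}) (V := V) (σ := σ) (τ := τ) (k₁ := (1, σ₁, τ₁))
      (k₂ := (2, σ₂, τ₂)) (i := 8) (i₁ := 3) (i₂ := 11) (S := { S with int := g })
      (by simpa [hg8, hg11, hgj, h3] using hV ⟨hg₁, hg₂, hg₃⟩)
    have ht : (Test.le 11 5).Holds { S with int := g } := by
      change g 11 ≤ g 5
      rwa [hg11, hgj 5 (by decide)]
    rw [hrun, run, if_pos ht]
    simp only [hg8, hg11, hgj 3 (by decide), h3] at h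
    exact ⟨h0.trans h.1, fun _ => h.2⟩
  · have ht : ¬ (Test.le 11 5).Holds { S with int := g } := by
      change ¬ g 11 ≤ g 5
      rwa [hg11, hgj 5 (by decide)]
    rw [hrun, run, if_neg ht]
    exact ⟨h0, fun h => absurd h.2.2 hg₃⟩

/-- The rotations at the poles, and whether the first part attains its bends on the path from `s`
to `t`. -/
noncomputable def parallelCases : Finset (ℕ × ℕ × ℕ × ℕ × ℕ × ℕ × ℤ × ℤ × Bool) :=
  (Finset.Icc 1 4 ×ˢ Finset.Icc 1 4 ×ˢ Finset.Icc 1 4 ×ˢ Finset.Icc 1 4 ×ˢ Finset.Icc 1 4 ×ˢ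
    Finset.Icc 1 4 ×ˢ Finset.Icc (-2) 1 ×ˢ Finset.Icc (-2) 1 ×ˢ Finset.univ).filter
    fun t => (t.2.1 + t.2.2.1 : ℤ) = t.1 + t.2.2.2.2.2.2.1 - 1 ∧
      (t.2.2.2.2.1 + t.2.2.2.2.2.1 : ℤ) = t.2.2.2.1 + t.2.2.2.2.2.2.2.1 - 1

theorem mem_parallelCases {σ σ₁ σ₂ τ τ₁ τ₂ : ℕ} {p q : ℤ} {f : Bool} :
    (σ, σ₁, σ₂, τ, τ₁, τ₂, p, q, f) ∈ parallelCases ↔ (σ ∈ Finset.Icc 1 4 ∧ σ₁ ∈ Finset.Icc 1 4 ∧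
      σ₂ ∈ Finset.Icc 1 4 ∧ τ ∈ Finset.Icc 1 4 ∧ τ₁ ∈ Finset.Icc 1 4 ∧ τ₂ ∈ Finset.Icc 1 4 ∧
      p ∈ Set.Icc (-2) 1 ∧ q ∈ Set.Icc (-2) 1) ∧
      (σ₁ + σ₂ : ℤ) = σ + p - 1 ∧ (τ₁ + τ₂ : ℤ) = τ + q - 1 := by
  simp only [parallelCases, Finset.mem_filter, Finset.mem_product, Finset.mem_univ, and_true,
    Finset.mem_Icc, Set.mem_Icc]

noncomputable def parallelBody : Prog :=
  all (fun t => parallelBlock t.1 t.2.1 t.2.2.1 t.2.2.2.1 t.2.2.2.2.1 t.2.2.2.2.2.1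
    t.2.2.2.2.2.2.1 t.2.2.2.2.2.2.2.1 t.2.2.2.2.2.2.2.2) parallelCases.toList

/-- Only the bend number of the first part is looped over. As `ρ = ρ₁` lies between `-ℓ - 6` and
`ℓ`, both `-ρ` and `ρ + σ + τ - 2` are at most `ℓ + 6`. -/
noncomputable def parallelProg : Prog :=
  .seq (initProg false 6) (loop 3 5 7 parallelBody)

theorem parallel_steps (ℓ a b : ℕ) :
    (ℓ + 6 + 1) * (b + 2) + 10 + ((ℓ + 1) * (a + 2) + 1) ≤ (a + 7 * b + 40) * (ℓ + 1) := by
  nlinarith [Nat.zero_le (ℓ * a), Nat.zero_le (ℓ * b)]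

theorem runs_parallelProg {V₁ E₁ V₂ E₂ : Type} [Fintype V₁] [Fintype E₁] [Fintype V₂] [Fintype E₂]
    {G₁ : PoleGraph V₁ E₁} {G₂ : PoleGraph V₂ E₂} {w₁ : E₁ → ℕ → WithTop ℝ}
    {w₂ : E₂ → ℕ → WithTop ℝ} {W : Set (V₁ ⊕ {v : V₂ // v ≠ G₂.s ∧ v ≠ G₂.t})} {ℓ : ℕ}
    {c₁ c₂ : ℕ → ℕ → ℕ → WithTop ℝ} (h₁ : G₁.IsSTGraph) (h₂ : G₂.IsSTGraph)
    (hdeg : ∀ v ∈ W, (parallel G₁ G₂).degree v ≤ 2)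
    (hc₁ : IsCostFunctions G₁ w₁ {R | R.Restricted (Sum.inl ⁻¹' W)} c₁)
    (hc₂ : IsCostFunctions G₂ w₂ {R | R.Restricted (parIncl G₁.s G₁.t G₂.s G₂.t ⁻¹' W)} c₂)
    (ht₁ : TopAbove ℓ c₁) (ht₂ : TopAbove ℓ c₂) {S₀ : State} (hi0 : S₀.int 0 = ℓ)
    (hi1 : S₀.int 1 = bit (Sum.inl G₁.s ∈ W)) (hi2 : S₀.int 2 = bit (Sum.inl G₁.t ∈ W))
    (hT₁ : S₀.HoldsTable 1 ℓ c₁) (hT₂ : S₀.HoldsTable 2 ℓ c₂) :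
    Runs parallelProg S₀ ((parallelBody.size + 7 * clearProg.size + 40) * (ℓ + 1))
      fun S => S.int 0 = (ℓ + 6 : ℕ) ∧ ∃ c, S.HoldsTable 0 (ℓ + 6) c ∧ TopAbove (ℓ + 6) c ∧
        IsCostFunctions (parallel G₁ G₂) (Sum.elim w₁ w₂) {R | R.Restricted W ∧ SideBySide R} c := by
  classical
  have : Fintype (V₁ ⊕ {v : V₂ // v ≠ G₂.s ∧ v ≠ G₂.t}) := Fintype.ofFinite _
  set A : Set (OrthRep (parallel G₁ G₂)) := {R | R.Restricted W ∧ SideBySide R}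
  have hmir₁ : ∀ R ∈ {R : OrthRep G₁ | R.Restricted (Sum.inl ⁻¹' W)},
      R.mirror ∈ {R : OrthRep G₁ | R.Restricted (Sum.inl ⁻¹' W)} :=
    fun R hR => R.restricted_mirror hR
  have hmir₂ : ∀ R ∈ {R : OrthRep G₂ | R.Restricted (parIncl G₁.s G₁.t G₂.s G₂.t ⁻¹' W)},
      R.mirror ∈ {R : OrthRep G₂ | R.Restricted (parIncl G₁.s G₁.t G₂.s G₂.t ⁻¹' W)} :=
    fun R hR => R.restricted_mirror hR
  have hpoles := (parallel_gluing h₁.poles_ne h₂.poles_ne).poles_ne h₁.poles_ne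
  refine ((runs_initProg false 6 (m := ℓ + 6) hi0 rfl).seq
    (N := (ℓ + 1) * (parallelBody.size + 2) + 1) fun S₁ hS₁ => ?_).mono
    (parallel_steps ℓ parallelBody.size clearProg.size) fun _ h => h
  set D : ℕ → ℕ → ℕ → ℤ → WithTop ℝ → Prop := fun β₁ σ τ i v =>
    ∃ (σ₁ σ₂ τ₁ τ₂ : ℕ) (p q : ℤ) (f : Bool) (β₂ : ℕ),
      (σ, σ₁, σ₂, τ, τ₁, τ₂, p, q, f) ∈ parallelCases ∧ β₂ ≤ ℓ ∧
      ((σ = 4 ∨ p = 1) ∨ S₁.int 1 ≤ 0) ∧ ((q = 1 ∨ τ = 4) ∨ S₁.int 2 ≤ 0) ∧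
      i = rotBend (σ + τ - 2) (bendRot f (σ₁ + τ₁ - 2) β₁) ∧
      (β₂ : ℤ) = rotBend (σ₂ + τ₂ - 2)
        (2 - p - q + σ₁ + τ₁ + bendRot f (σ₁ + τ₁ - 2) β₁) ∧
      v = c₁ σ₁ τ₁ β₁ + c₂ σ₂ τ₂ β₂
  have hbody : ∀ β₁ ≤ ℓ, ∀ S, Relaxes ({j | j < 8} \ {3}) (IsValue A (Sum.elim w₁ w₂)) S₁ S →
      S.int 3 = β₁ → Runs parallelBody S parallelBody.size fun S' =>
        Relaxes {j | j < 8} (IsValue A (Sum.elim w₁ w₂)) S S' ∧ Meets (D β₁) S' := by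
    intro β₁ hβ₁ S hS h3
    refine (LoopFree.runs (loopFree_all fun t => loopFree_parallelBlock ..) S).mono le_rfl ?_
    rintro _ rfl
    have key := relaxes_all (F := {j | j < 8}) (V := IsValue A (Sum.elim w₁ w₂)) (S₀ := S)
      (S := S) (l := parallelCases.toList)
      (f := fun t => parallelBlock t.1 t.2.1 t.2.2.1 t.2.2.2.1 t.2.2.2.2.1 t.2.2.2.2.2.1
        t.2.2.2.2.2.2.1 t.2.2.2.2.2.2.2.1 t.2.2.2.2.2.2.2.2)
      (D := fun t σ τ i v => ∃ (σ₁ σ₂ τ₁ τ₂ : ℕ) (p q : ℤ) (f : Bool) (β₂ : ℕ),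
        t = (σ, σ₁, σ₂, τ, τ₁, τ₂, p, q, f) ∧ β₂ ≤ ℓ ∧
        ((σ = 4 ∨ p = 1) ∨ S₁.int 1 ≤ 0) ∧ ((q = 1 ∨ τ = 4) ∨ S₁.int 2 ≤ 0) ∧
        i = rotBend (σ + τ - 2) (bendRot f (σ₁ + τ₁ - 2) β₁) ∧
        (β₂ : ℤ) = rotBend (σ₂ + τ₂ - 2)
          (2 - p - q + σ₁ + τ₁ + bendRot f (σ₁ + τ₁ - 2) β₁) ∧
        v = c₁ σ₁ τ₁ β₁ + c₂ σ₂ τ₂ β₂) ?_ (.refl _ _ _)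
    · refine ⟨key.1, ?_⟩
      rintro σ τ i v ⟨σ₁, σ₂, τ₁, τ₂, p, q, f, β₂, hm, h⟩
      exact key.2 _ (Finset.mem_toList.2 hm) σ τ i v ⟨σ₁, σ₂, τ₁, τ₂, p, q, f, β₂, rfl, h⟩
    · rintro ⟨σ, σ₁, σ₂, τ, τ₁, τ₂, p, q, f⟩ ht S' hS'
      have hm := mem_parallelCases.1 (Finset.mem_toList.1 ht)
      obtain ⟨⟨hσ, hσ₁, hσ₂, hτ, hτ₁, hτ₂, hp, hq⟩, hst, hst'⟩ := hm
      have hv : ∀ β₂ : ℕ, β₂ ≤ ℓ → S'.arr (1, σ₁, τ₁) β₁ + S'.arr (2, σ₂, τ₂) β₂ =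
          c₁ σ₁ τ₁ β₁ + c₂ σ₂ τ₂ β₂ := fun β₂ hβ₂ => by
        rw [hS'.arr _ (by simp), hS'.arr _ (by simp), hS.arr _ (by simp), hS.arr _ (by simp),
          hS₁.arr _ (by simp), hS₁.arr _ (by simp), hT₁ σ₁ hσ₁ τ₁ hτ₁ β₁ hβ₁,
          hT₂ σ₂ hσ₂ τ₂ hτ₂ β₂ hβ₂]
      have hint : ∀ j < 8, j ≠ 3 → S'.int j = S₁.int j := fun j hj h3 =>
        (hS'.int j hj).trans (hS.int j ⟨hj, h3⟩)
      -- The computed index is a natural number: `max (-ρ) (ρ + k)` is nonnegative for `k = σ₂ + τ₂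
      -- - 2 ≥ 0`.
      obtain ⟨β₂, hβ₂⟩ : ∃ β₂ : ℕ, (β₂ : ℤ) = rotBend (σ₂ + τ₂ - 2)
          (2 - p - q + σ₁ + τ₁ + bendRot f (σ₁ + τ₁ - 2) β₁) := by
        rw [Finset.mem_Icc] at hσ₂ hτ₂
        refine ⟨_, Int.toNat_of_nonneg ?_⟩
        rw [rotBend]
        omega
      have := parallelBlock_spec (V := IsValue A (Sum.elim w₁ w₂)) (σ := σ) (σ₁ := σ₁) (σ₂ := σ₂)
        (τ := τ) (τ₁ := τ₁) (τ₂ := τ₂) (p := p) (q := q) (f := f) (S := S')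
        ((hint 6 (by decide) (by decide)).trans hS₁.int_six) ((hS'.int 3 (by simp)).trans h3)
        rfl rfl hβ₂ ?_
      · rw [hint 1 (by decide) (by decide), hint 2 (by decide) (by decide),
          hint 5 (by decide) (by decide), hS₁.int_five] at this
        refine ⟨this.1, ?_⟩
        rintro _ _ _ _ ⟨_, _, _, _, _, _, _, β, heq, hβ, hg, hg', rfl, hβ', rfl⟩
        simp only [Prod.mk.injEq] at heq
        obtain ⟨rfl, rfl, rfl, rfl, rfl, rfl, rfl, rfl, rfl⟩ := heq
        obtain rfl : β = β₂ := by exact_mod_cast hβ'.trans hβ₂.symm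
        rw [← hv β hβ]
        exact this.2 ⟨hg, hg', by exact_mod_cast hβ⟩
      · rw [hint 1 (by decide) (by decide), hint 2 (by decide) (by decide),
          hint 5 (by decide) (by decide), hS₁.int_five]
        rintro ⟨hg, hg', hβ⟩ htop
        rw [hv β₂ (by exact_mod_cast hβ)] at htop ⊢
        obtain ⟨hf₁, hf₂⟩ := WithTop.add_ne_top.1 htop
        -- The rotation prescribed for the second part is one of the two that belong to `β₂` bends,
        -- and `realizes` provides either of them.
        obtain ⟨g, hg₂⟩ := rotBend_eq_iff hβ₂.symm
        refine ⟨_, rfl, realizes_parallel h₁ h₂ (hc₁.realizes h₁.poles_ne hmir₁ f hf₁)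
          (hc₂.realizes h₂.poles_ne hmir₂ g hf₂) hσ hτ hp hq hst hst' hg₂.symm
          (fun hW => hg.resolve_right ?_) fun hW => hg'.resolve_right ?_⟩
        · rw [hS₁.int_one, hi1, bit_le_zero]
          exact not_not.2 hW
        · rw [hS₁.int_two, hi2, bit_le_zero]
          exact not_not.2 hW
  have hloop : Runs (loop 3 5 7 parallelBody) S₁ ((ℓ + 1) * (parallelBody.size + 2) + 1) fun S =>
      Relaxes ({j | j < 8} \ {3}) (IsValue A (Sum.elim w₁ w₂)) S₁ S ∧
        ∀ β₁ ≤ ℓ, Meets (D β₁) S := by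
    refine runs_relax_loop (S₀ := S₁) (by simp) (by simp) (by simp) hS₁.int_five hS₁.int_seven ?_
      (.refl _ _ _) hS₁.int_three
    intro β₁ hβ₁ S hS h3
    have hF : insert 3 ({j | j < 8} \ {3}) = {j : ℕ | j < 8} := by
      ext j
      simp only [Set.mem_insert_iff, Set.mem_sdiff, Set.mem_ofPred_eq, Set.mem_singleton_iff]
      omega
    rw [hF]
    exact hbody β₁ hβ₁ S hS h3
  refine hloop.mono le_rfl fun S hS => ⟨?_, ?_⟩
  · rw [hS.1.int 0 (by simp), hS₁.int_zero]
  · refine exists_costFunctions hpoles hS₁.top hS.1 ?_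
    have main : ∀ R : OrthRep (parallel G₁ G₂), R.Restricted W →
        FirstPrecedes (inlDart : E₁ × Bool → _) (inrDart : E₂ × Bool → _) R → ∀ σ τ, R.IsST σ τ →
        R.cost (Sum.elim w₁ w₂) ≠ ⊤ →
        ∃ i ≤ ((ℓ + 6 : ℕ) : ℤ), rotBend (σ + τ - 2) (R.rotPath R.outS R.outT) = i ∧
        S.arr (0, σ, τ) i ≤ R.cost (Sum.elim w₁ w₂) := by
      intro R hR hf σ τ hst hcost
      obtain ⟨R₁, R₂, σ₁, τ₁, σ₂, τ₂, p, q, hR₁, hR₂, hst₁, hst₂, hp, hq, hσ, hτ, hρ₂, hWs, hWt,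
        hrot, hsum⟩ := exists_parts_parallel (w₁ := w₁) (w₂ := w₂) h₁ h₂ hdeg hR hf hst
      obtain ⟨f₁, β₁, hf₁, -, hle₁⟩ := hc₁.le_cost h₁.poles_ne hR₁ hst₁
      obtain ⟨-, β₂, -, hf₂, hle₂⟩ := hc₂.le_cost h₂.poles_ne hR₂ hst₂
      rw [hsum] at hcost ⊢
      obtain ⟨hn₁, hn₂⟩ := WithTop.add_ne_top.1 hcost
      have hβ₁ := ht₁.le (ne_top_of_le_ne_top hn₁ hle₁)
      have hβ₂ := ht₂.le (ne_top_of_le_ne_top hn₂ hle₂)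
      refine ⟨_, ?_, rfl, le_trans (hS.2 β₁ hβ₁ σ τ _ (c₁ σ₁ τ₁ β₁ + c₂ σ₂ τ₂ β₂)
        ⟨σ₁, σ₂, τ₁, τ₂, p, q, f₁, β₂, ?_, hβ₂, ?_, ?_, ?_, ?_, rfl⟩) (add_le_add hle₁ hle₂)⟩
      · have k0 := hst.mem_Icc
        have k1 := hst₁.mem_Icc
        simp only [Finset.mem_Icc] at k0 k1
        have k3 := bendRot_le f₁ (k := σ₁ + τ₁ - 2) (β := β₁) (by omega) (by omega)
        have k4 := le_bendRot f₁ (k := σ₁ + τ₁ - 2) (β := β₁) (by omega) (by omega)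
        rw [hrot, hf₁, rotBend]
        push_cast
        omega
      · exact mem_parallelCases.2 ⟨⟨hst.mem_Icc.1, hst₁.mem_Icc.1, hst₂.mem_Icc.1, hst.mem_Icc.2,
          hst₁.mem_Icc.2, hst₂.mem_Icc.2, hp, hq⟩, hσ, hτ⟩
      · by_cases hb : Sum.inl G₁.s ∈ W
        · exact Or.inl (hWs hb)
        · right
          rwa [hS₁.int_one, hi1, bit_le_zero]
      · by_cases hb : Sum.inl G₁.t ∈ W
        · exact Or.inl (hWt hb)
        · right
          rwa [hS₁.int_two, hi2, bit_le_zero]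
      · rw [hrot, hf₁]
      · rw [← hf₂, hρ₂, hf₁]
    -- If the second part comes first at `s`, the mirror image is used; it has the same pole angles,
    -- cost and number of bends, although a different `ρ` in general.
    intro R hR σ τ hst hcost
    rcases hR.2.firstPrecedes h₁ h₂ with hf | hf
    · exact main R hR.1 hf σ τ hst hcost
    · have h := main R.mirror (R.restricted_mirror hR.1) hf σ τ (R.isST_mirror hst)
        (by rwa [R.cost_mirror])
      rwa [R.cost_mirror, ← bends_eq_rotBend hpoles (R.isST_mirror hst), R.bends_mirror hpoles,
        bends_eq_rotBend hpoles hst] at h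

end ParallelProgram

end BendCost

/-- Series composition in `O(ℓ²)` time and parallel composition in `O(ℓ)` time. The ordinary
(non-restricted) cost functions are the case `W = ∅`. -/
theorem mainTheorem10 :
    (∃ (P : Prog) (C : ℕ),
      ∀ (V₁ E₁ V₂ E₂ : Type) [Fintype V₁] [Fintype E₁] [Fintype V₂] [Fintype E₂]
        (G₁ : PoleGraph V₁ E₁) (G₂ : PoleGraph V₂ E₂)
        (w₁ : E₁ → ℕ → WithTop ℝ) (w₂ : E₂ → ℕ → WithTop ℝ)
        (W : Set (V₁ ⊕ {v : V₂ // v ≠ G₂.s}))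
        (ℓ : ℕ) (c₁ c₂ : ℕ → ℕ → ℕ → WithTop ℝ),
        G₁.IsSTGraph → G₂.IsSTGraph →
        (∀ v ∈ W, (series G₁ G₂).degree v ≤ 2) →
        IsCostFunctions G₁ w₁ {R | R.Restricted (Sum.inl ⁻¹' W)} c₁ →
        IsCostFunctions G₂ w₂ {R | R.Restricted (serIncl G₁.t G₂.s ⁻¹' W)} c₂ →
        TopAbove ℓ c₁ → TopAbove ℓ c₂ →
        ∀ S : State, S.int 0 = ℓ → S.int 1 = bit (Sum.inl G₁.t ∈ W) →
          S.HoldsTable 1 ℓ c₁ → S.HoldsTable 2 ℓ c₂ →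
          ∃ (n : ℕ) (S' : State) (m : ℕ) (c : ℕ → ℕ → ℕ → WithTop ℝ),
            Exec P S n S' ∧ n ≤ C * (ℓ ^ 2 + 1) ∧
            S'.int 0 = m ∧ S'.HoldsTable 0 m c ∧ TopAbove m c ∧
            IsCostFunctions (series G₁ G₂) (Sum.elim w₁ w₂) {R | R.Restricted W} c) ∧
    (∃ (P : Prog) (C : ℕ),
      ∀ (V₁ E₁ V₂ E₂ : Type) [Fintype V₁] [Fintype E₁] [Fintype V₂] [Fintype E₂]
        (G₁ : PoleGraph V₁ E₁) (G₂ : PoleGraph V₂ E₂)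
        (w₁ : E₁ → ℕ → WithTop ℝ) (w₂ : E₂ → ℕ → WithTop ℝ)
        (W : Set (V₁ ⊕ {v : V₂ // v ≠ G₂.s ∧ v ≠ G₂.t}))
        (ℓ : ℕ) (c₁ c₂ : ℕ → ℕ → ℕ → WithTop ℝ),
        G₁.IsSTGraph → G₂.IsSTGraph →
        (∀ v ∈ W, (parallel G₁ G₂).degree v ≤ 2) →
        IsCostFunctions G₁ w₁ {R | R.Restricted (Sum.inl ⁻¹' W)} c₁ →
        IsCostFunctions G₂ w₂ {R | R.Restricted (parIncl G₁.s G₁.t G₂.s G₂.t ⁻¹' W)} c₂ →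
        TopAbove ℓ c₁ → TopAbove ℓ c₂ →
        ∀ S : State, S.int 0 = ℓ →
          S.int 1 = bit (Sum.inl G₁.s ∈ W) → S.int 2 = bit (Sum.inl G₁.t ∈ W) →
          S.HoldsTable 1 ℓ c₁ → S.HoldsTable 2 ℓ c₂ →
          ∃ (n : ℕ) (S' : State) (m : ℕ) (c : ℕ → ℕ → ℕ → WithTop ℝ),
            Exec P S n S' ∧ n ≤ C * (ℓ + 1) ∧
            S'.int 0 = m ∧ S'.HoldsTable 0 m c ∧ TopAbove m c ∧
            IsCostFunctions (parallel G₁ G₂) (Sum.elim w₁ w₂)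
              {R | R.Restricted W ∧ SideBySide R} c) := by
  refine ⟨⟨seriesProg, 2 * seriesBody.size + 17 * clearProg.size + 100, ?_⟩,
    ⟨parallelProg, parallelBody.size + 7 * clearProg.size + 40, ?_⟩⟩
  · intro V₁ E₁ V₂ E₂ _ _ _ _ G₁ G₂ w₁ w₂ W ℓ c₁ c₂ h₁ h₂ hdeg hc₁ hc₂ ht₁ ht₂ S h0 hb hT₁ hT₂
    obtain ⟨n, S', hE, hn, h0', c, hc⟩ :=
      runs_seriesProg h₁ h₂ hdeg hc₁ hc₂ ht₁ ht₂ h0 hb hT₁ hT₂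
    exact ⟨n, S', _, c, hE, hn, h0', hc⟩
  · intro V₁ E₁ V₂ E₂ _ _ _ _ G₁ G₂ w₁ w₂ W ℓ c₁ c₂ h₁ h₂ hdeg hc₁ hc₂ ht₁ ht₂ S h0 hb hb' hT₁ hT₂
    obtain ⟨n, S', hE, hn, h0', c, hc⟩ :=
      runs_parallelProg h₁ h₂ hdeg hc₁ hc₂ ht₁ ht₂ h0 hb hb' hT₁ hT₂
    exact ⟨n, S', _, c, hE, hn, h0', hc⟩
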